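/- Let $H$ be a finite abelian group, with dual group $\widehat H$ and Fourier coupling $\langle i,a\rangle\in\mathbb T$ ($i\in H$, $a\in\widehat H$). Put $n=|H|$, $N=n^2$, identify $\ell^2(\widehat H)\simeq\mathbb C^n$, and let $W_{ia}\in U_n$, given by $W_{ia}:e_b\mapsto\langle i,b\rangle e_{a+b}$, be the Weyl matrices of $H$. Let $E\subset U_n$ be a compact subgroup containing all the matrices $W_{ia}$, with its Haar probability measure $dU$. Let $C(S_N^+)$ be the universal $C^*$-algebra generated by the entries $w_{ia,jb}$ ($i,j\in H$, $a,b\in\widehat H$) of an $N\times N$ magic matrix, that is, a matrix of projections summing up to $1$ on each row and each column. For $\xi\in M_n(\mathbb C)\simeq\mathbb C^N$, with the scalar product $\langle x,y\rangle=\frac1n\mathrm{Tr}(x^*y)$, let $\mathrm{Proj}(\xi)\in M_N(\mathbb C)$ be the orthogonal projection onto $\mathbb C\xi$. Then there is a unique morphism of unital $C^*$-algebras $$\pi:C(S_N^+)\to M_N(C(E)),\qquad w_{ia,jb}\mapsto\left[U\mapsto \mathrm{Proj}(W_{ia}UW_{jb}^*)\right],$$ and $\pi$ is stationary on its image. This means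 the following, where $B=\mathrm{Im}(\pi)$ and $v_{ia,jb}=\pi(w_{ia,jb})$. 1. $B$ is a Woronowicz algebra with fundamental matrix $v$: the matrix $v\in M_N(B)$ is unitary, its entries generate $B$ as a $C^*$-algebra, and there are morphisms of unital $C^*$-algebras $\Delta:B\to B\otimes B$, $\varepsilon:B\to\mathbb C$, $S:B\to B^{opp}$ such that, for all $x,y\in H\times\widehat H$, $$\Delta(v_{xy})=\sum_zv_{xz}\otimes v_{zy},\qquad\varepsilon(v_{xy})=\delta_{xy},\qquad S(v_{xy})=v_{yx}^*.$$ Here $B\otimes B$ is the universal $C^*$-algebraic completion of the algebraic tensor product. 2. The restriction to $B$ of the functional $\varphi(f)=\int_E\frac1N\mathrm{Tr}(f(U))\,dU$ is the Haar integration of $B$: it is a positive unital trace, and it satisfies $(\varphi\otimes id)\Delta(b)=(id\otimes\varphi)\Delta(b)=\varphi(b)1$ for all $b\in B$. -/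

import Mathlib

open scoped ComplexOrder TensorProduct

/-! ## Completion of a `*`-algebra with respect to a C*-seminorm -/

/-- A C*-seminorm on a unital complex `*`-algebra. -/
structure CStarSeminorm (A : Type*) [Ring A] [StarRing A] [Algebra ℂ A] where
  toFun : A → ℝ
  add_le : ∀ a b, toFun (a + b) ≤ toFun a + toFun b
  smul_eq : ∀ (c : ℂ) (a : A), toFun (c • a) = ‖c‖ * toFun a
  mul_le : ∀ a b, toFun (a * b) ≤ toFun a * toFun b
  star_mul_self : ∀ a, toFun (star a * a) = toFun a ^ 2

namespace CStarSeminorm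

section

variable {A : Type*} [Ring A] [StarRing A] [Algebra ℂ A]

instance : CoeFun (CStarSeminorm A) (fun _ => A → ℝ) := ⟨CStarSeminorm.toFun⟩

theorem map_zero (p : CStarSeminorm A) : p 0 = 0 := by
  simpa using p.smul_eq 0 0

theorem map_neg (p : CStarSeminorm A) (a : A) : p (-a) = p a := by
  simpa using p.smul_eq (-1) a

theorem nonneg (p : CStarSeminorm A) (a : A) : 0 ≤ p a := by
  have h := p.add_le a (-a)
  rw [add_neg_cancel, p.map_zero, p.map_neg] at h
  linarith

theorem map_star_le (p : CStarSeminorm A) (a : A) : p a ≤ p (star a) := by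
  have h : p a ^ 2 ≤ p (star a) * p a := (p.star_mul_self a) ▸ p.mul_le _ _
  rcases (p.nonneg a).eq_or_lt with h0 | h0
  · rw [← h0]; exact p.nonneg _
  · nlinarith

theorem map_star (p : CStarSeminorm A) (a : A) : p (star a) = p a :=
  le_antisymm (by simpa using p.map_star_le (star a)) (p.map_star_le a)

/-- A copy of `A`, carrying the topology of the seminorm `p`. -/
def Pre (_p : CStarSeminorm A) : Type _ := A

variable (p : CStarSeminorm A)

instance : Ring p.Pre := inferInstanceAs (Ring A)
instance : StarRing p.Pre := inferInstanceAs (StarRing A)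
instance : Algebra ℂ p.Pre := inferInstanceAs (Algebra ℂ A)
instance [StarModule ℂ A] : StarModule ℂ p.Pre := inferInstanceAs (StarModule ℂ A)

/-- The seminorm `p`, as a ring seminorm. -/
def toRingSeminorm : RingSeminorm p.Pre where
  toFun := p.toFun
  map_zero' := p.map_zero
  add_le' := p.add_le
  neg' := p.map_neg
  mul_le' := p.mul_le

noncomputable instance : SeminormedRing p.Pre where
  __ := (inferInstance : Ring p.Pre)
  __ := p.toRingSeminorm.toAddGroupSeminorm.toSeminormedAddCommGroup
  norm_mul_le := p.mul_le

theorem norm_pre (a : p.Pre) : ‖a‖ = p a := rfl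

noncomputable instance : NormedSpace ℂ p.Pre where
  norm_smul_le c a := (p.smul_eq c a).le

/-- The Hausdorff completion of `A` with respect to the C*-seminorm `p`. -/
abbrev Completion : Type _ := UniformSpace.Completion p.Pre

theorem isometry_star_pre : Isometry (star : p.Pre → p.Pre) :=
  AddMonoidHomClass.isometry_of_norm (starAddEquiv : p.Pre ≃+ p.Pre) (fun a => p.map_star a)

noncomputable instance : Star p.Completion := ⟨UniformSpace.Completion.map star⟩

theorem star_coe (a : p.Pre) : star (a : p.Completion) = ((star a : p.Pre) : p.Completion) :=
  UniformSpace.Completion.map_coe p.isometry_star_pre.uniformContinuous a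

theorem continuous_star_completion : Continuous (star : p.Completion → p.Completion) :=
  UniformSpace.Completion.continuous_map

noncomputable instance : StarRing p.Completion where
  star_involutive x := by
    induction x using UniformSpace.Completion.induction_on with
    | hp => exact isClosed_eq
              (p.continuous_star_completion.comp p.continuous_star_completion) continuous_id
    | ih a => rw [star_coe, star_coe, star_star]
  star_mul x y := by
    induction x, y using UniformSpace.Completion.induction_on₂ with
    | hp => exact isClosed_eq (p.continuous_star_completion.comp continuous_mul)
              ((p.continuous_star_completion.comp continuous_snd).mul
                (p.continuous_star_completion.comp continuous_fst))
    | ih a b =>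
      rw [← UniformSpace.Completion.coe_mul, star_coe, star_coe, star_coe, star_mul,
        UniformSpace.Completion.coe_mul]
  star_add x y := by
    induction x, y using UniformSpace.Completion.induction_on₂ with
    | hp => exact isClosed_eq (p.continuous_star_completion.comp continuous_add)
              ((p.continuous_star_completion.comp continuous_fst).add
                (p.continuous_star_completion.comp continuous_snd))
    | ih a b =>
      rw [← UniformSpace.Completion.coe_add, star_coe, star_coe, star_coe, star_add,
        UniformSpace.Completion.coe_add]

/-- The completion of a `*`-algebra with respect to a C*-seminorm is a C*-algebra. -/
noncomputable instance [StarModule ℂ A] : CStarAlgebra p.Completion where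
  norm_mul_self_le x := by
    induction x using UniformSpace.Completion.induction_on with
    | hp => exact isClosed_le (continuous_norm.mul continuous_norm)
              (continuous_norm.comp (p.continuous_star_completion.mul continuous_id))
    | ih a =>
      rw [star_coe, ← UniformSpace.Completion.coe_mul, UniformSpace.Completion.norm_coe,
        UniformSpace.Completion.norm_coe, norm_pre, norm_pre]
      exact (by rw [← sq]; exact (p.star_mul_self a).ge)
  norm_smul_le c x := norm_smul_le c x
  star_smul c x := by
    induction x using UniformSpace.Completion.induction_on with
    | hp => exact isClosed_eq (p.continuous_star_completion.comp (continuous_const_smul c))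
              ((continuous_const_smul (star c)).comp p.continuous_star_completion)
    | ih a =>
      rw [← UniformSpace.Completion.coe_smul, star_coe, star_coe, star_smul,
        UniformSpace.Completion.coe_smul]

/-- The canonical `*`-homomorphism from a `*`-algebra to its completion. -/
noncomputable def toCompletion [StarModule ℂ A] : A →⋆ₐ[ℂ] p.Completion where
  toFun a := ((show p.Pre from a) : p.Completion)
  map_one' := rfl
  map_mul' a b := UniformSpace.Completion.coe_mul (α := p.Pre) a b
  map_zero' := rfl
  map_add' a b := UniformSpace.Completion.coe_add (α := p.Pre) a b
  commutes' _ := rfl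
  map_star' a := (p.star_coe a).symm

theorem norm_toCompletion [StarModule ℂ A] (a : A) : ‖p.toCompletion a‖ = p a :=
  UniformSpace.Completion.norm_coe (E := p.Pre) a

theorem denseRange_toCompletion [StarModule ℂ A] : DenseRange p.toCompletion :=
  UniformSpace.Completion.denseRange_coe (α := p.Pre)

end

end CStarSeminorm

/-! ## Universal C*-algebras given by generators and relations -/

section Universal

variable {A : Type*} [Ring A] [StarRing A] [Algebra ℂ A]

/-- The relations `x = 0`, `x ∈ R`, are bounded: on each element of `A`, the C*-seminorms that
vanish on `R` are uniformly bounded. -/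
class BoundedRelations (R : Set A) : Prop where
  exists_bound : ∀ a : A, ∃ C : ℝ, ∀ p : CStarSeminorm A, (∀ x ∈ R, p x = 0) → p a ≤ C

/-- The zero seminorm. -/
def CStarSeminorm.zero (A : Type*) [Ring A] [StarRing A] [Algebra ℂ A] : CStarSeminorm A where
  toFun _ := 0
  add_le := by simp
  smul_eq := by simp
  mul_le := by simp
  star_mul_self := by simp

variable (R : Set A)

instance : Nonempty {p : CStarSeminorm A // ∀ x ∈ R, p x = 0} :=
  ⟨⟨CStarSeminorm.zero A, fun _ _ => rfl⟩⟩

theorem BoundedRelations.bddAbove [h : BoundedRelations R] (a : A) :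
    BddAbove (Set.range fun p : {p : CStarSeminorm A // ∀ x ∈ R, p x = 0} => p.1 a) := by
  obtain ⟨C, hC⟩ := h.exists_bound a
  exact ⟨C, by rintro _ ⟨p, rfl⟩; exact hC p.1 p.2⟩

/-- The greatest C*-seminorm on `A` that vanishes on `R`. -/
noncomputable def maxCStarSeminorm [h : BoundedRelations R] : CStarSeminorm A where
  toFun a := ⨆ p : {p : CStarSeminorm A // ∀ x ∈ R, p x = 0}, p.1 a
  add_le a b := ciSup_le fun p => (p.1.add_le a b).trans
    (add_le_add (le_ciSup (h.bddAbove R a) p) (le_ciSup (h.bddAbove R b) p))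
  smul_eq c a := by
    rw [Real.mul_iSup_of_nonneg (norm_nonneg c)]
    exact iSup_congr fun p => p.1.smul_eq c a
  mul_le a b := ciSup_le fun p => (p.1.mul_le a b).trans
    (mul_le_mul (le_ciSup (h.bddAbove R a) p) (le_ciSup (h.bddAbove R b) p) (p.1.nonneg b)
      ((p.1.nonneg a).trans (le_ciSup (h.bddAbove R a) p)))
  star_mul_self a := by
    have h0 : (0 : ℝ) ≤ ⨆ p : {p : CStarSeminorm A // ∀ x ∈ R, p x = 0}, p.1 a :=
      Real.iSup_nonneg fun p => p.1.nonneg a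
    refine le_antisymm (ciSup_le fun p => ?_) ?_
    · rw [p.1.star_mul_self]
      exact pow_le_pow_left₀ (p.1.nonneg a) (le_ciSup (h.bddAbove R a) p) 2
    · refine (pow_le_pow_left₀ h0 (ciSup_le fun p => ?_) 2).trans_eq (Real.sq_sqrt
        (Real.iSup_nonneg fun p => p.1.nonneg (star a * a)))
      refine Real.le_sqrt_of_sq_le ?_
      rw [← p.1.star_mul_self]
      exact le_ciSup (h.bddAbove R (star a * a)) p

/-- The universal C*-algebra of the `*`-algebra `A`, subject to the relations `x = 0`, `x ∈ R`:
the completion of `A` with respect to the greatest C*-seminorm that vanishes on `R`. -/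
abbrev UniversalCStar [BoundedRelations R] : Type _ := (maxCStarSeminorm R).Completion

theorem le_maxCStarSeminorm [h : BoundedRelations R] (p : CStarSeminorm A)
    (hp : ∀ x ∈ R, p x = 0) (a : A) : p a ≤ maxCStarSeminorm R a :=
  le_ciSup (h.bddAbove R a)
    (⟨p, hp⟩ : {p : CStarSeminorm A // ∀ x ∈ R, p x = 0})

theorem maxCStarSeminorm_relation [BoundedRelations R] {x : A} (hx : x ∈ R) :
    maxCStarSeminorm R x = 0 :=
  le_antisymm (ciSup_le fun p => (p.2 x hx).le) ((maxCStarSeminorm R).nonneg x)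

/-- The C*-seminorm `a ↦ ‖f a‖` given by a `*`-homomorphism `f` to a C*-algebra. -/
def CStarSeminorm.ofStarHom {D : Type*} [CStarAlgebra D] (f : A →⋆ₐ[ℂ] D) : CStarSeminorm A where
  toFun a := ‖f a‖
  add_le a b := by rw [map_add]; exact norm_add_le _ _
  smul_eq c a := by rw [map_smul, norm_smul]
  mul_le a b := by rw [map_mul]; exact norm_mul_le _ _
  star_mul_self a := by rw [map_mul, StarHomClass.map_star, CStarRing.norm_star_mul_self, sq]

variable [StarModule ℂ A]

/-- The relations `x = 0`, `x ∈ R`, hold in the universal C*-algebra. -/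
theorem universalCStar_relation [BoundedRelations R] {x : A} (hx : x ∈ R) :
    (maxCStarSeminorm R).toCompletion x = 0 := by
  rw [← norm_eq_zero, CStarSeminorm.norm_toCompletion, maxCStarSeminorm_relation R hx]

/-- The universal property: a `*`-homomorphism from `A` to a C*-algebra in which the relations hold
extends uniquely to the universal C*-algebra. -/
theorem universalCStar_existsUnique_lift [BoundedRelations R] {D : Type*} [CStarAlgebra D]
    (f : A →⋆ₐ[ℂ] D) (hf : ∀ x ∈ R, f x = 0) :
    ∃! F : UniversalCStar R →⋆ₐ[ℂ] D, ∀ a, F ((maxCStarSeminorm R).toCompletion a) = f a := by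
  set q := maxCStarSeminorm R with hq
  have hle : ∀ a : q.Pre, ‖(show D from f a)‖ ≤ 1 * ‖a‖ := fun a => by
    rw [one_mul]
    exact le_maxCStarSeminorm R (CStarSeminorm.ofStarHom f)
      (fun x hx => by change ‖f x‖ = 0; rw [hf x hx, norm_zero]) a
  let g : q.Pre →+* D := (f : A →+* D)
  have hg : Continuous g :=
    AddMonoidHomClass.continuous_of_bound g 1 hle
  let G : q.Completion →+* D := UniformSpace.Completion.extensionHom g hg
  have hGc : Continuous G := UniformSpace.Completion.continuous_extension
  have hG : ∀ a : A, G (q.toCompletion a) = f a := fun a =>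
    UniformSpace.Completion.extensionHom_coe g hg a
  refine ⟨{ G with
    commutes' := fun c => ?_
    map_star' := fun x => ?_ }, hG, fun F hF => ?_⟩
  · have h := hG (algebraMap ℂ A c)
    rw [AlgHomClass.commutes f] at h
    exact h
  · change G (star x) = star (G x)
    induction x using UniformSpace.Completion.induction_on with
    | hp => exact isClosed_eq (hGc.comp q.continuous_star_completion) hGc.star
    | ih a =>
      have h := hG (star (show A from a))
      rw [StarHomClass.map_star f, ← hG, StarHomClass.map_star q.toCompletion] at h
      exact h
  · apply DFunLike.coe_injective
    have hFc : Continuous F :=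
      AddMonoidHomClass.continuous_of_bound F 1
        (fun x => by rw [one_mul]; exact NonUnitalStarAlgHom.norm_apply_le F x)
    refine q.denseRange_toCompletion.equalizer hFc hGc (funext fun a => ?_)
    exact (hF a).trans (hG a).symm

end Universal

/-! ## The maximal tensor product -/

section MaxTensor

variable (A B : Type*) [CStarAlgebra A] [CStarAlgebra B]

instance boundedRelations_tensor : BoundedRelations (∅ : Set (A ⊗[ℂ] B)) where
  exists_bound t := by
    induction t using TensorProduct.induction_on with
    | zero => exact ⟨0, fun p _ => p.map_zero.le⟩
    | add x y hx hy =>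
      obtain ⟨C, hC⟩ := hx
      obtain ⟨C', hC'⟩ := hy
      exact ⟨C + C', fun p hp => (p.add_le x y).trans (add_le_add (hC p hp) (hC' p hp))⟩
    | tmul a b =>
      refine ⟨‖a‖ * ‖b‖, fun p _ => ?_⟩
      let f : A →⋆ₐ[ℂ] A ⊗[ℂ] B :=
        { (Algebra.TensorProduct.includeLeft : A →ₐ[ℂ] A ⊗[ℂ] B) with
          map_star' := fun x => by simp }
      let g : B →⋆ₐ[ℂ] A ⊗[ℂ] B :=
        { (Algebra.TensorProduct.includeRight : B →ₐ[ℂ] A ⊗[ℂ] B) with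
          map_star' := fun x => by simp }
      have h1 : p (a ⊗ₜ 1) ≤ ‖a‖ := by
        rw [← p.norm_toCompletion]
        exact NonUnitalStarAlgHom.norm_apply_le (p.toCompletion.comp f) a
      have h2 : p ((1 : A) ⊗ₜ b) ≤ ‖b‖ := by
        rw [← p.norm_toCompletion]
        exact NonUnitalStarAlgHom.norm_apply_le (p.toCompletion.comp g) b
      calc p (a ⊗ₜ b) = p ((a ⊗ₜ 1) * (1 ⊗ₜ b)) := by simp
        _ ≤ _ := p.mul_le _ _
        _ ≤ _ := mul_le_mul h1 h2 (p.nonneg _) (norm_nonneg _)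

/-- The C*-algebra tensor product `A ⊗ B`: the universal C*-algebraic completion of the algebraic
tensor product. -/
abbrev MaxTensor : Type _ := UniversalCStar (∅ : Set (A ⊗[ℂ] B))

variable {A B}

/-- The elementary tensor `a ⊗ b` in the C*-algebra tensor product. -/
noncomputable def maxTmul (a : A) (b : B) : MaxTensor A B :=
  (maxCStarSeminorm (∅ : Set (A ⊗[ℂ] B))).toCompletion (a ⊗ₜ[ℂ] b)

end MaxTensor

/-! ## The algebra `C(S_N^+)` -/

section FreeStar

variable {X : Type*}

/-- The free complex `*`-algebra on self-adjoint generators indexed by `X`. -/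
abbrev FreeStarAlgebra (X : Type*) : Type _ := MonoidAlgebra ℂ (FreeMonoid X)

/-- The involution `∑ c_w w ↦ ∑ conj(c_w) rev(w)`. -/
noncomputable def freeStarHom (X : Type*) : FreeStarAlgebra X →+ FreeStarAlgebra X :=
  MonoidAlgebra.liftNC
    ((MonoidAlgebra.singleAddHom (1 : FreeMonoid X)).comp (starRingEnd ℂ : ℂ →+ ℂ))
    (fun w => MonoidAlgebra.single (star w) 1)

theorem freeStarHom_single (w : FreeMonoid X) (c : ℂ) :
    freeStarHom X (MonoidAlgebra.single w c) = MonoidAlgebra.single (star w) (star c) := by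
  simp [freeStarHom, MonoidAlgebra.single_mul_single]

noncomputable instance : StarRing (FreeStarAlgebra X) where
  star := freeStarHom X
  star_involutive x := by
    change ((freeStarHom X).comp (freeStarHom X)) x = AddMonoidHom.id _ x
    congr 1
    ext w c : 2
    simp [freeStarHom_single]
  star_mul x y := by
    change freeStarHom X (x * y) = freeStarHom X y * freeStarHom X x
    induction x using MonoidAlgebra.induction_linear with
    | zero => simp
    | add x x' hx hx' => rw [add_mul, map_add, map_add, mul_add, hx, hx']
    | single w c =>
      induction y using MonoidAlgebra.induction_linear with
      | zero => simp
      | add y y' hy hy' => rw [mul_add, map_add, map_add, add_mul, hy, hy']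
      | single v d =>
        simp only [MonoidAlgebra.single_mul_single, freeStarHom_single, star_mul]
  star_add := map_add _

theorem star_freeStarAlgebra_single (w : FreeMonoid X) (c : ℂ) :
    star (MonoidAlgebra.single w c : FreeStarAlgebra X) =
      MonoidAlgebra.single (star w) (star c) :=
  freeStarHom_single w c

instance : StarModule ℂ (FreeStarAlgebra X) where
  star_smul c x := by
    induction x using MonoidAlgebra.induction_linear with
    | zero => simp
    | add x x' hx hx' => rw [smul_add, star_add, star_add, smul_add, hx, hx']
    | single w d =>
      simp only [MonoidAlgebra.smul_single, star_freeStarAlgebra_single, smul_eq_mul, star_mul']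

/-- The generators of the free `*`-algebra. -/
noncomputable def freeStarGen (x : X) : FreeStarAlgebra X :=
  MonoidAlgebra.single (FreeMonoid.of x) 1

theorem star_freeStarGen (x : X) : star (freeStarGen x) = freeStarGen x := by
  simp [freeStarGen, star_freeStarAlgebra_single]

end FreeStar

section QuantumPermutation

variable (ι : Type*) [Fintype ι]

/-- The relations saying that the matrix of (self-adjoint) generators is magic: its entries are
projections, which sum up to `1` on each row and each column. -/
def magicRelations : Set (FreeStarAlgebra (ι × ι)) :=
  {x | (∃ i j, x = freeStarGen (i, j) * freeStarGen (i, j) - freeStarGen (i, j)) ∨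
    (∃ i, x = ∑ j, freeStarGen (i, j) - 1) ∨ (∃ j, x = ∑ i, freeStarGen (i, j) - 1)}

theorem magic_gen_le_one (p : CStarSeminorm (FreeStarAlgebra (ι × ι)))
    (hp : ∀ x ∈ magicRelations ι, p x = 0) (k : ι × ι) : p (freeStarGen k) ≤ 1 := by
  set e : FreeStarAlgebra (ι × ι) := freeStarGen k
  have h0 : p (e * e - e) = 0 := hp _ (Or.inl ⟨k.1, k.2, rfl⟩)
  have h1 : p e ^ 2 = p (e * e) := by
    rw [← p.star_mul_self, star_freeStarGen]
  have h2 : p (e * e) ≤ p (e * e - e) + p e := by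
    simpa using p.add_le (e * e - e) e
  have h3 := p.nonneg e
  nlinarith

instance boundedRelations_magic : BoundedRelations (magicRelations ι) where
  exists_bound x := by
    induction x using MonoidAlgebra.induction_linear with
    | zero => exact ⟨0, fun p _ => p.map_zero.le⟩
    | add x y hx hy =>
      obtain ⟨C, hC⟩ := hx
      obtain ⟨C', hC'⟩ := hy
      exact ⟨C + C', fun p hp => (p.add_le x y).trans (add_le_add (hC p hp) (hC' p hp))⟩
    | single w c =>
      have h1 : ∀ p : CStarSeminorm (FreeStarAlgebra (ι × ι)), p 1 ≤ 1 := fun p => by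
        have h := p.star_mul_self 1
        rw [star_one, one_mul] at h
        nlinarith [p.nonneg 1]
      have hw : ∀ (w : FreeMonoid (ι × ι)) (p : CStarSeminorm (FreeStarAlgebra (ι × ι))),
          (∀ x ∈ magicRelations ι, p x = 0) → p (MonoidAlgebra.single w 1) ≤ 1 := by
        intro w p hp
        induction w using FreeMonoid.inductionOn' with
        | one => exact h1 p
        | of_mul k w ih =>
          have h : (MonoidAlgebra.single (FreeMonoid.of k * w) 1 : FreeStarAlgebra (ι × ι)) =
              freeStarGen k * MonoidAlgebra.single w 1 := by
            simp [freeStarGen, MonoidAlgebra.single_mul_single]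
          rw [h]
          exact (p.mul_le _ _).trans
            (mul_le_one₀ (magic_gen_le_one ι p hp k) (p.nonneg _) ih)
      refine ⟨‖c‖, fun p hp => ?_⟩
      have h : (MonoidAlgebra.single w c : FreeStarAlgebra (ι × ι)) =
          c • MonoidAlgebra.single w 1 := by simp
      rw [h, p.smul_eq]
      exact mul_le_of_le_one_right (norm_nonneg c) (hw w p hp)

/-- The algebra `C(S_N^+)`, where `N = |ι|`: the universal C*-algebra generated by the entries of
an `ι × ι` magic matrix. -/
abbrev QuantumPermAlgebra : Type _ := UniversalCStar (magicRelations ι)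

/-- The standard coordinates of `C(S_N^+)`. -/
noncomputable def quantumPermCoord : Matrix ι ι (QuantumPermAlgebra ι) :=
  Matrix.of fun i j => (maxCStarSeminorm (magicRelations ι)).toCompletion (freeStarGen (i, j))

end QuantumPermutation

/-! ## Woronowicz algebras and stationary models -/

section Woronowicz

variable {A : Type*} [CStarAlgebra A] {ι : Type*} [Fintype ι] [DecidableEq ι]

/-- A Woronowicz algebra: a C*-algebra `A` with a unitary matrix `u` whose coefficients generate
`A`, such that `Δ(u_ij) = ∑ u_ik ⊗ u_kj`, `ε(u_ij) = δ_ij` and `S(u_ij) = u_ji^*` define morphisms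
of C*-algebras `A → A ⊗ A`, `A → ℂ` and `A → A^opp`. -/
structure WoronowiczAlgebra (u : Matrix ι ι A) where
  unitary : u ∈ _root_.unitary (Matrix ι ι A)
  generates :
    (StarAlgebra.adjoin ℂ (Set.range fun k : ι × ι => u k.1 k.2)).topologicalClosure = ⊤
  comul : A →⋆ₐ[ℂ] MaxTensor A A
  comul_apply : ∀ i j, comul (u i j) = ∑ k, maxTmul (u i k) (u k j)
  counit : A →⋆ₐ[ℂ] ℂ
  counit_apply : ∀ i j, counit (u i j) = if i = j then 1 else 0
  antipode : A →⋆ₐ[ℂ] Aᵐᵒᵖ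
  antipode_apply : ∀ i j, antipode (u i j) = MulOpposite.op (star (u j i))

/-- `φ` is a Haar integration for the comultiplication `Δ`: a positive unital trace such that
`(φ ⊗ id)Δ = (id ⊗ φ)Δ = φ(.)1`, where the slice maps `φ ⊗ id` and `id ⊗ φ` are the continuous
linear maps `A ⊗ A → A` given by `a ⊗ b ↦ φ(a)b` and `a ⊗ b ↦ φ(b)a`. -/
structure IsHaarIntegration (Δ : A →⋆ₐ[ℂ] MaxTensor A A) (φ : A →ₗ[ℂ] ℂ) : Prop where
  nonneg : ∀ a, 0 ≤ φ (star a * a)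
  map_one : φ 1 = 1
  trace : ∀ a b, φ (a * b) = φ (b * a)
  left_invariant : ∃ Φ : MaxTensor A A →L[ℂ] A,
    (∀ a b, Φ (maxTmul a b) = φ a • b) ∧ ∀ a, Φ (Δ a) = φ a • (1 : A)
  right_invariant : ∃ Φ : MaxTensor A A →L[ℂ] A,
    (∀ a b, Φ (maxTmul a b) = φ b • a) ∧ ∀ a, Φ (Δ a) = φ a • (1 : A)

end Woronowicz

section Model

/-- The image of a morphism of C*-algebras. (As such images are closed, taking the closure does not
change the image; it makes it a C*-algebra by construction.) -/
noncomputable def cstarImage {A M : Type*} [CStarAlgebra A] [CStarAlgebra M] (π : A →⋆ₐ[ℂ] M) :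
    StarSubalgebra ℂ M :=
  π.range.topologicalClosure

instance {A M : Type*} [CStarAlgebra A] [CStarAlgebra M] (π : A →⋆ₐ[ℂ] M) :
    IsClosed (cstarImage π : Set M) :=
  π.range.isClosed_topologicalClosure

/-- A morphism of C*-algebras, as a map to its image. -/
noncomputable def toCstarImage {A M : Type*} [CStarAlgebra A] [CStarAlgebra M] (π : A →⋆ₐ[ℂ] M)
    (a : A) : cstarImage π :=
  ⟨π a, π.range.le_topologicalClosure ⟨a, rfl⟩⟩

/-- The random matrix algebra `M_K(C(T))`, with `K = |κ|`. -/
abbrev RandomMatrix (κ T : Type*) [TopologicalSpace T] : Type _ := CStarMatrix κ κ C(T, ℂ)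

variable {κ T : Type*} [Fintype κ] [DecidableEq κ] [TopologicalSpace T] [CompactSpace T]
  [MeasurableSpace T] [BorelSpace T]

/-- The random matrix trace `tr ⊗ ∫_T`, with `tr` being the normalized trace. -/
noncomputable def matrixIntegral (μ : MeasureTheory.Measure T)
    [MeasureTheory.IsFiniteMeasure μ] : RandomMatrix κ T →ₗ[ℂ] ℂ where
  toFun f := ∫ x, (Fintype.card κ : ℂ)⁻¹ * ∑ i, f i i x ∂μ
  map_add' f g := by
    have hint : ∀ f : RandomMatrix κ T,
        MeasureTheory.Integrable (fun x => (Fintype.card κ : ℂ)⁻¹ * ∑ i, f i i x) μ := fun f =>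
      Continuous.integrable_of_hasCompactSupport
        (continuous_const.mul (continuous_finsetSum _ fun i _ => (f i i).continuous))
        (HasCompactSupport.of_compactSpace _)
    rw [← MeasureTheory.integral_add (hint f) (hint g)]
    congr 1
    ext x
    simp [Finset.sum_add_distrib, mul_add]
  map_smul' c f := by
    rw [RingHom.id_apply, smul_eq_mul, ← MeasureTheory.integral_const_mul]
    congr 1
    ext x
    simp [Finset.mul_sum, mul_left_comm]

/-- A matrix model `π : C(G) → M_K(C(T))`, with `u` being the matrix of standard coordinates of
`C(G)`, is stationary on its image when `Im(π)`, with coordinates `π(u_ij)`, is a Woronowicz algebra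
whose Haar integration is `tr ⊗ ∫_T`. -/
def StationaryOnImage {A : Type*} [CStarAlgebra A] {ι : Type*} [Fintype ι] [DecidableEq ι]
    (u : Matrix ι ι A) (μ : MeasureTheory.Measure T) [MeasureTheory.IsFiniteMeasure μ]
    (π : A →⋆ₐ[ℂ] RandomMatrix κ T) : Prop :=
  ∃ W : WoronowiczAlgebra (u.map (toCstarImage π)),
    IsHaarIntegration W.comul ((matrixIntegral μ).comp (cstarImage π).subtype.toLinearMap)

end Model

/-! ## The Weyl matrix models -/

section Weyl

variable {H : Type*} [AddCommGroup H] [Finite H]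

/-- The Weyl matrix `W_ia : e_b ↦ ⟨i, b⟩ e_{a+b}`, for `i ∈ H` and `a` in the dual group of `H`. -/
noncomputable def weylMatrix (i : H) (a : AddChar H ℂ) :
    Matrix (AddChar H ℂ) (AddChar H ℂ) ℂ :=
  Matrix.of fun c b => if c = a + b then b i else 0

/-- The orthogonal projection onto the line spanned by a vector `ξ`, as a matrix. -/
noncomputable def projMatrix {κ : Type*} [Fintype κ] [DecidableEq κ] (ξ : κ → ℂ) : Matrix κ κ ℂ :=
  (Matrix.toEuclideanCLM (n := κ) (𝕜 := ℂ)).symm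
    (Submodule.span ℂ {WithLp.toLp 2 ξ}).starProjection

theorem projMatrix_apply {κ : Type*} [Fintype κ] [DecidableEq κ] (ξ : κ → ℂ) (k l : κ) :
    projMatrix ξ k l = ξ k * star (ξ l) / ((∑ m, ‖ξ m‖ ^ 2 : ℝ) : ℂ) := by
  have h : ∀ M : Matrix κ κ ℂ,
      M k l = Matrix.toEuclideanCLM (n := κ) (𝕜 := ℂ) M (WithLp.toLp 2 (Pi.single l 1)) k := by
    intro M
    simp
  rw [h (projMatrix ξ), projMatrix, StarAlgEquiv.apply_symm_apply, Submodule.starProjection_singleton,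
    EuclideanSpace.norm_sq_eq]
  simp [EuclideanSpace.inner_eq_star_dotProduct]
  ring

theorem weylMatrix_mem_unitaryGroup (i : H) (a : AddChar H ℂ) :
    weylMatrix i a ∈ Matrix.unitaryGroup (AddChar H ℂ) ℂ := by
  rw [Matrix.mem_unitaryGroup_iff']
  ext b b'
  have hb : (starRingEnd ℂ) (b i) * b i = 1 := by
    rw [mul_comm, RCLike.mul_conj, AddChar.norm_apply]
    simp
  by_cases h : b = b'
  · subst h
    simp [weylMatrix, Matrix.mul_apply, Matrix.star_apply, hb]
  · have h' : ¬b' = b := fun e => h e.symm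
    simp [weylMatrix, Matrix.mul_apply, Matrix.star_apply, h, h']

/-- The Weyl matrices, as elements of the unitary group `U_n`, with `n = |H|`. -/
noncomputable def weylUnitary (i : H) (a : AddChar H ℂ) :
    Matrix.unitaryGroup (AddChar H ℂ) ℂ :=
  ⟨weylMatrix i a, weylMatrix_mem_unitaryGroup i a⟩

/-- A matrix in `M_n(ℂ)`, as a vector in the `n²`-dimensional space with coordinates its entries. -/
def matVec {ν : Type*} (x : Matrix ν ν ℂ) : ν × ν → ℂ := fun k => x k.1 k.2

theorem continuous_projMatrix_matVec {Y ν : Type*} [TopologicalSpace Y] [Fintype ν] [DecidableEq ν]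
    [Nonempty ν] (V : Y → Matrix.unitaryGroup ν ℂ) (hV : Continuous V) (k l : ν × ν) :
    Continuous fun y => projMatrix (matVec (V y : Matrix ν ν ℂ)) k l := by
  have hc : ∀ m : ν × ν, Continuous fun y => matVec (V y : Matrix ν ν ℂ) m := fun m =>
    (continuous_subtype_val.comp hV).matrix_elem m.1 m.2
  simp only [projMatrix_apply]
  refine ((hc k).mul (hc l).star).div
    (Complex.continuous_ofReal.comp (continuous_finsetSum _ fun m _ => (hc m).norm.pow 2))
    fun y h0 => ?_
  rw [Complex.ofReal_eq_zero, Finset.sum_eq_zero_iff_of_nonneg (fun m _ => by positivity)] at h0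
  have hz : (V y : Matrix ν ν ℂ) = 0 := by
    ext c d
    simpa [matVec] using h0 (c, d) (Finset.mem_univ _)
  have h1 := Matrix.mem_unitaryGroup_iff'.1 (V y).2
  rw [hz, mul_zero] at h1
  exact zero_ne_one h1

/-- The element `U ↦ Proj(W_ia U W_jb^*)` of `M_N(C(E))`, with `N = n²`. -/
noncomputable def weylProj (E : Subgroup (Matrix.unitaryGroup (AddChar H ℂ) ℂ))
    (x y : H × AddChar H ℂ) : RandomMatrix (AddChar H ℂ × AddChar H ℂ) E :=
  CStarMatrix.ofMatrix <| Matrix.of fun k l =>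
    { toFun := fun U => projMatrix
        (matVec (weylMatrix x.1 x.2 * (U.1 : Matrix (AddChar H ℂ) (AddChar H ℂ) ℂ) *
          star (weylMatrix y.1 y.2))) k l
      continuous_toFun :=
        continuous_projMatrix_matVec
          (fun U : E => weylUnitary x.1 x.2 * U.1 * star (weylUnitary y.1 y.2))
          ((continuous_const.mul continuous_subtype_val).mul continuous_const) k l }

end Weyl

set_option linter.unusedSectionVars false

/-! ## Maximal tensor products -/

section MaxTensorLift

variable {A B D : Type*} [CStarAlgebra A] [CStarAlgebra B] [CStarAlgebra D]

/-! The entry of `Proj(W_ia U W_jd^*)` at `(b, b')` is `1/n` times a character of `(i, j)`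
determined by `b' - b`, times `U_h conj(U_k)` with `h = b - (a, d)` and `k = b' - (a, d)`; this is
`weylModel`. The magic relations follow from unitarity of `U` and orthogonality of characters, and
the universal property of `C(S_N^+)` gives the unique morphism `π`.

The main point is the comultiplication of `B ⊂ M_N(C(E))`. Replacing `U` by a product `UV` gives
matrices over `C(E × E)`, which are not elements of `B ⊗ B`. The remedy is a morphism `twirl : C(E)
→ M_N(M_N(C(E)))`, made of the translations `U ↦ W_ic^* U W_jd` and of a Fourier transform. It sends
`U_h conj(U_k)` to a matrix whose entries are `0` or Fourier coefficients of the model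
(`twirl_entryCoeff`), hence lie in `B`. Let `C ⊂ C(E)` consist of the functions twirled into
`M_N(B)`. As `C` is commutative and its characters are point evaluations, `C ⊗ C` embeds
isometrically in `C(E × E)` (`isometry_maxTensorToProd`), and the functions `f(UV)` coming from `B`
lie in it. Twirling both legs gives a morphism `B → M_{N³}(B ⊗ B)` (`exists_comul_matrix`).

This morphism has a scalar eigenvector common to all generators, the structure tensor `∑ e_ps ⊗ e_pq
⊗ e_qs` of matrix multiplication, with eigenvalue `∑_z v_xz ⊗ v_zy` at `v_xy`
(`sum_comulVector_smul_twirl`, `sum_bilin_fourier`). Eigenvalues at a common eigenvector multiply,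
so they form the morphism `Δ` (`exists_starAlgHom_of_eigenvector`). The counit arises in the same
way from evaluation at `U = 1`, with the identity matrix as eigenvector. The antipode is a
transposition composed with the index flip and `U ↦ U⁻¹`.

For the Haar integration, translation invariance gives `φ(twirl(f)_kl) = δ_kl ∫ f`
(`matrixIntegral_twirl`). Slicing the eigenvector equation then reduces, by invariance of the
integral of `f(UV)` in either variable, to `(φ ⊗ id)Δ(b) = (∫ b_kk) 1` for every `k`, and similarly
on the other side; the average over `k` is `φ(b) 1` (`slice_comul`). -/

/-- Two morphisms with commuting ranges define a morphism on the algebraic tensor product. -/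
noncomputable def tensorLiftStar (α : A →⋆ₐ[ℂ] D) (β : B →⋆ₐ[ℂ] D)
    (h : ∀ a b, Commute (α a) (β b)) : A ⊗[ℂ] B →⋆ₐ[ℂ] D :=
  { Algebra.TensorProduct.lift (α : A →ₐ[ℂ] D) (β : B →ₐ[ℂ] D) h with
    map_star' := fun x => by
      change Algebra.TensorProduct.lift (α : A →ₐ[ℂ] D) (β : B →ₐ[ℂ] D) h (star x) =
        star (Algebra.TensorProduct.lift (α : A →ₐ[ℂ] D) (β : B →ₐ[ℂ] D) h x)
      induction x using TensorProduct.induction_on with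
      | zero => simp
      | add x y hx hy => rw [star_add, map_add, map_add, star_add, hx, hy]
      | tmul a b =>
        simp only [TensorProduct.star_tmul, Algebra.TensorProduct.lift_tmul]
        simp only [StarAlgHom.coe_toAlgHom, map_star, star_mul]
        rw [← map_star, ← map_star]
        exact h _ _ }

@[simp]
theorem tensorLiftStar_tmul (α : A →⋆ₐ[ℂ] D) (β : B →⋆ₐ[ℂ] D)
    (h : ∀ a b, Commute (α a) (β b)) (a : A) (b : B) :
    tensorLiftStar α β h (a ⊗ₜ b) = α a * β b := by
  change Algebra.TensorProduct.lift (α : A →ₐ[ℂ] D) (β : B →ₐ[ℂ] D) h (a ⊗ₜ b) = _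
  simp

variable (A B) in
/-- The canonical map from the algebraic to the maximal tensor product. -/
noncomputable abbrev toMaxTensor : A ⊗[ℂ] B →⋆ₐ[ℂ] MaxTensor A B :=
  (maxCStarSeminorm (∅ : Set (A ⊗[ℂ] B))).toCompletion

theorem denseRange_toMaxTensor : DenseRange (toMaxTensor A B) :=
  CStarSeminorm.denseRange_toCompletion _

theorem maxTensor_induction {p : MaxTensor A B → Prop} (hp : IsClosed {F | p F})
    (add : ∀ F G, p F → p G → p (F + G)) (tmul : ∀ a b, p (maxTmul a b)) (F : MaxTensor A B) :
    p F := by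
  refine isClosed_property denseRange_toMaxTensor hp (fun t => ?_) F
  induction t using TensorProduct.induction_on with
  | zero => simpa [maxTmul] using tmul (0 : A) (0 : B)
  | add s t hs ht => rw [map_add]; exact add _ _ hs ht
  | tmul a b => exact tmul a b

/-- Two morphisms with commuting ranges define a morphism on the maximal tensor product. -/
noncomputable def maxTensorLift (α : A →⋆ₐ[ℂ] D) (β : B →⋆ₐ[ℂ] D)
    (h : ∀ a b, Commute (α a) (β b)) : MaxTensor A B →⋆ₐ[ℂ] D :=
  (universalCStar_existsUnique_lift (∅ : Set (A ⊗[ℂ] B)) (tensorLiftStar α β h)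
    (fun _ hx => hx.elim)).choose

theorem maxTensorLift_toMaxTensor (α : A →⋆ₐ[ℂ] D) (β : B →⋆ₐ[ℂ] D)
    (h : ∀ a b, Commute (α a) (β b)) (t : A ⊗[ℂ] B) :
    maxTensorLift α β h (toMaxTensor A B t) = tensorLiftStar α β h t :=
  (universalCStar_existsUnique_lift (∅ : Set (A ⊗[ℂ] B)) (tensorLiftStar α β h)
    (fun _ hx => hx.elim)).choose_spec.1 t

@[simp]
theorem maxTensorLift_maxTmul (α : A →⋆ₐ[ℂ] D) (β : B →⋆ₐ[ℂ] D)
    (h : ∀ a b, Commute (α a) (β b)) (a : A) (b : B) :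
    maxTensorLift α β h (maxTmul a b) = α a * β b := by
  rw [maxTmul, maxTensorLift_toMaxTensor, tensorLiftStar_tmul]

theorem maxTmul_mul_maxTmul (a a' : A) (b b' : B) :
    maxTmul a b * maxTmul a' b' = maxTmul (a * a') (b * b') := by
  simp [maxTmul, ← map_mul]

theorem star_maxTmul (a : A) (b : B) : star (maxTmul a b) = maxTmul (star a) (star b) := by
  simp [maxTmul, ← map_star]

theorem maxTmul_one_one : maxTmul (1 : A) (1 : B) = 1 := by
  rw [maxTmul, ← Algebra.TensorProduct.one_def, map_one]

variable (A B) in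
/-- The bilinear map `(a, b) ↦ a ⊗ b` to the maximal tensor product. -/
noncomputable def maxTmulBilin : A →ₗ[ℂ] B →ₗ[ℂ] MaxTensor A B :=
  (TensorProduct.mk ℂ A B).compr₂ (toMaxTensor A B).toAlgHom.toLinearMap

@[simp]
theorem maxTmulBilin_apply (a : A) (b : B) : maxTmulBilin A B a b = maxTmul a b := rfl

variable (A B) in
/-- The embedding `a ↦ a ⊗ 1`. -/
noncomputable def maxInl : A →⋆ₐ[ℂ] MaxTensor A B where
  toFun a := maxTmul a 1
  map_one' := maxTmul_one_one
  map_mul' a a' := by rw [maxTmul_mul_maxTmul, one_mul]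
  map_zero' := by simp [← maxTmulBilin_apply]
  map_add' a a' := by simp [← maxTmulBilin_apply]
  commutes' c := by
    rw [Algebra.algebraMap_eq_smul_one, Algebra.algebraMap_eq_smul_one, ← maxTmulBilin_apply]
    simp [maxTmul_one_one]
  map_star' a := by rw [star_maxTmul, star_one]

variable (A B) in
/-- The embedding `b ↦ 1 ⊗ b`. -/
noncomputable def maxInr : B →⋆ₐ[ℂ] MaxTensor A B where
  toFun b := maxTmul 1 b
  map_one' := maxTmul_one_one
  map_mul' a a' := by rw [maxTmul_mul_maxTmul, one_mul]
  map_zero' := by simp [← maxTmulBilin_apply]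
  map_add' a a' := by simp [← maxTmulBilin_apply]
  commutes' c := by
    rw [Algebra.algebraMap_eq_smul_one, Algebra.algebraMap_eq_smul_one, ← maxTmulBilin_apply]
    simp [maxTmul_one_one]
  map_star' a := by rw [star_maxTmul, star_one]

theorem maxInl_mul_maxInr (a : A) (b : B) : maxInl A B a * maxInr A B b = maxTmul a b := by
  change maxTmul a 1 * maxTmul 1 b = _
  rw [maxTmul_mul_maxTmul, one_mul, mul_one]

theorem commute_maxInl_maxInr (a : A) (b : B) : Commute (maxInl A B a) (maxInr A B b) := by
  change maxTmul a 1 * maxTmul 1 b = maxTmul 1 b * maxTmul a 1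
  simp [maxTmul_mul_maxTmul]

/-- The flip `a ⊗ b ↦ b ⊗ a`. -/
noncomputable def maxFlip : MaxTensor A B →⋆ₐ[ℂ] MaxTensor B A :=
  maxTensorLift (maxInr B A) (maxInl B A) fun _ _ => (commute_maxInl_maxInr _ _).symm

theorem maxFlip_maxTmul (a : A) (b : B) : maxFlip (maxTmul a b) = maxTmul b a := by
  rw [maxFlip, maxTensorLift_maxTmul, (commute_maxInl_maxInr _ _).symm.eq, maxInl_mul_maxInr]

theorem StarAlgHom.continuous_of_cstar (f : A →⋆ₐ[ℂ] D) : Continuous f :=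
  AddMonoidHomClass.continuous_of_bound f 1
    (fun x => by rw [one_mul]; exact NonUnitalStarAlgHom.norm_apply_le f x)

/-- A linear map on the algebraic tensor product that is bounded for the maximal norm extends to
the maximal tensor product. -/
theorem exists_maxTensor_extension {V : Type*} [NormedAddCommGroup V] [NormedSpace ℂ V]
    [CompleteSpace V] (f : A ⊗[ℂ] B →ₗ[ℂ] V) (K : ℝ)
    (hf : ∀ t, ‖f t‖ ≤ K * ‖toMaxTensor A B t‖) :
    ∃ F : MaxTensor A B →L[ℂ] V, ∀ t, F (toMaxTensor A B t) = f t := by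
  set p := maxCStarSeminorm (∅ : Set (A ⊗[ℂ] B))
  let f' : p.Pre →ₗ[ℂ] V := f
  have hf' : ∀ t : p.Pre, ‖f' t‖ ≤ K * ‖t‖ := fun t =>
    (hf t).trans_eq (congrArg (K * ·) (CStarSeminorm.norm_toCompletion p t))
  let g : p.Pre →L[ℂ] V := f'.mkContinuous K hf'
  refine ⟨g.extend (UniformSpace.Completion.toComplL (𝕜 := ℂ) (E := p.Pre)), fun t => ?_⟩
  exact ContinuousLinearMap.extend_eq g
    (UniformSpace.Completion.denseRange_coe (α := p.Pre))
    (UniformSpace.Completion.isUniformInducing_coe p.Pre) t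

end MaxTensorLift

/-! ## Commutative algebras -/

section Commutative

variable {X Y : Type*} [TopologicalSpace X] [CompactSpace X] [TopologicalSpace Y] [CompactSpace Y]

/-- The characters of a closed `*`-subalgebra of `C(X)` are evaluations at points of `X`. -/
theorem exists_eval_eq_character (C : StarSubalgebra ℂ C(X, ℂ)) [IsClosed (C : Set C(X, ℂ))]
    (χ : C →ₐ[ℂ] ℂ) : ∃ x : X, ∀ f : C, χ f = (f : C(X, ℂ)) x := by
  by_contra! hcon
  choose f hf using hcon
  -- `k x` is `|f x - χ (f x)|²`: it lies in the kernel of `χ`, is nonnegative everywhere and is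
  -- nonzero at `x`. By compactness finitely many of these have a sum that vanishes nowhere.
  let k : X → C := fun x => star (f x - algebraMap ℂ C (χ (f x))) * (f x - algebraMap ℂ C (χ (f x)))
  have hk0 : ∀ x, χ (k x) = 0 := fun x => by
    simp [k]
  have hk : ∀ x y, ((k x : C) : C(X, ℂ)) y =
      ((‖(f x : C(X, ℂ)) y - χ (f x)‖ ^ 2 : ℝ) : ℂ) := fun x y => by
    have : ((k x : C) : C(X, ℂ)) y = star ((f x : C(X, ℂ)) y - χ (f x)) *
      ((f x : C(X, ℂ)) y - χ (f x)) := rfl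
    rw [this, RCLike.star_def, RCLike.conj_mul]
    simp
  have hopen : ∀ x, IsOpen {y | ((k x : C) : C(X, ℂ)) y ≠ 0} := fun x =>
    isOpen_ne_fun ((k x : C) : C(X, ℂ)).continuous continuous_const
  obtain ⟨s, hs⟩ := isCompact_univ.elim_finite_subcover (fun x => {y | ((k x : C) : C(X, ℂ)) y ≠ 0})
    hopen (fun x _ => Set.mem_iUnion.2 ⟨x, by
      change ((k x : C) : C(X, ℂ)) x ≠ 0
      rw [hk]
      have : (f x : C(X, ℂ)) x - χ (f x) ≠ 0 := sub_ne_zero.2 (hf x).symm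
      exact_mod_cast pow_ne_zero 2 (norm_ne_zero_iff.2 this)⟩)
  have hu : IsUnit (((∑ x ∈ s, k x : C)) : C(X, ℂ)) := by
    rw [ContinuousMap.isUnit_iff_forall_ne_zero]
    intro y
    have hsum : ((∑ x ∈ s, k x : C) : C(X, ℂ)) y =
        ((∑ x ∈ s, ‖(f x : C(X, ℂ)) y - χ (f x)‖ ^ 2 : ℝ) : ℂ) := by
      push_cast
      rw [ContinuousMap.sum_apply]
      refine Finset.sum_congr rfl fun x _ => ?_
      rw [hk]
      push_cast
      rfl
    rw [hsum]
    obtain ⟨x, hx⟩ := Set.mem_iUnion.1 (hs (Set.mem_univ y))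
    obtain ⟨hxs, hx⟩ := Set.mem_iUnion.1 hx
    have hx' : ((k x : C) : C(X, ℂ)) y ≠ 0 := hx
    rw [hk] at hx'
    have hpos : 0 < ‖(f x : C(X, ℂ)) y - χ (f x)‖ ^ 2 :=
      lt_of_le_of_ne (by positivity) (fun h => hx' (by rw [← h]; simp))
    have := Finset.single_le_sum (f := fun x => ‖(f x : C(X, ℂ)) y - χ (f x)‖ ^ 2)
      (fun i _ => by positivity) hxs
    exact_mod_cast (hpos.trans_le this).ne'
  -- Spectral permanence: as `C` is closed, an inverse in `C(X)` already lies in `C`. A character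
  -- cannot kill an invertible element.
  have h1 := (C.coe_isUnit.1 hu).map χ
  rw [map_sum, Finset.sum_eq_zero fun x _ => hk0 x] at h1
  exact not_isUnit_zero h1

theorem maxTensor_mul_comm {A B : Type*} [CStarAlgebra A] [CStarAlgebra B]
    (hA : ∀ a b : A, a * b = b * a) (hB : ∀ a b : B, a * b = b * a)
    (F G : MaxTensor A B) : F * G = G * F := by
  refine maxTensor_induction (p := fun F => F * G = G * F)
    (isClosed_eq (continuous_mul_const G) (continuous_const_mul G))
    (fun F F' h h' => by rw [add_mul, mul_add, h, h']) (fun a b => ?_) F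
  refine maxTensor_induction (p := fun G => maxTmul a b * G = G * maxTmul a b)
    (isClosed_eq (continuous_const_mul _) (continuous_mul_const _))
    (fun F F' h h' => by rw [add_mul, mul_add, h, h']) (fun a' b' => ?_) G
  rw [maxTmul_mul_maxTmul, maxTmul_mul_maxTmul, hA, hB]

/-- Gelfand duality: in a commutative C*-algebra the norm is the supremum over the characters. -/
theorem norm_le_of_forall_character {Q : Type*} [CStarAlgebra Q] (hQ : ∀ a b : Q, a * b = b * a)
    (q : Q) (K : ℝ) (hK : 0 ≤ K) (h : ∀ χ : Q →ₐ[ℂ] ℂ, Continuous χ → ‖χ q‖ ≤ K) : ‖q‖ ≤ K := by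
  let _ : CommCStarAlgebra Q := { (inferInstance : CStarAlgebra Q) with mul_comm := hQ }
  have hi := (gelfandTransform_isometry Q).norm_map_of_map_zero (map_zero _) q
  rw [← hi]
  refine (ContinuousMap.norm_le _ hK).2 fun χ => ?_
  exact h (WeakDual.CharacterSpace.toAlgHom χ) (map_continuous χ)

/-- Morphisms of C*-algebras are contractive, and the reverse inequality holds because every value
of a character on `q` is a value of the function `T q`. -/
theorem isometry_of_forall_character {Q : Type*} [CStarAlgebra Q]
    (hQ : ∀ a b : Q, a * b = b * a) {Z : Type*} [TopologicalSpace Z] [CompactSpace Z]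
    (T : Q →⋆ₐ[ℂ] C(Z, ℂ))
    (h : ∀ χ : Q →ₐ[ℂ] ℂ, Continuous χ → ∃ z, ∀ q, χ q = T q z) : Isometry T := by
  refine AddMonoidHomClass.isometry_of_norm _ fun q =>
    le_antisymm (NonUnitalStarAlgHom.norm_apply_le _ q) ?_
  refine norm_le_of_forall_character hQ q _ (norm_nonneg _) fun χ hχ => ?_
  obtain ⟨z, hz⟩ := h χ hχ
  rw [hz]
  exact ContinuousMap.norm_coe_le_norm _ _

variable {A A' : Type*} [CStarAlgebra A] [CStarAlgebra A']

/-- The morphism `A ⊗ A' → C(X × Y)` given by morphisms `A → C(X)` and `A' → C(Y)`. -/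
noncomputable def maxTensorToProd (i : A →⋆ₐ[ℂ] C(X, ℂ)) (i' : A' →⋆ₐ[ℂ] C(Y, ℂ)) :
    MaxTensor A A' →⋆ₐ[ℂ] C(X × Y, ℂ) :=
  maxTensorLift ((ContinuousMap.compStarAlgHom' ℂ ℂ ⟨Prod.fst, continuous_fst⟩).comp i)
    ((ContinuousMap.compStarAlgHom' ℂ ℂ ⟨Prod.snd, continuous_snd⟩).comp i')
    fun _ _ => Commute.all _ _

theorem maxTensorToProd_maxTmul (i : A →⋆ₐ[ℂ] C(X, ℂ)) (i' : A' →⋆ₐ[ℂ] C(Y, ℂ))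
    (f : A) (g : A') (z : X × Y) :
    maxTensorToProd i i' (maxTmul f g) z = i f z.1 * i' g z.2 := by
  rw [maxTensorToProd, maxTensorLift_maxTmul]
  rfl

/-- A character of `A ⊗ A'` is determined by its restrictions to the two legs. These are evaluations
at some `x` and `y`, so the character is evaluation at `(x, y)`. This allows functions on `X × Y` to
be treated as elements of the maximal tensor product. -/
theorem isometry_maxTensorToProd (i : A →⋆ₐ[ℂ] C(X, ℂ)) (i' : A' →⋆ₐ[ℂ] C(Y, ℂ))
    (hA : ∀ a b : A, a * b = b * a) (hA' : ∀ a b : A', a * b = b * a)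
    (hi : ∀ χ : A →ₐ[ℂ] ℂ, ∃ x : X, ∀ a, χ a = i a x)
    (hi' : ∀ χ : A' →ₐ[ℂ] ℂ, ∃ y : Y, ∀ a, χ a = i' a y) :
    Isometry (maxTensorToProd i i') := by
  refine isometry_of_forall_character (maxTensor_mul_comm hA hA') _ fun χ hχ => ?_
  obtain ⟨x, hx⟩ := hi (χ.comp (maxInl A A').toAlgHom)
  obtain ⟨y, hy⟩ := hi' (χ.comp (maxInr A A').toAlgHom)
  refine ⟨(x, y), fun F => ?_⟩
  have hc : Continuous fun F => maxTensorToProd i i' F (x, y) :=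
    (continuous_eval_const (x, y)).comp
      (StarAlgHom.continuous_of_cstar (maxTensorToProd i i'))
  refine maxTensor_induction (p := fun F => χ F = maxTensorToProd i i' F (x, y))
    (isClosed_eq hχ hc)
    (fun s t hs ht => by rw [map_add, map_add, ContinuousMap.add_apply, hs, ht]) (fun f g => ?_) F
  have h1 : χ (maxInl A A' f) = i f x := hx f
  have h2 : χ (maxInr A A' g) = i' g y := hy g
  rw [maxTensorToProd_maxTmul, ← h1, ← h2, ← map_mul, maxInl_mul_maxInr]

end Commutative

/-! ## Morphisms to and between matrix algebras -/

section MatrixHoms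

variable {I J : Type*} [Fintype I] [DecidableEq I] [Fintype J] [DecidableEq J]

/-- The matrix with given entries, as an element of the matrix algebra. -/
def cstarMatrixOf {I J A : Type*} (f : I → J → A) : CStarMatrix I J A :=
  CStarMatrix.ofMatrix (Matrix.of f)

@[simp]
theorem cstarMatrixOf_apply {I J A : Type*} (f : I → J → A) (i : I) (j : J) :
    cstarMatrixOf f i j = f i j := rfl

theorem cstarMatrix_sum_apply {I J A Y : Type*} [AddCommMonoid A] (s : Finset Y)
    (f : Y → CStarMatrix I J A) (i : I) (j : J) : (∑ y ∈ s, f y) i j = ∑ y ∈ s, f y i j :=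
  map_sum (⟨⟨fun M : CStarMatrix I J A => M i j, rfl⟩, fun _ _ => rfl⟩ :
    CStarMatrix I J A →+ A) f s

/-- The morphism of matrix algebras given by applying a morphism to the entries. -/
def cstarMatrixMap {A B : Type*} [Ring A] [StarRing A] [Algebra ℂ A] [Ring B] [StarRing B]
    [Algebra ℂ B] (f : A →⋆ₐ[ℂ] B) : CStarMatrix I I A →⋆ₐ[ℂ] CStarMatrix I I B where
  toFun M := cstarMatrixOf fun i j => f (M i j)
  map_one' := by
    ext i j
    simp [CStarMatrix.one_apply, apply_ite f]
  map_mul' M N := by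
    ext i j
    simp [CStarMatrix.mul_apply]
  map_zero' := by ext i j; simp
  map_add' M N := by ext i j; simp
  commutes' c := by
    ext i j
    simp [CStarMatrix.algebraMap_apply, apply_ite f, AlgHomClass.commutes f]
  map_star' M := by
    ext i j
    simp [CStarMatrix.star_apply, map_star]

@[simp]
theorem cstarMatrixMap_apply {A B : Type*} [Ring A] [StarRing A] [Algebra ℂ A] [Ring B] [StarRing B]
    [Algebra ℂ B] (f : A →⋆ₐ[ℂ] B) (M : CStarMatrix I I A) (i j : I) :
    cstarMatrixMap f M i j = f (M i j) := rfl

/-- The morphism `M ↦ M ⊗ 1`. -/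
def cstarMatrixAmpLeft (J : Type*) [Fintype J] [DecidableEq J] {A : Type*} [Ring A] [StarRing A]
    [Algebra ℂ A] : CStarMatrix I I A →⋆ₐ[ℂ] CStarMatrix (I × J) (I × J) A where
  toFun M := cstarMatrixOf fun p q => if p.2 = q.2 then M p.1 q.1 else 0
  map_one' := by
    ext p q
    simp only [cstarMatrixOf_apply, CStarMatrix.one_apply, Prod.ext_iff]
    split_ifs <;> simp_all
  map_mul' M N := by
    ext p q
    simp only [cstarMatrixOf_apply, CStarMatrix.mul_apply, Fintype.sum_prod_type]
    split_ifs with h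
    · refine Finset.sum_congr rfl fun i _ => ?_
      simp [h]
    · simp only [ite_mul, zero_mul, mul_ite, mul_zero]
      symm
      refine Finset.sum_eq_zero fun i _ => ?_
      simp [h]
  map_zero' := by ext p q; simp
  map_add' M N := by ext p q; simp; split_ifs <;> simp
  commutes' c := by
    ext p q
    simp only [cstarMatrixOf_apply, CStarMatrix.algebraMap_apply, Prod.ext_iff]
    split_ifs <;> simp_all
  map_star' M := by
    ext p q
    simp only [cstarMatrixOf_apply, CStarMatrix.star_apply, eq_comm (a := q.2)]
    split_ifs <;> simp

/-- The morphism `M ↦ 1 ⊗ M`. -/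
def cstarMatrixAmpRight (I : Type*) [Fintype I] [DecidableEq I] {A : Type*} [Ring A] [StarRing A]
    [Algebra ℂ A] : CStarMatrix J J A →⋆ₐ[ℂ] CStarMatrix (I × J) (I × J) A where
  toFun M := cstarMatrixOf fun p q => if p.1 = q.1 then M p.2 q.2 else 0
  map_one' := by
    ext p q
    simp only [cstarMatrixOf_apply, CStarMatrix.one_apply, Prod.ext_iff]
    split_ifs <;> simp_all
  map_mul' M N := by
    ext p q
    simp only [cstarMatrixOf_apply, CStarMatrix.mul_apply, Fintype.sum_prod_type]
    split_ifs with h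
    · rw [Finset.sum_comm]
      refine Finset.sum_congr rfl fun i _ => ?_
      simp [h]
    · simp only [ite_mul, zero_mul, mul_ite, mul_zero]
      symm
      rw [Finset.sum_comm]
      refine Finset.sum_eq_zero fun i _ => ?_
      simp [h]
  map_zero' := by ext p q; simp
  map_add' M N := by ext p q; simp; split_ifs <;> simp
  commutes' c := by
    ext p q
    simp only [cstarMatrixOf_apply, CStarMatrix.algebraMap_apply, Prod.ext_iff]
    split_ifs <;> simp_all
  map_star' M := by
    ext p q
    simp only [cstarMatrixOf_apply, CStarMatrix.star_apply, eq_comm (a := q.1)]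
    split_ifs <;> simp

theorem cstarMatrixAmpLeft_mul_ampRight {A : Type*} [Ring A] [StarRing A] [Algebra ℂ A]
    (M : CStarMatrix I I A) (N : CStarMatrix J J A) (p q : I × J) :
    (cstarMatrixAmpLeft J M * cstarMatrixAmpRight I N) p q = M p.1 q.1 * N p.2 q.2 := by
  rw [CStarMatrix.mul_apply, Fintype.sum_prod_type]
  simp [cstarMatrixAmpLeft, cstarMatrixAmpRight]

theorem cstarMatrixAmpRight_mul_ampLeft {A : Type*} [Ring A] [StarRing A] [Algebra ℂ A]
    (M : CStarMatrix I I A) (N : CStarMatrix J J A) (p q : I × J) :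
    (cstarMatrixAmpRight I N * cstarMatrixAmpLeft J M) p q = N p.2 q.2 * M p.1 q.1 := by
  rw [CStarMatrix.mul_apply, Fintype.sum_prod_type]
  simp [cstarMatrixAmpLeft, cstarMatrixAmpRight]

/-- Matrices of matrices, as matrices. -/
def cstarMatrixFlatten {A : Type*} [Ring A] [StarRing A] [Algebra ℂ A] :
    CStarMatrix I I (CStarMatrix J J A) →⋆ₐ[ℂ] CStarMatrix (I × J) (I × J) A where
  toFun M := cstarMatrixOf fun p q => M p.1 q.1 p.2 q.2
  map_one' := by
    ext p q
    by_cases h : p.1 = q.1 <;> simp [CStarMatrix.one_apply, Prod.ext_iff, h]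
  map_mul' M N := by
    ext p q
    simp only [cstarMatrixOf_apply, CStarMatrix.mul_apply, Fintype.sum_prod_type]
    rw [cstarMatrix_sum_apply]
    refine Finset.sum_congr rfl fun i _ => ?_
    rw [CStarMatrix.mul_apply]
  map_zero' := by ext p q; simp
  map_add' M N := by ext p q; simp
  commutes' c := by
    ext p q
    by_cases h : p.1 = q.1 <;> simp [CStarMatrix.algebraMap_apply, Prod.ext_iff, h]
  map_star' M := by
    ext p q
    simp [CStarMatrix.star_apply]

theorem CStarMatrix.continuous_entry {κ A : Type*} [CStarAlgebra A] [PartialOrder A]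
    [StarOrderedRing A] (i j : κ) : Continuous fun M : CStarMatrix κ κ A => M i j :=
  (continuous_apply j).comp (continuous_apply (A := fun _ : κ => κ → A) i)

/-- If a vector `e` with scalar entries is an eigenvector of the operator-valued matrices `Θ s`, with
`s` ranging over a set of self-adjoint generators, then the eigenvalues define a morphism. -/
theorem exists_starAlgHom_of_eigenvector {B D Y : Type*} [CStarAlgebra B] [CStarAlgebra D]
    [PartialOrder D] [StarOrderedRing D] (Θ : B →⋆ₐ[ℂ] CStarMatrix J J D) (e : J → ℂ) (j₀ : J)
    (he : e j₀ = 1) (s : Y → B)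
    (hs : (StarAlgebra.adjoin ℂ (Set.range s)).topologicalClosure = ⊤)
    (hsa : ∀ y, star (s y) = s y) (ψ : Y → D) (hψ : ∀ y, star (ψ y) = ψ y)
    (h : ∀ y i, ∑ j, e j • Θ (s y) i j = e i • ψ y) :
    ∃ Δ : B →⋆ₐ[ℂ] D, (∀ b i, ∑ j, e j • Θ b i j = e i • Δ b) ∧ ∀ y, Δ (s y) = ψ y := by
  set R : B → J → D := fun b i => ∑ j, e j • Θ b i j with hR
  have hRc : ∀ i, Continuous fun b => R b i := fun i =>
    continuous_finsetSum _ fun j _ => ((CStarMatrix.continuous_entry i j).comp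
      (StarAlgHom.continuous_of_cstar Θ)).const_smul (e j)
  have hadd : ∀ b c i, R (b + c) i = R b i + R c i := fun b c i => by
    simp [hR, Finset.sum_add_distrib]
  have hone : ∀ (r : ℂ) i, R (algebraMap ℂ B r) i = e i • algebraMap ℂ D r := fun r i => by
    simp only [hR, AlgHomClass.commutes Θ, CStarMatrix.algebraMap_apply]
    simp
  have hmul' : ∀ b c i, R (b * c) i = ∑ k, Θ b i k * R c k := fun b c i => by
    simp only [hR, map_mul, CStarMatrix.mul_apply, Finset.smul_sum, Finset.mul_sum]
    rw [Finset.sum_comm]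
    simp
  -- Scalar entries of `e` commute with everything, so the eigenvalue of `c` can be pulled out on
  -- the right, leaving `Θ b` applied to `e`.
  have hmul : ∀ b c, (∀ i, R c i = e i • R c j₀) → ∀ i, R (b * c) i = R b i * R c j₀ := by
    intro b c hc i
    rw [hmul']
    conv_lhs => enter [2, k]; rw [hc k]
    simp [hR, Finset.sum_mul]
  have hj : ∀ y, R (s y) j₀ = ψ y := fun y => by
    have := h y j₀
    rwa [he, one_smul] at this
  -- The eigenvector equation for `b` says nothing about `star b`, so both are carried through the
  -- induction. Self-adjoint generators with self-adjoint eigenvalues start it, and continuity of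
  -- the entries of `Θ` passes from the generated `*`-algebra to its closure.
  have key : ∀ b : B, (∀ i, R b i = e i • R b j₀) ∧ ∀ i, R (star b) i = e i • star (R b j₀) := by
    intro b
    have hb : b ∈ closure ((StarAlgebra.adjoin ℂ (Set.range s) : StarSubalgebra ℂ B) : Set B) := by
      rw [← StarSubalgebra.topologicalClosure_coe, hs]
      trivial
    have hcl : IsClosed {b : B | (∀ i, R b i = e i • R b j₀) ∧
        ∀ i, R (star b) i = e i • star (R b j₀)} := by
      simp only [Set.ofPred_and, Set.ofPred_forall]
      refine (isClosed_iInter fun i => isClosed_eq (hRc i) ((hRc j₀).const_smul _)).inter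
        (isClosed_iInter fun i => isClosed_eq ((hRc i).comp continuous_star)
          ((hRc j₀).star.const_smul _))
    refine hcl.closure_subset_iff.2 (fun b hb => ?_) hb
    refine StarAlgebra.adjoin_induction (p := fun b _ => (∀ i, R b i = e i • R b j₀) ∧
      ∀ i, R (star b) i = e i • star (R b j₀)) ?_ ?_ ?_ ?_ ?_ hb
    · rintro _ ⟨y, rfl⟩
      exact ⟨fun i => by rw [hj]; exact h y i, fun i => by rw [hsa, hj, hψ]; exact h y i⟩
    · intro r
      refine ⟨fun i => by rw [hone, hone, he, one_smul], fun i => ?_⟩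
      rw [← algebraMap_star_comm, hone, hone, he, one_smul, algebraMap_star_comm]
    · intro x y _ _ hx hy
      refine ⟨fun i => ?_, fun i => ?_⟩
      · rw [hadd, hadd, hx.1, hy.1, smul_add]
      · rw [star_add, hadd, hadd, hx.2, hy.2, star_add, smul_add]
    · intro x y _ _ hx hy
      refine ⟨fun i => ?_, fun i => ?_⟩
      · rw [hmul _ _ hy.1, hmul _ _ hy.1, hx.1, smul_mul_assoc]
      · have hx' : ∀ i, R (star x) i = e i • R (star x) j₀ := fun i => by
          rw [hx.2, hx.2 j₀, he, one_smul]
        rw [star_mul, hmul _ _ hx', hy.2, hx.2, he, one_smul, hmul _ _ hy.1, star_mul,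
          smul_mul_assoc]
    · intro x _ hx
      refine ⟨fun i => ?_, fun i => ?_⟩
      · rw [hx.2, hx.2 j₀, he, one_smul]
      · rw [star_star, hx.1, hx.2 j₀, he, one_smul, star_star]
  refine ⟨{ toFun := fun b => R b j₀
            map_one' := by simpa [he] using hone 1 j₀
            map_mul' := fun b c => hmul b c (key c).1 j₀
            map_zero' := by simp [hR]
            map_add' := fun b c => hadd b c j₀
            commutes' := fun r => by rw [hone, he, one_smul]
            map_star' := fun b => by rw [(key b).2, he, one_smul] }, fun b i => (key b).1 i, hj⟩

end MatrixHoms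

/-! ## Slice maps -/

section Slice

variable {A B T κ : Type*} [CStarAlgebra A] [CStarAlgebra B] [Fintype κ] [DecidableEq κ]

/-- The slice `a ⊗ b ↦ ev(a)_kk b` is a diagonal entry of the morphism `a ⊗ b ↦ ev(a) ⊗ b` to
`M_κ(B)`. Morphisms and passage to an entry are both contractive. -/
theorem norm_slice_entry_le (ev : A →⋆ₐ[ℂ] CStarMatrix κ κ ℂ) (k : κ)
    (f : A →ₗ[ℂ] ℂ) (hf : ∀ a, f a = ev a k k) (t : A ⊗[ℂ] B) :
    ‖TensorProduct.lift (LinearMap.lsmul ℂ B ∘ₗ f) t‖ ≤ ‖toMaxTensor A B t‖ := by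
  let _ : PartialOrder B := CStarAlgebra.spectralOrder B
  have _ : StarOrderedRing B := CStarAlgebra.spectralOrderedRing B
  let i : ℂ →⋆ₐ[ℂ] B := StarAlgHom.ofId ℂ B
  let d : B →⋆ₐ[ℂ] CStarMatrix κ κ B :=
      { toFun := fun b => cstarMatrixOf fun i j => if i = j then b else 0
        map_one' := by ext; simp [CStarMatrix.one_apply]
        map_mul' := fun b c => by ext; simp [CStarMatrix.mul_apply]
        map_zero' := by ext; simp
        map_add' := fun b c => by
          ext i j; by_cases h : i = j <;> simp [h]
        commutes' := fun c => by ext; simp [CStarMatrix.algebraMap_apply]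
        map_star' := fun b => by
          ext i j
          by_cases h : i = j
          · simp [CStarMatrix.star_apply, h]
          · simp [CStarMatrix.star_apply, h, Ne.symm h] }
  have hd : ∀ b k l, d b k l = if k = l then b else 0 := fun b k l => rfl
  have hi : ∀ c, i c = c • (1 : B) := fun c => Algebra.algebraMap_eq_smul_one c
  let F : MaxTensor A B →⋆ₐ[ℂ] CStarMatrix κ κ B :=
    maxTensorLift ((cstarMatrixMap i).comp ev) d fun a b => by
      ext k l
      simp [CStarMatrix.mul_apply, hd, hi]
  have hF : ∀ t, F (toMaxTensor A B t) k k = TensorProduct.lift (LinearMap.lsmul ℂ B ∘ₗ f) t := by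
    intro t
    induction t using TensorProduct.induction_on with
    | zero => simp
    | add x y hx hy => rw [map_add, map_add, map_add, CStarMatrix.add_apply, hx, hy]
    | tmul a b =>
      have : F (maxTmul a b) k k = f a • b := by
        rw [hf]
        have h : F (maxTmul a b) = _ := maxTensorLift_maxTmul _ _ _ a b
        rw [h, CStarMatrix.mul_apply]
        simp [hd, hi]
      exact this.trans (by simp)
  rw [← hF]
  exact CStarMatrix.norm_entry_le_norm.trans (NonUnitalStarAlgHom.norm_apply_le F _)

end Slice

section SliceIntegral

variable {A B T κ : Type*} [CStarAlgebra A] [CStarAlgebra B] [Fintype κ] [DecidableEq κ]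
  [TopologicalSpace T] [CompactSpace T] [MeasurableSpace T] [BorelSpace T]
  (μ : MeasureTheory.Measure T) [MeasureTheory.IsProbabilityMeasure μ]

/-- The evaluation of a random matrix at a point. -/
noncomputable def evalRandomMatrix (x : T) : RandomMatrix κ T →⋆ₐ[ℂ] CStarMatrix κ κ ℂ :=
  cstarMatrixMap (ContinuousMap.evalStarAlgHom ℂ ℂ x)

/-- The slice map `a ⊗ b ↦ φ(a)b`, with `φ = tr ⊗ ∫_T`. -/
theorem exists_slice_left (i : A →⋆ₐ[ℂ] RandomMatrix κ T) (φ : A →ₗ[ℂ] ℂ)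
    (hφ : ∀ a, φ a = matrixIntegral μ (i a)) :
    ∃ Φ : MaxTensor A B →L[ℂ] B, ∀ a b, Φ (maxTmul a b) = φ a • b := by
  let f : T → κ → A →ₗ[ℂ] ℂ := fun x k =>
    { toFun := fun a => i a k k x
      map_add' := fun a b => by simp
      map_smul' := fun c a => by simp }
  let G : T → A ⊗[ℂ] B → B := fun x t =>
    (Fintype.card κ : ℂ)⁻¹ • ∑ k, TensorProduct.lift (LinearMap.lsmul ℂ B ∘ₗ f x k) t
  -- The constant is `1`, or `0` when `κ` is empty; keeping the product avoids the case distinction.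
  have hG : ∀ x t, ‖G x t‖ ≤ ((Fintype.card κ : ℝ)⁻¹ * Fintype.card κ) * ‖toMaxTensor A B t‖ := by
    intro x t
    rw [norm_smul, mul_assoc]
    refine mul_le_mul (by simp) ((norm_sum_le _ _).trans ?_) (norm_nonneg _) (by positivity)
    refine (Finset.sum_le_sum fun k _ =>
      norm_slice_entry_le ((evalRandomMatrix x).comp i) k (f x k) (fun a => rfl) t).trans ?_
    simp
  -- The integral formula is needed only on the algebraic tensor product, where integrability
  -- reduces to continuous functions. Together with the pointwise bound on `G` it gives the
  -- boundedness required to extend to the completion.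
  have hint : ∀ t, MeasureTheory.Integrable (fun x => G x t) μ ∧
      TensorProduct.lift (LinearMap.lsmul ℂ B ∘ₗ φ) t = ∫ x, G x t ∂μ := by
    intro t
    induction t using TensorProduct.induction_on with
    | zero => simp [G]
    | add s t hs ht =>
      have : (fun x => G x (s + t)) = fun x => G x s + G x t := by
        funext x
        simp [G, Finset.sum_add_distrib]
      rw [this, MeasureTheory.integral_add hs.1 ht.1, map_add, hs.2, ht.2]
      exact ⟨hs.1.add ht.1, rfl⟩
    | tmul a b =>
      have : (fun x => G x (a ⊗ₜ b)) =
          fun x => ((Fintype.card κ : ℂ)⁻¹ * ∑ k, i a k k x) • b := by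
        funext x
        simp [G, f, mul_smul, Finset.sum_smul]
      rw [this]
      refine ⟨?_, ?_⟩
      · refine Continuous.integrable_of_hasCompactSupport ?_ (HasCompactSupport.of_compactSpace _)
        exact (continuous_const.mul (continuous_finsetSum _ fun k _ =>
          (i a k k).continuous)).smul continuous_const
      · rw [integral_smul_const]
        simp [hφ, matrixIntegral]
  obtain ⟨Φ, hΦ⟩ := exists_maxTensor_extension
    (TensorProduct.lift (LinearMap.lsmul ℂ B ∘ₗ φ)) ((Fintype.card κ : ℝ)⁻¹ * Fintype.card κ)
    fun t => by
      rw [(hint t).2]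
      refine (MeasureTheory.norm_integral_le_of_norm_le_const
        (Filter.Eventually.of_forall fun x => hG x t)).trans ?_
      simp
  exact ⟨Φ, fun a b => (hΦ _).trans (by simp)⟩

/-- The slice map `b ⊗ a ↦ φ(a)b`, with `φ = tr ⊗ ∫_T`. -/
theorem exists_slice_right (i : A →⋆ₐ[ℂ] RandomMatrix κ T) (φ : A →ₗ[ℂ] ℂ)
    (hφ : ∀ a, φ a = matrixIntegral μ (i a)) :
    ∃ Φ : MaxTensor B A →L[ℂ] B, ∀ b a, Φ (maxTmul b a) = φ a • b := by
  obtain ⟨Φ, hΦ⟩ := exists_slice_left (B := B) μ i φ hφ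
  let F : MaxTensor B A →L[ℂ] MaxTensor A B :=
    ⟨(maxFlip (A := B) (B := A)).toAlgHom.toLinearMap, StarAlgHom.continuous_of_cstar _⟩
  refine ⟨Φ.comp F, fun b a => ?_⟩
  have : F (maxTmul b a) = maxTmul a b := maxFlip_maxTmul b a
  rw [ContinuousLinearMap.comp_apply, this, hΦ]

end SliceIntegral

/-! ## Magic matrices -/

section Magic

variable {ι : Type*} [Fintype ι]

/-- Projections which sum up to `1` are pairwise orthogonal. -/
theorem mul_eq_zero_of_sum_projections_eq_one {D : Type*} [CStarAlgebra D] (p : ι → D)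
    (hsa : ∀ i, star (p i) = p i) (hp : ∀ i, p i * p i = p i) (hsum : ∑ i, p i = 1)
    {i j : ι} (hij : i ≠ j) : p i * p j = 0 := by
  classical
  let _ : PartialOrder D := CStarAlgebra.spectralOrder D
  have _ : StarOrderedRing D := CStarAlgebra.spectralOrderedRing D
  have hpp : ∀ k, star (p k * p j) * (p k * p j) = p j * p k * p j := fun k => by
    rw [star_mul, hsa, hsa, mul_assoc, ← mul_assoc (p k), hp, mul_assoc]
  -- Compressing `∑ p_k = 1` by `p_j` leaves `∑_{k ≠ j} p_j p_k p_j = 0`. The terms `(p_k p_j)^*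
  -- (p_k p_j)` are positive, so each of them vanishes.
  have h1 : ∑ k, p j * p k * p j = p j := by
    rw [← Finset.sum_mul, ← Finset.mul_sum, hsum, mul_one, hp]
  rw [← Finset.add_sum_erase _ _ (Finset.mem_univ j), hp, hp, add_eq_left,
    Finset.sum_eq_zero_iff_of_nonneg fun k _ => by rw [← hpp]; exact star_mul_self_nonneg _] at h1
  have := h1 i (by simp [hij])
  rwa [← hpp, CStarRing.star_mul_self_eq_zero_iff] at this

/-- Off the diagonal, the products in `u u^*` and `u^* u` are products of distinct projections in
one row or column, which are orthogonal. On the diagonal they reduce to the row and column sums. -/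
theorem magic_mem_unitary [DecidableEq ι] {D : Type*} [CStarAlgebra D] (u : Matrix ι ι D)
    (hsa : ∀ i j, star (u i j) = u i j) (hp : ∀ i j, u i j * u i j = u i j)
    (hrow : ∀ i, ∑ j, u i j = 1) (hcol : ∀ j, ∑ i, u i j = 1) :
    u ∈ unitary (Matrix ι ι D) := by
  rw [Unitary.mem_iff]
  constructor <;> ext i j <;> rw [Matrix.mul_apply, Matrix.one_apply]
  · simp only [Matrix.star_apply, hsa]
    split_ifs with h
    · subst h; simp [hp, hcol]
    · exact Finset.sum_eq_zero fun k _ => mul_eq_zero_of_sum_projections_eq_one (u k) (hsa k)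
        (hp k) (hrow k) h
  · simp only [Matrix.star_apply, hsa]
    split_ifs with h
    · subst h; simp [hp, hrow]
    · exact Finset.sum_eq_zero fun k _ => mul_eq_zero_of_sum_projections_eq_one (fun i => u i k)
        (hsa · k) (hp · k) (hcol k) h

/-- The morphism from the free `*`-algebra given by self-adjoint elements. -/
noncomputable def freeStarLift {X D : Type*} [CStarAlgebra D] (u : X → D)
    (hsa : ∀ x, star (u x) = u x) : FreeStarAlgebra X →⋆ₐ[ℂ] D :=
  { MonoidAlgebra.lift ℂ D (FreeMonoid X) (FreeMonoid.lift u) with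
    map_star' := fun x => by
      change MonoidAlgebra.lift ℂ D (FreeMonoid X) (FreeMonoid.lift u) (star x) =
        star (MonoidAlgebra.lift ℂ D (FreeMonoid X) (FreeMonoid.lift u) x)
      induction x using MonoidAlgebra.induction_linear with
      | zero => simp
      | add x y hx hy => rw [star_add, map_add, map_add, star_add, hx, hy]
      | single w c =>
        rw [star_freeStarAlgebra_single, MonoidAlgebra.lift_single, MonoidAlgebra.lift_single,
          star_smul]
        congr 1
        induction w using FreeMonoid.inductionOn' with
        | one => simp
        | of_mul x w ih => simp [star_mul, ih, hsa] }

theorem freeStarLift_gen {X D : Type*} [CStarAlgebra D] (u : X → D)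
    (hsa : ∀ x, star (u x) = u x) (x : X) : freeStarLift u hsa (freeStarGen x) = u x := by
  change MonoidAlgebra.lift ℂ D (FreeMonoid X) (FreeMonoid.lift u) (freeStarGen x) = _
  simp [freeStarGen]

theorem freeStarAlgebra_adjoin (X : Type*) :
    Algebra.adjoin ℂ (Set.range (freeStarGen (X := X))) = ⊤ := by
  rw [eq_top_iff]
  intro x _
  induction x using MonoidAlgebra.induction_linear with
  | zero => exact zero_mem _
  | add x y hx hy => exact add_mem (hx trivial) (hy trivial)
  | single w c =>
    have h : (MonoidAlgebra.single w c : FreeStarAlgebra X) = c • MonoidAlgebra.single w 1 := by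
      simp
    rw [h]
    refine Subalgebra.smul_mem _ ?_ c
    induction w using FreeMonoid.inductionOn' with
    | one => exact one_mem _
    | of_mul x w ih =>
      have h : (MonoidAlgebra.single (FreeMonoid.of x * w) 1 : FreeStarAlgebra X) =
          freeStarGen x * MonoidAlgebra.single w 1 := by
        simp [freeStarGen, MonoidAlgebra.single_mul_single]
      rw [h]
      exact mul_mem (Algebra.subset_adjoin ⟨x, rfl⟩) (ih trivial (by simp))

/-- The universal property of `C(S_N^+)`. -/
theorem existsUnique_quantumPermAlgebra_lift {D : Type*} [CStarAlgebra D] (u : Matrix ι ι D)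
    (hsa : ∀ i j, star (u i j) = u i j) (hp : ∀ i j, u i j * u i j = u i j)
    (hrow : ∀ i, ∑ j, u i j = 1) (hcol : ∀ j, ∑ i, u i j = 1) :
    ∃! F : QuantumPermAlgebra ι →⋆ₐ[ℂ] D, ∀ i j, F (quantumPermCoord ι i j) = u i j := by
  set f := freeStarLift (fun k : ι × ι => u k.1 k.2) (fun k => hsa k.1 k.2)
  have hf : ∀ k : ι × ι, f (freeStarGen k) = u k.1 k.2 := freeStarLift_gen _ _
  obtain ⟨F, hF, huniq⟩ := universalCStar_existsUnique_lift (magicRelations ι) f (by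
    rintro x (⟨i, j, rfl⟩ | ⟨i, rfl⟩ | ⟨j, rfl⟩)
    · rw [map_sub, map_mul, hf, hp, sub_self]
    · rw [map_sub, map_sum, map_one, Finset.sum_congr rfl fun j _ => hf (i, j), hrow, sub_self]
    · rw [map_sub, map_sum, map_one, Finset.sum_congr rfl fun i _ => hf (i, j), hcol, sub_self])
  refine ⟨F, fun i j => (hF _).trans (hf (i, j)), fun F' hF' => huniq F' fun a => ?_⟩
  set q := maxCStarSeminorm (magicRelations ι)
  have ha : a ∈ Algebra.adjoin ℂ (Set.range (freeStarGen (X := ι × ι))) := by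
    rw [freeStarAlgebra_adjoin]; trivial
  induction ha using Algebra.adjoin_induction with
  | mem x hx => obtain ⟨k, rfl⟩ := hx; rw [hf]; exact hF' k.1 k.2
  | algebraMap r => rw [AlgHomClass.commutes, AlgHomClass.commutes, AlgHomClass.commutes]
  | add x y _ _ hx hy => rw [map_add, map_add, map_add, hx, hy]
  | mul x y _ _ hx hy => rw [map_mul, map_mul, map_mul, hx, hy]

theorem toCompletion_mem_adjoin_quantumPermCoord (a : FreeStarAlgebra (ι × ι)) :
    (maxCStarSeminorm (magicRelations ι)).toCompletion a ∈
      StarAlgebra.adjoin ℂ (Set.range fun k : ι × ι => quantumPermCoord ι k.1 k.2) := by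
  have ha : a ∈ Algebra.adjoin ℂ (Set.range (freeStarGen (X := ι × ι))) := by
    rw [freeStarAlgebra_adjoin]; trivial
  induction ha using Algebra.adjoin_induction with
  | mem x hx => obtain ⟨k, rfl⟩ := hx; exact StarAlgebra.subset_adjoin _ _ ⟨k, rfl⟩
  | algebraMap r => rw [AlgHomClass.commutes]; exact algebraMap_mem _ r
  | add x y _ _ hx hy => rw [map_add]; exact add_mem hx hy
  | mul x y _ _ hx hy => rw [map_mul]; exact mul_mem hx hy

/-- A morphism of C*-algebras, as a morphism to its image. -/
noncomputable def cstarImageHom {A M : Type*} [CStarAlgebra A] [CStarAlgebra M]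
    (π : A →⋆ₐ[ℂ] M) : A →⋆ₐ[ℂ] cstarImage π :=
  π.codRestrict (cstarImage π) fun a => (toCstarImage π a).2

theorem denseRange_cstarImageHom {A M : Type*} [CStarAlgebra A] [CStarAlgebra M]
    (π : A →⋆ₐ[ℂ] M) : DenseRange (cstarImageHom π) := by
  intro b
  rw [closure_subtype]
  have hb : (b : M) ∈ closure (π.range : Set M) := b.2
  convert hb
  ext m
  constructor
  · rintro ⟨_, ⟨a, rfl⟩, rfl⟩
    exact ⟨a, rfl⟩
  · rintro ⟨a, rfl⟩
    exact ⟨_, ⟨a, rfl⟩, rfl⟩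

/-- The image of `C(S_N^+)` is generated by the images of the coordinates. -/
theorem adjoin_cstarImage_quantumPermCoord {M : Type*} [CStarAlgebra M]
    (π : QuantumPermAlgebra ι →⋆ₐ[ℂ] M) :
    (StarAlgebra.adjoin ℂ (Set.range fun k : ι × ι =>
      (quantumPermCoord ι).map (toCstarImage π) k.1 k.2)).topologicalClosure = ⊤ := by
  set S := StarAlgebra.adjoin ℂ (Set.range fun k : ι × ι =>
      (quantumPermCoord ι).map (toCstarImage π) k.1 k.2)
  have h1 : DenseRange fun a : FreeStarAlgebra (ι × ι) =>
      cstarImageHom π ((maxCStarSeminorm (magicRelations ι)).toCompletion a) :=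
    (denseRange_cstarImageHom π).comp (CStarSeminorm.denseRange_toCompletion _)
      (StarAlgHom.continuous_of_cstar _)
  have h2 : (StarAlgebra.adjoin ℂ (Set.range fun k : ι × ι => quantumPermCoord ι k.1 k.2)).map
      (cstarImageHom π) ≤ S := by
    rw [StarAlgHom.map_adjoin, ← Set.range_comp]
    exact le_rfl
  rw [eq_top_iff]
  intro b _
  change b ∈ closure (S : Set (cstarImage π))
  refine closure_mono ?_ (h1 b)
  rintro _ ⟨a, rfl⟩
  exact h2 ⟨_, toCompletion_mem_adjoin_quantumPermCoord a, rfl⟩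

end Magic

/-! ## The entries of the Weyl matrix model -/

section WeylEntries

variable {H : Type*} [AddCommGroup H]

/-- The pairing `(⟨i, h⟩, ⟨j, k⟩) ↦ conj ⟨i, h⟩ ⟨j, k⟩` between `H²` and its dual. -/
noncomputable def weylPairing (I : H × H) (h : AddChar H ℂ × AddChar H ℂ) : ℂ :=
  h.1 (-I.1) * h.2 I.2

theorem weylPairing_zero (I : H × H) : weylPairing I 0 = 1 := by simp [weylPairing]

theorem weylPairing_add (I : H × H) (h k : AddChar H ℂ × AddChar H ℂ) :
    weylPairing I (h + k) = weylPairing I h * weylPairing I k := by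
  simp [weylPairing]; ring

theorem weylPairing_add_left (I J : H × H) (h : AddChar H ℂ × AddChar H ℂ) :
    weylPairing (I + J) h = weylPairing I h * weylPairing J h := by
  simp [weylPairing, AddChar.map_add_eq_mul]; ring

theorem weylPairing_neg_left (I : H × H) (h : AddChar H ℂ × AddChar H ℂ) :
    weylPairing (-I) h = weylPairing I (-h) := by
  simp [weylPairing]

theorem weylPairing_sub (I : H × H) (h k : AddChar H ℂ × AddChar H ℂ) :
    weylPairing I (h - k) = weylPairing I h * weylPairing I (-k) := by
  rw [sub_eq_add_neg, weylPairing_add]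

theorem weylPairing_mul_neg (I : H × H) (h : AddChar H ℂ × AddChar H ℂ) :
    weylPairing I h * weylPairing I (-h) = 1 := by
  rw [← weylPairing_add, add_neg_cancel, weylPairing_zero]

variable [Fintype H]

theorem star_weylPairing (I : H × H) (h : AddChar H ℂ × AddChar H ℂ) :
    star (weylPairing I h) = weylPairing I (-h) := by
  simp [weylPairing, AddChar.map_neg_eq_conj]

/-- Orthogonality of characters on `H × H`. The companion `sum_weylPairing_right` is the dual
relation. -/
theorem sum_weylPairing [DecidableEq (AddChar H ℂ)] (h : AddChar H ℂ × AddChar H ℂ) :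
    ∑ I : H × H, weylPairing I h = if h = 0 then (Fintype.card H : ℂ) ^ 2 else 0 := by
  have h1 : ∑ i : H, h.1 (-i) = ∑ i : H, h.1 i :=
    Fintype.sum_equiv (Equiv.neg H) _ _ fun i => rfl
  simp only [weylPairing, Fintype.sum_prod_type, ← Finset.mul_sum, ← Finset.sum_mul, h1,
    AddChar.sum_eq_ite, Prod.ext_iff, Prod.fst_zero, Prod.snd_zero]
  split_ifs <;> simp_all [sq]

theorem sum_weylPairing_right [DecidableEq H] (I : H × H) :
    ∑ h : AddChar H ℂ × AddChar H ℂ, weylPairing I h =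
      if I = 0 then (Fintype.card H : ℂ) ^ 2 else 0 := by
  simp only [weylPairing, Fintype.sum_prod_type, ← Finset.mul_sum, ← Finset.sum_mul,
    AddChar.sum_apply_eq_ite, Prod.ext_iff, Prod.fst_zero, Prod.snd_zero, neg_eq_zero]
  split_ifs <;> simp_all [sq]

theorem card_ne_zero_complex : (Fintype.card H : ℂ) ≠ 0 :=
  Nat.cast_ne_zero.2 Fintype.card_ne_zero

theorem weylMatrix_mul_apply (i : H) (a : AddChar H ℂ)
    (U : Matrix (AddChar H ℂ) (AddChar H ℂ) ℂ) (b c : AddChar H ℂ) :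
    (weylMatrix i a * U) b c = (b - a) i * U (b - a) c := by
  rw [Matrix.mul_apply, Finset.sum_eq_single (b - a)]
  · simp [weylMatrix]
  · intro d _ hd
    have : ¬ b = a + d := fun h => hd (by rw [h]; abel)
    simp [weylMatrix, this]
  · simp

theorem mul_star_weylMatrix_apply (i : H) (a : AddChar H ℂ)
    (U : Matrix (AddChar H ℂ) (AddChar H ℂ) ℂ) (b c : AddChar H ℂ) :
    (U * star (weylMatrix i a)) b c = U b (c - a) * (c - a) (-i) := by
  rw [Matrix.mul_apply, Finset.sum_eq_single (c - a)]
  · simp [weylMatrix, Matrix.star_apply, AddChar.map_neg_eq_conj]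
  · intro d _ hd
    have : ¬ c = a + d := fun h => hd (by rw [h]; abel)
    simp [weylMatrix, Matrix.star_apply, this]
  · simp

theorem star_weylMatrix_mul_apply (i : H) (a : AddChar H ℂ)
    (U : Matrix (AddChar H ℂ) (AddChar H ℂ) ℂ) (b c : AddChar H ℂ) :
    (star (weylMatrix i a) * U) b c = b (-i) * U (a + b) c := by
  rw [Matrix.mul_apply, Finset.sum_eq_single (a + b)]
  · simp [weylMatrix, Matrix.star_apply, AddChar.map_neg_eq_conj]
  · intro d _ hd
    simp [weylMatrix, Matrix.star_apply, hd]
  · simp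

theorem mul_weylMatrix_apply (i : H) (a : AddChar H ℂ)
    (U : Matrix (AddChar H ℂ) (AddChar H ℂ) ℂ) (b c : AddChar H ℂ) :
    (U * weylMatrix i a) b c = U b (a + c) * c i := by
  rw [Matrix.mul_apply, Finset.sum_eq_single (a + c)]
  · simp [weylMatrix]
  · intro d _ hd
    simp [weylMatrix, hd]
  · simp

/-- This is `Tr(U U^*) = n`, the source of the factor `1/n` in the entries of the rank one
projections. -/
theorem sum_norm_sq_unitary {ν : Type*} [Fintype ν] [DecidableEq ν]
    (U : Matrix.unitaryGroup ν ℂ) :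
    ∑ m : ν × ν, ‖matVec (U : Matrix ν ν ℂ) m‖ ^ 2 = (Fintype.card ν : ℝ) := by
  have h : ((∑ m : ν × ν, ‖matVec (U : Matrix ν ν ℂ) m‖ ^ 2 : ℝ) : ℂ) =
      Matrix.trace ((U : Matrix ν ν ℂ) * star (U : Matrix ν ν ℂ)) := by
    push_cast
    rw [Fintype.sum_prod_type, Matrix.trace]
    refine Finset.sum_congr rfl fun i _ => ?_
    rw [Matrix.diag_apply, Matrix.mul_apply]
    refine Finset.sum_congr rfl fun j _ => ?_
    rw [Matrix.star_apply, RCLike.star_def, Complex.mul_conj']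
    rfl
  rw [Matrix.mem_unitaryGroup_iff.1 U.2, Matrix.trace_one] at h
  exact_mod_cast h

/-- A continuous unitary representation of a topological group, whose image contains the Weyl
matrices. -/
structure WeylRep (H : Type*) [AddCommGroup H] [Fintype H] (G : Type*) [Group G]
    [TopologicalSpace G] where
  toHom : G →* Matrix (AddChar H ℂ) (AddChar H ℂ) ℂ
  continuous_toHom : Continuous toHom
  mem_unitary : ∀ g, toHom g ∈ Matrix.unitaryGroup (AddChar H ℂ) ℂ
  weyl : H → AddChar H ℂ → G
  toHom_weyl : ∀ i a, toHom (weyl i a) = weylMatrix i a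

variable {G : Type*} [Group G] [TopologicalSpace G] [CompactSpace G] (ρ : WeylRep H G)

theorem WeylRep.toHom_inv (g : G) : ρ.toHom g⁻¹ = star (ρ.toHom g) := by
  have h1 : ρ.toHom g⁻¹ * ρ.toHom g = 1 := by rw [← map_mul, inv_mul_cancel, map_one]
  have h2 := Matrix.mem_unitaryGroup_iff.1 (ρ.mem_unitary g)
  exact left_inv_eq_right_inv h1 h2

/-- The function `U ↦ U_h conj(U_k)`, with `h, k` being pairs of indices. -/
noncomputable def entryCoeff (h k : AddChar H ℂ × AddChar H ℂ) : C(G, ℂ) where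
  toFun U := ρ.toHom U h.1 h.2 *
    star (ρ.toHom U k.1 k.2)
  continuous_toFun := by
    have hc := ρ.continuous_toHom
    exact (hc.matrix_elem _ _).mul (hc.matrix_elem _ _).star

theorem entryCoeff_apply (h k : AddChar H ℂ × AddChar H ℂ) (U : G) :
    entryCoeff ρ h k U = ρ.toHom U h.1 h.2 *
    star (ρ.toHom U k.1 k.2) := rfl

theorem star_entryCoeff (h k : AddChar H ℂ × AddChar H ℂ) :
    star (entryCoeff ρ h k) = entryCoeff ρ k h := by
  ext U
  simp [entryCoeff_apply, mul_comm]

theorem sum_entryCoeff_self :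
    ∑ h : AddChar H ℂ × AddChar H ℂ, entryCoeff ρ h h =
      algebraMap ℂ C(G, ℂ) (Fintype.card H : ℂ) := by
  ext U
  have h := sum_norm_sq_unitary ⟨ρ.toHom U, ρ.mem_unitary U⟩
  rw [AddChar.card_eq] at h
  have h' := congrArg (fun r : ℝ => (r : ℂ)) h
  push_cast at h'
  rw [ContinuousMap.sum_apply]
  refine Eq.trans (Finset.sum_congr rfl fun m _ => ?_) h'
  rw [entryCoeff_apply, RCLike.star_def, Complex.mul_conj']
  rfl

theorem sum_entryCoeff_sub_self (t : AddChar H ℂ × AddChar H ℂ) :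
    ∑ h : AddChar H ℂ × AddChar H ℂ, entryCoeff ρ (h - t) (h - t) =
      algebraMap ℂ C(G, ℂ) (Fintype.card H : ℂ) :=
  (Fintype.sum_equiv (Equiv.subRight t) _ (fun h => entryCoeff ρ h h) fun _ => rfl).trans
    (sum_entryCoeff_self ρ)

theorem sum_entryCoeff_right (p q : AddChar H ℂ) :
    ∑ d : AddChar H ℂ, entryCoeff ρ (p, d) (q, d) = if p = q then 1 else 0 := by
  ext U
  have h := congrFun (congrFun (Matrix.mem_unitaryGroup_iff.1 (ρ.mem_unitary U)) p) q
  rw [Matrix.mul_apply, Matrix.one_apply] at h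
  rw [ContinuousMap.sum_apply]
  refine Eq.trans ?_ (h.trans ?_)
  · rfl
  · split_ifs <;> rfl

theorem sum_entryCoeff_left (p q : AddChar H ℂ) :
    ∑ d : AddChar H ℂ, entryCoeff ρ (d, p) (d, q) = if p = q then 1 else 0 := by
  ext U
  have h := congrFun (congrFun (Matrix.mem_unitaryGroup_iff'.1 (ρ.mem_unitary U)) q) p
  rw [Matrix.mul_apply, Matrix.one_apply] at h
  rw [ContinuousMap.sum_apply]
  refine Eq.trans (Finset.sum_congr rfl fun d _ => ?_) (h.trans ?_)
  · exact mul_comm _ _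
  · simp only [eq_comm (a := q)]
    split_ifs <;> rfl

/-- The coefficients form a rank one matrix `ξ ξ^*` with commuting entries; this relation makes the
model idempotent. -/
theorem entryCoeff_mul_entryCoeff (h k l : AddChar H ℂ × AddChar H ℂ) :
    entryCoeff ρ h k * entryCoeff ρ k l = entryCoeff ρ k k * entryCoeff ρ h l := by
  ext U
  simp only [ContinuousMap.mul_apply, entryCoeff_apply]
  ring

/-- The comultiplication of the coefficients. -/
theorem entryCoeff_mul (h k : AddChar H ℂ × AddChar H ℂ) (U V : G) :
    entryCoeff ρ h k (U * V) = ∑ c : AddChar H ℂ, ∑ d : AddChar H ℂ,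
      entryCoeff ρ (h.1, c) (k.1, d) U * entryCoeff ρ (c, h.2) (d, k.2) V := by
  simp only [entryCoeff_apply]
  rw [map_mul, Matrix.mul_apply, Matrix.mul_apply, star_sum, Finset.sum_mul_sum]
  refine Finset.sum_congr rfl fun c _ => Finset.sum_congr rfl fun d _ => ?_
  rw [star_mul']
  ring

/-- The entries of the matrix model. -/
noncomputable def weylModel (x y : H × AddChar H ℂ) :
    RandomMatrix (AddChar H ℂ × AddChar H ℂ) G :=
  cstarMatrixOf fun b b' => ((Fintype.card H : ℂ)⁻¹ * weylPairing (x.1, y.1) (b' - b)) •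
      entryCoeff ρ (b - (x.2, y.2)) (b' - (x.2, y.2))

theorem weylModel_apply (x y : H × AddChar H ℂ) (b b' : AddChar H ℂ × AddChar H ℂ) :
    weylModel ρ x y b b' = ((Fintype.card H : ℂ)⁻¹ * weylPairing (x.1, y.1) (b' - b)) •
      entryCoeff ρ (b - (x.2, y.2)) (b' - (x.2, y.2)) := rfl

theorem star_weylModel (x y : H × AddChar H ℂ) : star (weylModel ρ x y) = weylModel ρ x y := by
  ext b b' : 2
  rw [CStarMatrix.star_apply, weylModel_apply, weylModel_apply, star_smul, star_entryCoeff, star_mul',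
    star_weylPairing, neg_sub]
  simp

/-- The character factors multiply along `b → m → b'`, the coefficients are of rank one, and the
remaining sum over `m` is `Tr(U U^*) = n`, which absorbs one factor `1/n`. -/
theorem weylModel_mul_self (x y : H × AddChar H ℂ) :
    weylModel ρ x y * weylModel ρ x y = weylModel ρ x y := by
  have hn := card_ne_zero_complex (H := H)
  refine CStarMatrix.ext fun b b' => ?_
  rw [CStarMatrix.mul_apply]
  have hc : ∀ m, weylModel ρ x y b m * weylModel ρ x y m b' =
      ((Fintype.card H : ℂ)⁻¹ * (Fintype.card H : ℂ)⁻¹ * weylPairing (x.1, y.1) (b' - b)) •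
      (entryCoeff ρ (m - (x.2, y.2)) (m - (x.2, y.2)) *
        entryCoeff ρ (b - (x.2, y.2)) (b' - (x.2, y.2))) := fun m => by
    have : b' - b = (m - b) + (b' - m) := by abel
    rw [weylModel_apply, weylModel_apply, smul_mul_smul_comm, entryCoeff_mul_entryCoeff, this,
      weylPairing_add]
    congr 1
    ring
  rw [Finset.sum_congr rfl fun m _ => hc m, ← Finset.smul_sum, ← Finset.sum_mul,
    sum_entryCoeff_sub_self, weylModel_apply, Algebra.algebraMap_eq_smul_one, smul_mul_assoc, one_mul,
    smul_smul]
  congr 1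
  field_simp

/-- The sum over the group index of `y` forces the second components of `b` and `b'` to agree, by
orthogonality of characters. The sum over its dual index is then a scalar product of two rows of
`U`. For `sum_weylModel_left` the components are exchanged and columns replace rows. -/
theorem sum_weylModel_right (x : H × AddChar H ℂ) : ∑ y, weylModel ρ x y = 1 := by
  have hn := card_ne_zero_complex (H := H)
  refine CStarMatrix.ext fun b b' => ?_
  rw [cstarMatrix_sum_apply, Fintype.sum_prod_type, Finset.sum_comm]
  have hc : ∀ d, ∑ j, weylModel ρ x (j, d) b b' = ((Fintype.card H : ℂ)⁻¹ * (b' - b).1 (-x.1) *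
      if (b' - b).2 = 0 then (Fintype.card H : ℂ) else 0) •
      entryCoeff ρ (b.1 - x.2, b.2 - d) (b'.1 - x.2, b'.2 - d) := fun d => by
    rw [← AddChar.sum_eq_ite, Finset.mul_sum, Finset.sum_smul]
    refine Finset.sum_congr rfl fun j _ => ?_
    rw [weylModel_apply, weylPairing, mul_assoc]
    rfl
  rw [Finset.sum_congr rfl fun d _ => hc d]
  by_cases h2 : b'.2 = b.2
  · rw [h2]
    simp only [Prod.snd_sub, h2, sub_self, if_true, ← Finset.smul_sum]
    rw [Fintype.sum_equiv (Equiv.subLeft b.2)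
      (fun d => entryCoeff ρ (b.1 - x.2, b.2 - d) (b'.1 - x.2, b.2 - d))
      (fun d => entryCoeff ρ (b.1 - x.2, d) (b'.1 - x.2, d)) fun d => rfl, sum_entryCoeff_right,
      CStarMatrix.one_apply]
    by_cases h1 : b.1 = b'.1
    · simp [h1, h2, Prod.ext_iff, hn]
    · simp [h1, Prod.ext_iff]
  · have : ¬ b = b' := fun h => h2 (by rw [h])
    simp [this, sub_eq_zero, h2]

theorem sum_weylModel_left (y : H × AddChar H ℂ) : ∑ x, weylModel ρ x y = 1 := by
  have hn := card_ne_zero_complex (H := H)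
  refine CStarMatrix.ext fun b b' => ?_
  rw [cstarMatrix_sum_apply, Fintype.sum_prod_type, Finset.sum_comm]
  have hc : ∀ d, ∑ j, weylModel ρ (j, d) y b b' = ((Fintype.card H : ℂ)⁻¹ * (b' - b).2 y.1 *
      if (b' - b).1 = 0 then (Fintype.card H : ℂ) else 0) •
      entryCoeff ρ (b.1 - d, b.2 - y.2) (b'.1 - d, b'.2 - y.2) := fun d => by
    rw [← AddChar.sum_eq_ite,
      ← Fintype.sum_equiv (Equiv.neg H) (fun j => (b' - b).1 (-j)) _ fun _ => rfl,
      Finset.mul_sum, Finset.sum_smul]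
    refine Finset.sum_congr rfl fun j _ => ?_
    rw [weylModel_apply, weylPairing, mul_comm ((b' - b).1 _), mul_assoc]
    rfl
  rw [Finset.sum_congr rfl fun d _ => hc d]
  by_cases h2 : b'.1 = b.1
  · rw [h2]
    simp only [Prod.fst_sub, h2, sub_self, if_true, ← Finset.smul_sum]
    rw [Fintype.sum_equiv (Equiv.subLeft b.1)
      (fun d => entryCoeff ρ (b.1 - d, b.2 - y.2) (b.1 - d, b'.2 - y.2))
      (fun d => entryCoeff ρ (d, b.2 - y.2) (d, b'.2 - y.2)) fun d => rfl, sum_entryCoeff_left,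
      CStarMatrix.one_apply]
    by_cases h1 : b.2 = b'.2
    · simp [h1, h2, Prod.ext_iff, hn]
    · simp [h1, Prod.ext_iff]
  · have : ¬ b = b' := fun h => h2 (by rw [h])
    simp [this, sub_eq_zero, h2]

/-- The partial Fourier transform of the matrix model. -/
noncomputable def weylFourier (t r : AddChar H ℂ × AddChar H ℂ) :
    RandomMatrix (AddChar H ℂ × AddChar H ℂ) G :=
  cstarMatrixOf fun b b' => if b - b' = r then entryCoeff ρ (b - t) (b' - t) else 0

/-- For fixed dual indices, `(i, j)` enters only through a character evaluated at `b' - b`. The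
Fourier coefficients in `(i, j)` are therefore the diagonals `b - b' = r`. -/
theorem weylModel_eq_sum_weylFourier (x y : H × AddChar H ℂ) :
    weylModel ρ x y = (Fintype.card H : ℂ)⁻¹ •
      ∑ r, weylPairing (x.1, y.1) (-r) • weylFourier ρ (x.2, y.2) r := by
  refine CStarMatrix.ext fun b b' => ?_
  rw [weylModel_apply, CStarMatrix.smul_apply, cstarMatrix_sum_apply, mul_smul]
  congr 1
  simp only [CStarMatrix.smul_apply, weylFourier, cstarMatrixOf_apply]
  rw [Finset.sum_eq_single (b - b')]
  · simp
  · intro r _ hr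
    simp [Ne.symm hr]
  · simp

/-- Fourier inversion. It places the Fourier coefficients in the linear span of the model entries,
hence in the image algebra. -/
theorem weylFourier_eq_sum_weylModel (t r : AddChar H ℂ × AddChar H ℂ) :
    weylFourier ρ t r = (Fintype.card H : ℂ)⁻¹ •
      ∑ I : H × H, weylPairing I r • weylModel ρ (I.1, t.1) (I.2, t.2) := by
  have hn := card_ne_zero_complex (H := H)
  refine CStarMatrix.ext fun b b' => ?_
  rw [CStarMatrix.smul_apply, cstarMatrix_sum_apply]
  have hc : ∀ I : H × H, (weylPairing I r • weylModel ρ (I.1, t.1) (I.2, t.2)) b b' =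
      (weylPairing I (r + (b' - b)) * (Fintype.card H : ℂ)⁻¹) •
        entryCoeff ρ (b - t) (b' - t) := fun I => by
    rw [CStarMatrix.smul_apply, weylModel_apply, smul_smul, weylPairing_add]
    congr 1
    ring
  rw [Finset.sum_congr rfl fun I _ => hc I, ← Finset.sum_smul, ← Finset.sum_mul, sum_weylPairing,
    smul_smul]
  have h : r + (b' - b) = 0 ↔ b - b' = r := by
    rw [← neg_sub b b', ← sub_eq_add_neg, sub_eq_zero, eq_comm]
  simp only [weylFourier, cstarMatrixOf_apply, h]
  split_ifs
  · rw [← one_smul ℂ (entryCoeff ρ (b - t) (b' - t)), smul_smul]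
    congr 1
    field_simp
  · simp

end WeylEntries

/-! ## The twirling morphism -/

section Twirl

variable {H : Type*} [AddCommGroup H] [Fintype H] {G : Type*} [Group G] [TopologicalSpace G]
  [IsTopologicalGroup G] [CompactSpace G] (ρ : WeylRep H G)

/-- The map `U ↦ W_ic^* U W_jd`. -/
noncomputable def weylTranslate (I : H × H) (c : AddChar H ℂ × AddChar H ℂ) : C(G, G) where
  toFun U := (ρ.weyl I.1 c.1)⁻¹ * U * ρ.weyl I.2 c.2
  continuous_toFun := (continuous_const.mul continuous_id).mul continuous_const

/-- Translation by Weyl matrices shifts the indices of the entries of `U` and multiplies them by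
characters; in the product with a conjugate only the difference `h - k` of the characters remains.
-/
theorem entryCoeff_weylTranslate (I : H × H) (c h k : AddChar H ℂ × AddChar H ℂ) :
    (entryCoeff ρ h k).comp (weylTranslate ρ I c) =
      weylPairing I (h - k) • entryCoeff ρ (c + h) (c + k) := by
  ext U
  have hU : ρ.toHom (weylTranslate ρ I c U) =
      star (weylMatrix I.1 c.1) * ρ.toHom U * weylMatrix I.2 c.2 := by
    change ρ.toHom ((ρ.weyl I.1 c.1)⁻¹ * U * ρ.weyl I.2 c.2) = _
    rw [map_mul, map_mul, ρ.toHom_inv, ρ.toHom_weyl, ρ.toHom_weyl]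
  have hm : ∀ h : AddChar H ℂ × AddChar H ℂ,
      ρ.toHom (weylTranslate ρ I c U) h.1 h.2 =
      weylPairing I h * ρ.toHom U (c + h).1 (c + h).2 := by
    intro h
    rw [hU, mul_weylMatrix_apply, star_weylMatrix_mul_apply, weylPairing, Prod.fst_add,
      Prod.snd_add]
    ring
  rw [ContinuousMap.comp_apply, entryCoeff_apply, hm, hm, ContinuousMap.smul_apply,
    entryCoeff_apply, star_mul', star_weylPairing, weylPairing_sub, smul_eq_mul]
  ring

/-- The entries of the twirling morphism. -/
noncomputable def twirlEntry (f : C(G, ℂ)) (k k' : AddChar H ℂ × AddChar H ℂ) :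
    RandomMatrix (AddChar H ℂ × AddChar H ℂ) G :=
  cstarMatrixOf fun b b' => if b - k = b' - k' then ((Fintype.card H : ℂ) ^ 2)⁻¹ •
    ∑ I : H × H, weylPairing I (k' - k) • f.comp (weylTranslate ρ I (b - k)) else 0

/-- On the block `b - k = c`, the twirl is the Fourier conjugate of the diagonal matrix with entries
`f ∘ weylTranslate ρ I c`, with `I` ranging over `H × H`. Multiplicativity is thus that of diagonal
matrices. -/
theorem twirlEntry_mul [DecidableEq H] (f g : C(G, ℂ)) (k k' : AddChar H ℂ × AddChar H ℂ) :
    twirlEntry ρ (f * g) k k' = ∑ l, twirlEntry ρ f k l * twirlEntry ρ g l k' := by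
  have hn := card_ne_zero_complex (H := H)
  refine CStarMatrix.ext fun b b' => ?_
  rw [cstarMatrix_sum_apply]
  simp only [CStarMatrix.mul_apply]
  -- Both factors live on the same block, so `m` is forced to be `b - k + l`.
  have h1 : ∀ l, ∑ m, twirlEntry ρ f k l b m * twirlEntry ρ g l k' m b' =
      twirlEntry ρ f k l b (b - k + l) * twirlEntry ρ g l k' (b - k + l) b' := fun l => by
    refine Finset.sum_eq_single _ (fun m _ hm => ?_) (by simp)
    have : ¬ b - k = m - l := fun h => hm (by rw [h]; abel)
    simp [twirlEntry, this]
  rw [Finset.sum_congr rfl fun l _ => h1 l]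
  simp only [twirlEntry, cstarMatrixOf_apply, add_sub_cancel_right, if_true]
  split_ifs with h
  · simp only [smul_mul_smul_comm, Finset.sum_mul_sum, ← Finset.smul_sum]
    rw [Finset.sum_comm]
    have h2 : ∀ I : H × H, (∑ l, ∑ J : H × H, (weylPairing I (l - k) * weylPairing J (k' - l)) •
        (f.comp (weylTranslate ρ I (b - k)) * g.comp (weylTranslate ρ J (b - k)))) =
        ((Fintype.card H : ℂ) ^ 2 * weylPairing I (k' - k)) •
          (f * g).comp (weylTranslate ρ I (b - k)) := by
      intro I
      rw [Finset.sum_comm]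
      -- The dependence on `l` is the character of `I - J`, so summing over `l` leaves only `J = I`.
      have h3 : ∀ J : H × H, ∑ l, (weylPairing I (l - k) * weylPairing J (k' - l)) •
          (f.comp (weylTranslate ρ I (b - k)) * g.comp (weylTranslate ρ J (b - k))) =
          (weylPairing I (-k) * weylPairing J k' *
            if I - J = 0 then (Fintype.card H : ℂ) ^ 2 else 0) •
          (f.comp (weylTranslate ρ I (b - k)) * g.comp (weylTranslate ρ J (b - k))) := by
        intro J
        rw [← Finset.sum_smul, ← sum_weylPairing_right, Finset.mul_sum]
        congr 1
        refine Finset.sum_congr rfl fun l _ => ?_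
        rw [sub_eq_add_neg I J, weylPairing_add_left, weylPairing_neg_left, weylPairing_sub,
          weylPairing_sub]
        ring
      rw [Finset.sum_congr rfl fun J _ => h3 J, Finset.sum_eq_single I]
      · rw [sub_self, if_pos rfl, weylPairing_sub, ContinuousMap.mul_comp]
        congr 1
        ring
      · intro J _ hJ
        rw [if_neg (sub_ne_zero.2 hJ.symm), mul_zero, zero_smul]
      · simp
    rw [Finset.sum_congr rfl fun I _ => h2 I]
    simp only [mul_smul, ← Finset.smul_sum]
    rw [smul_smul, smul_smul]
    congr 1
    field_simp
  · simp

theorem twirlEntry_smul (c : ℂ) (f : C(G, ℂ)) (k k' : AddChar H ℂ × AddChar H ℂ) :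
    twirlEntry ρ (c • f) k k' = c • twirlEntry ρ f k k' := by
  refine CStarMatrix.ext fun b b' => ?_
  simp only [twirlEntry, cstarMatrixOf_apply, CStarMatrix.smul_apply, ContinuousMap.smul_comp]
  split_ifs
  · rw [smul_comm c]
    congr 1
    rw [Finset.smul_sum]
    exact Finset.sum_congr rfl fun I _ =>
      smul_comm (weylPairing I (k' - k)) c (f.comp (weylTranslate ρ I (b - k)))
  · simp

theorem twirlEntry_add (f g : C(G, ℂ)) (k k' : AddChar H ℂ × AddChar H ℂ) :
    twirlEntry ρ (f + g) k k' = twirlEntry ρ f k k' + twirlEntry ρ g k k' := by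
  refine CStarMatrix.ext fun b b' => ?_
  simp only [twirlEntry, cstarMatrixOf_apply, CStarMatrix.add_apply, ContinuousMap.add_comp]
  split_ifs
  · simp [Finset.sum_add_distrib]
  · simp

theorem twirlEntry_one (k k' : AddChar H ℂ × AddChar H ℂ) :
    twirlEntry ρ 1 k k' = if k = k' then 1 else 0 := by
  have hn := card_ne_zero_complex (H := H)
  refine CStarMatrix.ext fun b b' => ?_
  simp only [twirlEntry, cstarMatrixOf_apply, ContinuousMap.one_comp]
  rw [← Finset.sum_smul, sum_weylPairing]
  by_cases hk : k = k'
  · subst hk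
    simp [CStarMatrix.one_apply, hn]
  · simp [hk, sub_eq_zero, Ne.symm hk]

theorem twirlEntry_star (f : C(G, ℂ)) (k k' : AddChar H ℂ × AddChar H ℂ) :
    twirlEntry ρ (star f) k k' = star (twirlEntry ρ f k' k) := by
  refine CStarMatrix.ext fun b b' => ?_
  simp only [twirlEntry, cstarMatrixOf_apply, CStarMatrix.star_apply]
  by_cases h : b - k = b' - k'
  · rw [if_pos h, if_pos h.symm, star_smul, star_sum, ← h]
    congr 1
    · simp
    · refine Finset.sum_congr rfl fun I _ => ?_
      rw [star_smul, star_weylPairing, neg_sub]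
      rfl
  · rw [if_neg h, if_neg (Ne.symm h), star_zero]

/-- The twirling morphism `C(G) → M_N(M_N(C(G)))`. -/
noncomputable def twirl [DecidableEq H] : C(G, ℂ) →⋆ₐ[ℂ]
    CStarMatrix (AddChar H ℂ × AddChar H ℂ) (AddChar H ℂ × AddChar H ℂ)
      (RandomMatrix (AddChar H ℂ × AddChar H ℂ) G) where
  toFun f := cstarMatrixOf fun k k' => twirlEntry ρ f k k'
  map_one' := CStarMatrix.ext fun k k' => twirlEntry_one ρ k k'
  map_mul' f g := CStarMatrix.ext fun k k' => by
    rw [CStarMatrix.mul_apply]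
    exact twirlEntry_mul ρ f g k k'
  map_zero' := CStarMatrix.ext fun k k' => by
    have := twirlEntry_smul ρ 0 0 k k'
    rwa [zero_smul, zero_smul] at this
  map_add' f g := CStarMatrix.ext fun k k' => twirlEntry_add ρ f g k k'
  commutes' c := CStarMatrix.ext fun k k' => by
    rw [Algebra.algebraMap_eq_smul_one, Algebra.algebraMap_eq_smul_one, CStarMatrix.smul_apply]
    exact (twirlEntry_smul ρ c 1 k k').trans (congrArg (c • ·) (twirlEntry_one ρ k k'))
  map_star' f := CStarMatrix.ext fun k k' => twirlEntry_star ρ f k k'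

theorem twirl_apply [DecidableEq H] (f : C(G, ℂ)) (k k' b b' : AddChar H ℂ × AddChar H ℂ) :
    twirl ρ f k k' b b' = if b - k = b' - k' then ((Fintype.card H : ℂ) ^ 2)⁻¹ •
    ∑ I : H × H, weylPairing I (k' - k) • f.comp (weylTranslate ρ I (b - k)) else 0 := rfl

/-- Averaging the characters produced by the translations over `I` yields the condition `k - k' = h
- h'`. What survives is a Fourier coefficient of the model, so products of entries of `U` are
twirled into matrices over the image algebra. -/
theorem twirl_entryCoeff [DecidableEq H] (h h' k k' : AddChar H ℂ × AddChar H ℂ) :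
    twirl ρ (entryCoeff ρ h h') k k' =
      if k - k' = h - h' then weylFourier ρ (k - h) (h - h') else 0 := by
  have hn := card_ne_zero_complex (H := H)
  refine CStarMatrix.ext fun b b' => ?_
  rw [twirl_apply]
  simp only [entryCoeff_weylTranslate, smul_smul, ← weylPairing_add]
  rw [← Finset.sum_smul, sum_weylPairing]
  have h1 : k' - k + (h - h') = 0 ↔ k - k' = h - h' := by
    rw [← neg_sub k k', neg_add_eq_zero]
  simp only [h1]
  by_cases hk : k - k' = h - h'
  · have h2 : b - k = b' - k' ↔ b - b' = h - h' := by
      rw [← hk, sub_eq_sub_iff_sub_eq_sub]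
    simp only [if_pos hk, h2, weylFourier, cstarMatrixOf_apply]
    split_ifs with hb
    · have e1 : b - k + h = b - (k - h) := by abel
      have e2 : b - k + h' = b' - (k - h) := by
        have h3 : h' = h - (b - b') := by rw [hb]; abel
        rw [h3]
        abel
      rw [e1, e2, smul_smul, inv_mul_cancel₀ (pow_ne_zero 2 hn), one_smul]
    · rfl
  · simp [hk]

end Twirl

/-! ## Restricting matrix-valued morphisms -/

section Restrict

variable {κ A M : Type*} [Fintype κ] [DecidableEq κ] [CStarAlgebra A] [CStarAlgebra M]

theorem StarAlgHom.continuous_cstarMatrix_entry (α : A →⋆ₐ[ℂ] CStarMatrix κ κ M) (k l : κ) :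
    Continuous fun a => α a k l := by
  let _ : PartialOrder M := CStarAlgebra.spectralOrder M
  have _ : StarOrderedRing M := CStarAlgebra.spectralOrderedRing M
  exact (CStarMatrix.continuous_entry k l).comp (StarAlgHom.continuous_of_cstar α)

/-- The elements which a matrix-valued morphism maps to matrices with entries in a subalgebra. -/
def cstarMatrixComap {A M : Type*} [Ring A] [StarRing A] [Algebra ℂ A] [StarModule ℂ A]
    [Ring M] [StarRing M] [Algebra ℂ M] [StarModule ℂ M]
    (α : A →⋆ₐ[ℂ] CStarMatrix κ κ M) (B : StarSubalgebra ℂ M) :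
    StarSubalgebra ℂ A where
  carrier := {a | ∀ k l, α a k l ∈ B}
  mul_mem' {a b} ha hb k l := by
    rw [map_mul, CStarMatrix.mul_apply]
    exact sum_mem fun m _ => mul_mem (ha k m) (hb m l)
  add_mem' {a b} ha hb k l := by
    rw [map_add, CStarMatrix.add_apply]
    exact add_mem (ha k l) (hb k l)
  algebraMap_mem' c k l := by
    rw [AlgHomClass.commutes α, CStarMatrix.algebraMap_apply]
    split_ifs
    · exact algebraMap_mem B c
    · exact zero_mem B
  star_mem' {a} ha k l := by
    rw [StarHomClass.map_star α, CStarMatrix.star_apply]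
    exact star_mem (ha l k)

variable (α : A →⋆ₐ[ℂ] CStarMatrix κ κ M) (B : StarSubalgebra ℂ M)

theorem mem_cstarMatrixComap {α : A →⋆ₐ[ℂ] CStarMatrix κ κ M} {B : StarSubalgebra ℂ M} {a : A} :
    a ∈ cstarMatrixComap α B ↔ ∀ k l, α a k l ∈ B := Iff.rfl

instance [h : IsClosed (B : Set M)] : IsClosed (cstarMatrixComap α B : Set A) := by
  have : (cstarMatrixComap α B : Set A) = ⋂ k, ⋂ l, (fun a => α a k l) ⁻¹' B := by
    ext a
    simp [mem_cstarMatrixComap]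
  rw [this]
  exact isClosed_iInter fun k => isClosed_iInter fun l =>
    h.preimage (StarAlgHom.continuous_cstarMatrix_entry α k l)

/-- The restriction of a matrix-valued morphism. -/
def cstarMatrixRestrict : cstarMatrixComap α B →⋆ₐ[ℂ] CStarMatrix κ κ B where
  toFun a := cstarMatrixOf fun k l => ⟨α a k l, a.2 k l⟩
  map_one' := by
    ext k l
    by_cases h : k = l <;> simp [CStarMatrix.one_apply, h]
  map_mul' a b := by
    ext k l
    simp [CStarMatrix.mul_apply]
  map_zero' := by ext k l; simp
  map_add' a b := by ext k l; simp
  commutes' c := by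
    ext k l
    have : ((algebraMap ℂ (cstarMatrixComap α B) c : cstarMatrixComap α B) : A) =
      algebraMap ℂ A c := rfl
    by_cases h : k = l <;> simp [CStarMatrix.algebraMap_apply, h, this, AlgHomClass.commutes α]
  map_star' a := by
    ext k l
    simp [CStarMatrix.star_apply, StarHomClass.map_star α]

/-- A matrix-valued morphism factors through an injective morphism whose range contains the
entries of its values. -/
theorem exists_cstarMatrix_lift {Q R : Type*} [Ring Q] [StarRing Q] [Algebra ℂ Q]
    [Ring R] [StarRing R] [Algebra ℂ R] (τ : Q →⋆ₐ[ℂ] R) (hτ : Function.Injective τ)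
    (γ : A →⋆ₐ[ℂ] CStarMatrix κ κ R) (h : ∀ a k l, ∃ q, τ q = γ a k l) :
    ∃ β : A →⋆ₐ[ℂ] CStarMatrix κ κ Q, ∀ a k l, τ (β a k l) = γ a k l := by
  choose f hf using h
  refine ⟨{ toFun := fun a => cstarMatrixOf (f a)
            map_one' := ?_
            map_mul' := fun a b => ?_
            map_zero' := ?_
            map_add' := fun a b => ?_
            commutes' := fun c => ?_
            map_star' := fun a => ?_ }, hf⟩ <;>
  refine CStarMatrix.ext fun k l => hτ ?_ <;> rw [cstarMatrixOf_apply, hf]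
  · simp [CStarMatrix.one_apply, apply_ite τ]
  · simp [CStarMatrix.mul_apply, hf]
  · simp
  · simp [hf]
  · simp [CStarMatrix.algebraMap_apply, apply_ite τ, AlgHomClass.commutes]
  · simp [CStarMatrix.star_apply, hf, map_star]

end Restrict

/-! ## Comultiplications from matrix-valued morphisms -/

section MatrixComul

variable {κ A B : Type*} [Fintype κ] [DecidableEq κ] [CStarAlgebra A] [CStarAlgebra B]

/-- The bilinear map `(f, g) ↦ α(f)_{p₁q₁} ⊗ α(g)_{p₂q₂}`, as a linear map on the tensor product. -/
noncomputable def tensorEntry (α : A →⋆ₐ[ℂ] CStarMatrix κ κ B) (p q : κ × κ) :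
    A ⊗[ℂ] A →ₗ[ℂ] MaxTensor B B :=
  TensorProduct.lift ((maxTmulBilin B B).compl₁₂
    ({ toFun := fun a => α a p.1 q.1, map_add' := by simp, map_smul' := by simp } : A →ₗ[ℂ] B)
    ({ toFun := fun a => α a p.2 q.2, map_add' := by simp, map_smul' := by simp } : A →ₗ[ℂ] B))

@[simp]
theorem tensorEntry_tmul (α : A →⋆ₐ[ℂ] CStarMatrix κ κ B) (p q : κ × κ) (f g : A) :
    tensorEntry α p q (f ⊗ₜ g) = maxTmul (α f p.1 q.1) (α g p.2 q.2) := rfl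

/-- The morphism `f ⊗ g ↦ α(f) ⊗ α(g)`. -/
theorem exists_tensor_cstarMatrix (α : A →⋆ₐ[ℂ] CStarMatrix κ κ B) :
    ∃ Γ : MaxTensor A A →⋆ₐ[ℂ] CStarMatrix (κ × κ) (κ × κ) (MaxTensor B B),
      ∀ t p q, Γ (toMaxTensor A A t) p q = tensorEntry α p q t := by
  let _ : PartialOrder (MaxTensor B B) := CStarAlgebra.spectralOrder _
  have _ : StarOrderedRing (MaxTensor B B) := CStarAlgebra.spectralOrderedRing _
  let αl : A →⋆ₐ[ℂ] CStarMatrix (κ × κ) (κ × κ) (MaxTensor B B) :=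
    (cstarMatrixAmpLeft κ).comp ((cstarMatrixMap (maxInl B B)).comp α)
  let αr : A →⋆ₐ[ℂ] CStarMatrix (κ × κ) (κ × κ) (MaxTensor B B) :=
    (cstarMatrixAmpRight κ).comp ((cstarMatrixMap (maxInr B B)).comp α)
  have hlr : ∀ f g p q, (αl f * αr g) p q = maxTmul (α f p.1 q.1) (α g p.2 q.2) :=
    fun f g p q => (cstarMatrixAmpLeft_mul_ampRight _ _ p q).trans (maxInl_mul_maxInr _ _)
  have hrl : ∀ f g p q, (αr g * αl f) p q = maxTmul (α f p.1 q.1) (α g p.2 q.2) :=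
    fun f g p q => (cstarMatrixAmpRight_mul_ampLeft _ _ p q).trans
      ((commute_maxInl_maxInr _ _).symm.eq.trans (maxInl_mul_maxInr _ _))
  have hc : ∀ f g, Commute (αl f) (αr g) := fun f g => CStarMatrix.ext fun p q =>
    (hlr f g p q).trans (hrl f g p q).symm
  refine ⟨maxTensorLift αl αr hc, fun t p q => ?_⟩
  rw [maxTensorLift_toMaxTensor]
  induction t using TensorProduct.induction_on with
  | zero => simp
  | add s t hs ht => rw [map_add, map_add, CStarMatrix.add_apply, hs, ht]
  | tmul f g => rw [tensorLiftStar_tmul, hlr, tensorEntry_tmul]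

variable {G : Type*} [TopologicalSpace G] [CompactSpace G] [Mul G] [ContinuousMul G]

variable (G) in
/-- The multiplication of a topological monoid, as a continuous map. -/
def continuousMulMap : C(G × G, G) := ⟨fun z => z.1 * z.2, continuous_mul⟩

variable (G κ) in
/-- The morphism `M_K(C(G)) → M_K(C(G × G))` given by the multiplication of `G`. -/
noncomputable def randomMatrixComul : RandomMatrix κ G →⋆ₐ[ℂ] RandomMatrix κ (G × G) :=
  cstarMatrixMap (ContinuousMap.compStarAlgHom' ℂ ℂ (continuousMulMap G))

theorem randomMatrixComul_apply (f : RandomMatrix κ G) (k l : κ) (z : G × G) :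
    randomMatrixComul κ G f k l z = f k l (z.1 * z.2) := rfl

/-- The morphism `B → M_{K³}(B ⊗ B)` obtained by comultiplying the entries of the elements of
`B ⊂ M_K(C(G))`, and applying the morphism `α` to both legs of the result. -/
theorem exists_comul_matrix (i : B →⋆ₐ[ℂ] RandomMatrix κ G) (j : A →⋆ₐ[ℂ] C(G, ℂ))
    (α : A →⋆ₐ[ℂ] CStarMatrix κ κ B) (hj : Isometry (maxTensorToProd j j)) {Y : Type*} (s : Y → B)
    (hs : (StarAlgebra.adjoin ℂ (Set.range s)).topologicalClosure = ⊤)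
    (h : ∀ y k l, ∃ t, maxTensorToProd j j (toMaxTensor A A t) =
      randomMatrixComul κ G (i (s y)) k l) :
    (∃ Θ : B →⋆ₐ[ℂ] CStarMatrix (κ × κ × κ) (κ × κ × κ) (MaxTensor B B), ∀ b k l t,
      maxTensorToProd j j (toMaxTensor A A t) = randomMatrixComul κ G (i b) k l →
        ∀ p q, Θ b (k, p) (l, q) = tensorEntry α p q t) ∧
    ∀ b ∈ StarAlgebra.adjoin ℂ (Set.range s), ∀ k l, ∃ t, maxTensorToProd j j (toMaxTensor A A t) =
      randomMatrixComul κ G (i b) k l := by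
  set τ := maxTensorToProd j j
  set γ : B →⋆ₐ[ℂ] RandomMatrix κ (G × G) := (randomMatrixComul κ G).comp i
  -- Elements of the generated `*`-algebra have comultiplied entries coming from the algebraic
  -- tensor product. General elements of `B` only reach the maximal one, by the closedness of the
  -- range of an isometry.
  have h0 : StarAlgebra.adjoin ℂ (Set.range s) ≤
      cstarMatrixComap γ (τ.comp (toMaxTensor A A)).range := by
    refine StarAlgebra.adjoin_le ?_
    rintro _ ⟨y, rfl⟩ k l
    obtain ⟨t, ht⟩ := h y k l
    exact ⟨t, ht⟩
  have hcl : IsClosed (τ.range : Set C(G × G, ℂ)) := by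
    have := hj.isClosedEmbedding.isClosed_range
    have h2 : (τ.range : Set C(G × G, ℂ)) = Set.range τ := rfl
    rwa [h2]
  have h1 : ∀ b, b ∈ cstarMatrixComap γ τ.range := by
    intro b
    have h2 : StarAlgebra.adjoin ℂ (Set.range s) ≤ cstarMatrixComap γ τ.range := by
      refine h0.trans fun b hb k l => ?_
      obtain ⟨t, ht⟩ := hb k l
      exact ⟨_, ht⟩
    have h3 := StarSubalgebra.topologicalClosure_minimal h2
      (inferInstance : IsClosed (cstarMatrixComap γ τ.range : Set B))
    rw [hs] at h3
    exact h3 trivial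
  refine ⟨?_, fun b hb k l => h0 hb k l⟩
  obtain ⟨β, hβ⟩ := exists_cstarMatrix_lift τ hj.injective γ fun a k l => h1 a k l
  obtain ⟨Γ, hΓ⟩ := exists_tensor_cstarMatrix α
  refine ⟨cstarMatrixFlatten.comp ((cstarMatrixMap Γ).comp β), fun b k l t ht p q => ?_⟩
  rw [← hΓ]
  -- Injectivity makes the result independent of the tensor chosen to represent the function.
  have : β b k l = toMaxTensor A A t := hj.injective ((hβ b k l).trans ht.symm)
  rw [← this]
  rfl

end MatrixComul

/-! ## The eigenvector equation for the comultiplication -/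

section Eigenvector

variable {K V D : Type*} [AddCommGroup K] [Fintype K] [DecidableEq K] [AddCommGroup V] [Module ℂ V]
  [AddCommGroup D] [Module ℂ D]

/-- The vector `∑ e_{ps} ⊗ e_{pq} ⊗ e_{qs}`. -/
def comulVector (K : Type*) [DecidableEq K] (j : (K × K) × (K × K) × (K × K)) : ℂ :=
  if j.1.1 = j.2.1.1 ∧ j.2.1.2 = j.2.2.1 ∧ j.2.2.2 = j.1.2 then 1 else 0

theorem sum_comulVector_smul (F : (K × K) × (K × K) × (K × K) → D) :
    ∑ j, comulVector K j • F j = ∑ p, ∑ s, ∑ q, F ((p, s), (p, q), (q, s)) := by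
  simp only [Fintype.sum_prod_type, comulVector, ite_and, ite_smul, one_smul, zero_smul]
  refine Finset.sum_congr rfl fun p _ => Finset.sum_congr rfl fun s _ => ?_
  rw [Finset.sum_eq_single p]
  · refine Finset.sum_congr rfl fun q _ => ?_
    rw [Finset.sum_eq_single q]
    · simp
    · intro q' _ hq
      simp [Ne.symm hq]
    · simp
  · intro p' _ hp
    simp [Ne.symm hp]
  · simp

/-- The Kronecker conditions force `(b, p)` into the support of `comulVector` and determine the
middle index of `j`. What remains is independent of `b` and `p`, after a change of summation
variables: this is the eigenvector property. -/
theorem sum_comulVector_smul_twirl (T : V →ₗ[ℂ] V →ₗ[ℂ] D) (m : K × K → K × K → V)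
    (wt : K × K → ℂ) (a d : K) (b : K × K) (p : (K × K) × (K × K)) :
    (∑ j, comulVector K j • wt (b - j.1) • ∑ c, ∑ c',
      T (if p.1 - j.2.1 = (b.1 - a, c) - (j.1.1 - a, c') then
          m (p.1 - (b.1 - a, c)) ((b.1 - a, c) - (j.1.1 - a, c')) else 0)
        (if p.2 - j.2.2 = (c, b.2 - d) - (c', j.1.2 - d) then
          m (p.2 - (c, b.2 - d)) ((c, b.2 - d) - (c', j.1.2 - d)) else 0)) =
    comulVector K (b, p) • ∑ r, ∑ s, wt (r, s) • ∑ w, ∑ u,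
      T (m (a, w) (r, u)) (m (w, d) (u, s)) := by
  rw [sum_comulVector_smul]
  dsimp only
  have key : ∀ P S Q c c',
      T (if p.1 - (P, Q) = (b.1 - a, c) - (P - a, c') then
          m (p.1 - (b.1 - a, c)) ((b.1 - a, c) - (P - a, c')) else 0)
        (if p.2 - (Q, S) = (c, b.2 - d) - (c', S - d) then
          m (p.2 - (c, b.2 - d)) ((c, b.2 - d) - (c', S - d)) else 0) =
      comulVector K (b, p) • if Q = p.1.2 - (c - c') then
        T (m (a, p.1.2 - c) (b.1 - P, c - c')) (m (p.1.2 - c, d) (c - c', b.2 - S)) else 0 := by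
    intro P S Q c c'
    obtain ⟨⟨p1, p2⟩, p3, p4⟩ := p
    obtain ⟨b1, b2⟩ := b
    simp only [comulVector, Prod.mk_sub_mk, Prod.mk.injEq, sub_sub_sub_cancel_right]
    by_cases h1 : b1 = p1
    · by_cases h2 : p2 = p3
      · by_cases h3 : p4 = b2
        -- On the support of the vector the two Kronecker conditions coincide, and each fixes `Q`.
        -- In the other cases they are incompatible, and both sides vanish.
        · subst h1 h2 h3
          have : p2 - Q = c - c' ↔ Q = p2 - (c - c') := by
            constructor
            · intro h; rw [← h]; abel
            · intro h; rw [h]; abel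
          simp only [this, true_and, and_true, if_true, one_smul, sub_sub_cancel]
          split_ifs
          · rfl
          · simp
        · simp [h3]
      · have : ¬ (p2 - Q = c - c' ∧ p3 - Q = c - c') := fun h => h2 (by
          simpa using h.1.trans h.2.symm)
        by_cases h4 : p2 - Q = c - c'
        · have h5 : ¬ p3 - Q = c - c' := fun h => this ⟨h4, h⟩
          simp [h2, h5]
        · simp [h2, h4]
    · simp [h1, Ne.symm h1]
  simp only [key, ← Finset.smul_sum, smul_comm _ (comulVector K (b, p))]
  congr 1
  -- The new variables are `r = b₁ - P` and `s = b₂ - S`; below, with `p₁₂` being the common middle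
  -- index, `w = p₁₂ - c` and `u = c - c'`.
  refine Fintype.sum_equiv (Equiv.subLeft b.1) _ _ fun P =>
    Fintype.sum_equiv (Equiv.subLeft b.2) _ _ fun S => ?_
  have h1 : b - (P, S) = (b.1 - P, b.2 - S) := rfl
  rw [h1]
  change _ = wt (b.1 - P, b.2 - S) • _
  congr 1
  rw [Finset.sum_comm]
  refine Fintype.sum_equiv (Equiv.subLeft p.1.2) _ _ fun c => ?_
  rw [Finset.sum_comm]
  refine Fintype.sum_equiv (Equiv.subLeft c) _ _ fun c' => ?_
  rw [Finset.sum_ite_eq' Finset.univ (p.1.2 - (c - c'))]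
  simp

end Eigenvector

/-! ### Fourier form of the comultiplied generators -/

section WeylComulSum

variable {H V D : Type*} [AddCommGroup H] [Fintype H] [AddCommGroup V] [Module ℂ V]
  [AddCommGroup D] [Module ℂ D]

/-- After expanding both factors, the group component `h` of `z` enters only through `(u' - u)(h)`.
Summing over `h` identifies the two inner Fourier indices and cancels one factor `1/n`. The result
has the form of the eigenvalue in `sum_comulVector_smul_twirl`. -/
theorem sum_bilin_fourier [DecidableEq H] (T : V →ₗ[ℂ] V →ₗ[ℂ] D)
    (m : AddChar H ℂ × AddChar H ℂ → AddChar H ℂ × AddChar H ℂ → V)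
    (v : H × AddChar H ℂ → H × AddChar H ℂ → V)
    (hv : ∀ x y, v x y = (Fintype.card H : ℂ)⁻¹ •
      ∑ r, weylPairing (x.1, y.1) (-r) • m (x.2, y.2) r) (x y : H × AddChar H ℂ) :
    ∑ z, T (v x z) (v z y) = ∑ r, ∑ s, ((Fintype.card H : ℂ)⁻¹ *
      weylPairing (x.1, y.1) (-(r, s))) • ∑ w, ∑ u, T (m (x.2, w) (r, u)) (m (w, y.2) (u, s)) := by
  have hn := card_ne_zero_complex (H := H)
  have h1 : ∀ w, ∑ h, T (v x (h, w)) (v (h, w) y) = ∑ r, ∑ s, ∑ u, ((Fintype.card H : ℂ)⁻¹ *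
      weylPairing (x.1, y.1) (-(r, s))) • T (m (x.2, w) (r, u)) (m (w, y.2) (u, s)) := by
    intro w
    have h2 : ∀ h, T (v x (h, w)) (v (h, w) y) = ∑ u', ∑ s, ∑ r, ∑ u,
        ((Fintype.card H : ℂ)⁻¹ * (Fintype.card H : ℂ)⁻¹ * weylPairing (x.1, y.1) (-(r, s)) *
          (u' - u) h) • T (m (x.2, w) (r, u)) (m (w, y.2) (u', s)) := by
      intro h
      rw [hv, hv]
      simp only [map_smul, map_sum, LinearMap.smul_apply, LinearMap.sum_apply, Finset.smul_sum,
        smul_smul, Fintype.sum_prod_type]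
      refine Finset.sum_congr rfl fun u' _ => Finset.sum_congr rfl fun s _ =>
        Finset.sum_congr rfl fun r _ => Finset.sum_congr rfl fun u _ => ?_
      congr 1
      simp only [weylPairing, Prod.neg_mk, AddChar.sub_apply, AddChar.neg_apply, neg_neg]
      ring
    simp only [h2]
    rw [Finset.sum_comm]
    refine Eq.trans (Finset.sum_congr rfl fun u' _ => ?_)
      (Finset.sum_comm.trans ((Finset.sum_congr rfl fun s _ => Finset.sum_comm).trans
        Finset.sum_comm))
    rw [Finset.sum_comm]
    refine Finset.sum_congr rfl fun s _ => ?_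
    rw [Finset.sum_comm]
    refine Finset.sum_congr rfl fun r _ => ?_
    rw [Finset.sum_comm, Finset.sum_eq_single u']
    · simp only [sub_self, AddChar.zero_apply, mul_one, Finset.sum_const, Finset.card_univ,
        ← Nat.cast_smul_eq_nsmul ℂ, smul_smul]
      congr 1
      field_simp
    · intro u _ hu
      rw [← Finset.sum_smul, ← Finset.mul_sum, AddChar.sum_eq_ite, if_neg (sub_ne_zero.2 hu.symm)]
      simp
    · simp
  rw [Fintype.sum_prod_type, Finset.sum_comm]
  simp only [h1, Finset.smul_sum]
  rw [Finset.sum_comm]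
  refine Finset.sum_congr rfl fun r _ => ?_
  rw [Finset.sum_comm]

end WeylComulSum

/-! ## The comultiplication of the Weyl matrix model -/

section WeylComul

variable {H : Type*} [AddCommGroup H] [Fintype H] [DecidableEq H]
  {G : Type*} [Group G] [TopologicalSpace G] [IsTopologicalGroup G] [CompactSpace G]

/-- The data of C*-algebras `B ⊂ M_N(C(G))` and `C ⊂ C(G)` such that the twirling morphism maps `C`
to `M_N(B)`, with `B` containing the coefficients of the Weyl matrix model, and `C` containing the
products of coefficients of `G`. -/
structure TwirlRestriction (ρ : WeylRep H G) (B C : Type*) [CStarAlgebra B] [CStarAlgebra C] where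
  incl : B →⋆ₐ[ℂ] RandomMatrix (AddChar H ℂ × AddChar H ℂ) G
  incl_injective : Function.Injective incl
  toFunctions : C →⋆ₐ[ℂ] C(G, ℂ)
  toFunctions_injective : Function.Injective toFunctions
  isometry_toProd : Isometry (maxTensorToProd toFunctions toFunctions)
  twirl : C →⋆ₐ[ℂ] CStarMatrix (AddChar H ℂ × AddChar H ℂ) (AddChar H ℂ × AddChar H ℂ) B
  incl_twirl : ∀ f k l, incl (twirl f k l) = _root_.twirl ρ (toFunctions f) k l
  coeff : AddChar H ℂ × AddChar H ℂ → AddChar H ℂ × AddChar H ℂ → C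
  toFunctions_coeff : ∀ h k, toFunctions (coeff h k) = entryCoeff ρ h k
  model : H × AddChar H ℂ → H × AddChar H ℂ → B
  incl_model : ∀ x y, incl (model x y) = weylModel ρ x y
  adjoin_model : (StarAlgebra.adjoin ℂ (Set.range
    fun k : (H × AddChar H ℂ) × (H × AddChar H ℂ) => model k.1 k.2)).topologicalClosure = ⊤

namespace TwirlRestriction

variable {ρ : WeylRep H G} {B C : Type*} [CStarAlgebra B] [CStarAlgebra C]
  (R : TwirlRestriction ρ B C)

theorem star_model (x y : H × AddChar H ℂ) : star (R.model x y) = R.model x y :=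
  R.incl_injective (by rw [StarHomClass.map_star R.incl, R.incl_model, star_weylModel])

/-- The partial Fourier transform of the model. -/
noncomputable def fourier (t r : AddChar H ℂ × AddChar H ℂ) : B :=
  (Fintype.card H : ℂ)⁻¹ • ∑ I : H × H, weylPairing I r • R.model (I.1, t.1) (I.2, t.2)

theorem incl_fourier (t r : AddChar H ℂ × AddChar H ℂ) :
    R.incl (R.fourier t r) = weylFourier ρ t r := by
  rw [weylFourier_eq_sum_weylModel, fourier, map_smul, map_sum]
  simp only [map_smul, R.incl_model]

theorem model_eq_sum_fourier (x y : H × AddChar H ℂ) :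
    R.model x y = (Fintype.card H : ℂ)⁻¹ •
      ∑ r, weylPairing (x.1, y.1) (-r) • R.fourier (x.2, y.2) r := by
  apply R.incl_injective
  rw [R.incl_model, weylModel_eq_sum_weylFourier, map_smul, map_sum]
  simp only [map_smul, R.incl_fourier]

theorem twirl_coeff (h h' k k' : AddChar H ℂ × AddChar H ℂ) :
    R.twirl (R.coeff h h') k k' =
      if k - k' = h - h' then R.fourier (k - h) (h - h') else 0 := by
  apply R.incl_injective
  rw [R.incl_twirl, R.toFunctions_coeff, twirl_entryCoeff]
  split_ifs
  · rw [R.incl_fourier]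
  · rw [map_zero]

/-- The entries of the model, comultiplied. -/
noncomputable def comulEntry (x y : H × AddChar H ℂ) (b b' : AddChar H ℂ × AddChar H ℂ) :
    C ⊗[ℂ] C :=
  ((Fintype.card H : ℂ)⁻¹ * weylPairing (x.1, y.1) (b' - b)) • ∑ c, ∑ c',
    R.coeff (b.1 - x.2, c) (b'.1 - x.2, c') ⊗ₜ[ℂ] R.coeff (c, b.2 - y.2) (c', b'.2 - y.2)

/-- Expanding the matrix product in `(UV)_h conj(UV)_k` writes the comultiplied entries as finite
sums of products of coefficients in `U` and `V`. -/
theorem toProd_comulEntry (x y : H × AddChar H ℂ) (b b' : AddChar H ℂ × AddChar H ℂ) :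
    maxTensorToProd R.toFunctions R.toFunctions (toMaxTensor C C (R.comulEntry x y b b')) =
      randomMatrixComul _ G (R.incl (R.model x y)) b b' := by
  ext z
  rw [randomMatrixComul_apply, R.incl_model, weylModel_apply,
    ContinuousMap.smul_apply, entryCoeff_mul]
  simp only [comulEntry, map_smul, map_sum, ContinuousMap.smul_apply, ContinuousMap.sum_apply]
  congr 1
  refine Finset.sum_congr rfl fun c _ => Finset.sum_congr rfl fun c' _ => ?_
  refine (maxTensorToProd_maxTmul _ _ _ _ z).trans ?_
  rw [R.toFunctions_coeff, R.toFunctions_coeff]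
  rfl

/-- The comultiplication of the image of the Weyl matrix model, together with the formula on which
the computation of its Haar integration is based. -/
theorem exists_comul :
    ∃ Δ : B →⋆ₐ[ℂ] MaxTensor B B,
      (∀ x y, Δ (R.model x y) = ∑ z, maxTmul (R.model x z) (R.model z y)) ∧
      ∀ b ∈ StarAlgebra.adjoin ℂ (Set.range fun k : (H × AddChar H ℂ) × (H × AddChar H ℂ) =>
        R.model k.1 k.2), ∃ t : AddChar H ℂ × AddChar H ℂ → AddChar H ℂ × AddChar H ℂ → C ⊗[ℂ] C,
        (∀ k l, maxTensorToProd R.toFunctions R.toFunctions (toMaxTensor C C (t k l)) =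
            randomMatrixComul _ G (R.incl b) k l) ∧
        ∀ i, comulVector (AddChar H ℂ) i • Δ b = ∑ j, comulVector (AddChar H ℂ) j •
          tensorEntry R.twirl i.2 j.2 (t i.1 j.1) := by
  obtain ⟨⟨Θ, hΘ⟩, hadj⟩ := exists_comul_matrix R.incl R.toFunctions R.twirl
    R.isometry_toProd _ R.adjoin_model fun x k l => ⟨_, R.toProd_comulEntry x.1 x.2 k l⟩
  let _ : PartialOrder (MaxTensor B B) := CStarAlgebra.spectralOrder _
  have _ : StarOrderedRing (MaxTensor B B) := CStarAlgebra.spectralOrderedRing _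
  -- The index `0` lies in the support of `comulVector`, with coordinate `1`, so the eigenvalue can
  -- be read there.
  obtain ⟨Δ, hΔ, hΔs⟩ := exists_starAlgHom_of_eigenvector Θ (comulVector (AddChar H ℂ)) 0
    (by simp [comulVector]) (fun k : (H × AddChar H ℂ) × (H × AddChar H ℂ) => R.model k.1 k.2)
    R.adjoin_model (fun k => R.star_model k.1 k.2)
    (fun k => ∑ z, maxTmul (R.model k.1 z) (R.model z k.2))
    (fun k => by simp [star_sum, star_maxTmul, R.star_model]) (fun x i => by
      have h1 := sum_bilin_fourier (maxTmulBilin B B) R.fourier R.model R.model_eq_sum_fourier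
        x.1 x.2
      simp only [maxTmulBilin_apply] at h1
      rw [h1]
      refine Eq.trans ?_ (sum_comulVector_smul_twirl (maxTmulBilin B B) R.fourier
        (fun r => (Fintype.card H : ℂ)⁻¹ * weylPairing (x.1.1, x.2.1) (-r)) x.1.2 x.2.2 i.1 i.2)
      refine Finset.sum_congr rfl fun j _ => ?_
      congr 1
      have h2 := hΘ (R.model x.1 x.2) i.1 j.1 _ (R.toProd_comulEntry x.1 x.2 i.1 j.1) i.2 j.2
      refine h2.trans ?_
      simp only [comulEntry, map_smul, map_sum, tensorEntry_tmul, R.twirl_coeff, neg_sub,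
        maxTmulBilin_apply])
  refine ⟨Δ, fun x y => hΔs (x, y), fun b hb => ?_⟩
  -- For `b` in the generated `*`-algebra the tensors are algebraic, so they can later be integrated
  -- term by term.
  choose t ht using hadj b hb
  refine ⟨t, ht, fun i => ?_⟩
  rw [← hΔ]
  refine Finset.sum_congr rfl fun j _ => ?_
  rw [← hΘ b i.1 j.1 _ (ht i.1 j.1)]

end TwirlRestriction

end WeylComul

/-! ## The Haar integration of the Weyl matrix model -/

section MatrixIntegral

variable {κ G : Type*} [Fintype κ] [DecidableEq κ] [TopologicalSpace G] [CompactSpace G]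
  [MeasurableSpace G] [BorelSpace G] (μ : MeasureTheory.Measure G)
  [MeasureTheory.IsProbabilityMeasure μ]

theorem ContinuousMap.integrable_of_compactSpace (f : C(G, ℂ)) : MeasureTheory.Integrable f μ :=
  f.continuous.integrable_of_hasCompactSupport (HasCompactSupport.of_compactSpace _)

theorem matrixIntegral_eq_sum (f : RandomMatrix κ G) :
    matrixIntegral μ f = (Fintype.card κ : ℂ)⁻¹ * ∑ k, ∫ x, f k k x ∂μ := by
  change ∫ x, _ ∂μ = _
  rw [MeasureTheory.integral_const_mul, MeasureTheory.integral_finsetSum]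
  exact fun k _ => ContinuousMap.integrable_of_compactSpace μ (f k k)

theorem matrixIntegral_one [Nonempty κ] : matrixIntegral μ (1 : RandomMatrix κ G) = 1 := by
  rw [matrixIntegral_eq_sum]
  simp

theorem matrixIntegral_mul_comm (f g : RandomMatrix κ G) :
    matrixIntegral μ (f * g) = matrixIntegral μ (g * f) := by
  change ∫ x, _ ∂μ = ∫ x, _ ∂μ
  congr 1
  ext x
  simp only [CStarMatrix.mul_apply, ContinuousMap.sum_apply, ContinuousMap.mul_apply]
  rw [Finset.sum_comm]
  simp only [mul_comm]

theorem matrixIntegral_star_mul_self_nonneg (f : RandomMatrix κ G) :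
    0 ≤ matrixIntegral μ (star f * f) := by
  have h : matrixIntegral μ (star f * f) =
      ((∫ x, (Fintype.card κ : ℝ)⁻¹ * ∑ k, ∑ m, ‖f m k x‖ ^ 2 ∂μ : ℝ) : ℂ) := by
    rw [← integral_complex_ofReal]
    change ∫ x, _ ∂μ = _
    congr 1
    ext x
    push_cast
    congr 1
    refine Finset.sum_congr rfl fun k _ => ?_
    rw [CStarMatrix.mul_apply, ContinuousMap.sum_apply]
    refine Finset.sum_congr rfl fun m _ => ?_
    rw [ContinuousMap.mul_apply, CStarMatrix.star_apply, ContinuousMap.star_apply, RCLike.star_def,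
      RCLike.conj_mul]
    rfl
  rw [h]
  exact Complex.zero_le_real.2 (MeasureTheory.integral_nonneg fun x => by positivity)

end MatrixIntegral

section CompactGroup

variable {G : Type*} [Group G] [TopologicalSpace G] [IsTopologicalGroup G] [CompactSpace G]
  [MeasurableSpace G] [BorelSpace G] (μ : MeasureTheory.Measure G)
  [μ.IsHaarMeasure] [MeasureTheory.IsProbabilityMeasure μ]

/-- The Haar probability measure of a compact group is right invariant. -/
theorem isMulRightInvariant_of_compactSpace : μ.IsMulRightInvariant where
  map_mul_right_eq_self g := by
    have : MeasureTheory.IsProbabilityMeasure (μ.map (· * g)) :=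
      MeasureTheory.Measure.isProbabilityMeasure_map (measurable_mul_const g).aemeasurable
    exact MeasureTheory.Measure.isHaarMeasure_eq_of_isProbabilityMeasure _ _

end CompactGroup

/-! ### Slices of twirled tensors -/

section TensorSlice

variable {κ A B : Type*} [Fintype κ] [DecidableEq κ] [CStarAlgebra A] [CStarAlgebra B]

/-- The map `f ⊗ g ↦ I(f)g`. -/
noncomputable def tensorSliceLeft (I : A →ₗ[ℂ] ℂ) : A ⊗[ℂ] A →ₗ[ℂ] A :=
  TensorProduct.lift (LinearMap.lsmul ℂ A ∘ₗ I)

/-- The map `f ⊗ g ↦ I(g)f`. -/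
noncomputable def tensorSliceRight (I : A →ₗ[ℂ] ℂ) : A ⊗[ℂ] A →ₗ[ℂ] A :=
  TensorProduct.lift (LinearMap.lsmul ℂ A ∘ₗ I).flip

@[simp]
theorem tensorSliceLeft_tmul (I : A →ₗ[ℂ] ℂ) (f g : A) :
    tensorSliceLeft I (f ⊗ₜ g) = I f • g := rfl

@[simp]
theorem tensorSliceRight_tmul (I : A →ₗ[ℂ] ℂ) (f g : A) :
    tensorSliceRight I (f ⊗ₜ g) = I g • f := rfl

variable (α : A →⋆ₐ[ℂ] CStarMatrix κ κ B) (φ : B →ₗ[ℂ] ℂ) (Φ : MaxTensor B B →L[ℂ] B)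
  (I : A →ₗ[ℂ] ℂ) (hI : ∀ f k l, φ (α f k l) = if k = l then I f else 0)

include hI

/-- Since `φ` sees only the diagonal of `α f`, and only through `I f`, slicing commutes with
applying `α`: it leaves `α` of the slice taken in `A ⊗ A`. -/
theorem sliceLeft_tensorEntry (hΦ : ∀ a b, Φ (maxTmul a b) = φ a • b) (t : A ⊗[ℂ] A)
    (p q : κ × κ) :
    Φ (tensorEntry α p q t) = if p.1 = q.1 then α (tensorSliceLeft I t) p.2 q.2 else 0 := by
  induction t using TensorProduct.induction_on with
  | zero => simp
  | add s t hs ht => simp only [map_add, hs, ht, CStarMatrix.add_apply]; split_ifs <;> simp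
  | tmul f g =>
    rw [tensorEntry_tmul, hΦ, hI, tensorSliceLeft_tmul, map_smul, CStarMatrix.smul_apply]
    split_ifs <;> simp

theorem sliceRight_tensorEntry (hΦ : ∀ a b, Φ (maxTmul a b) = φ b • a) (t : A ⊗[ℂ] A)
    (p q : κ × κ) :
    Φ (tensorEntry α p q t) = if p.2 = q.2 then α (tensorSliceRight I t) p.1 q.1 else 0 := by
  induction t using TensorProduct.induction_on with
  | zero => simp
  | add s t hs ht => simp only [map_add, hs, ht, CStarMatrix.add_apply]; split_ifs <;> simp
  | tmul f g =>
    rw [tensorEntry_tmul, hΦ, hI, tensorSliceRight_tmul, map_smul, CStarMatrix.smul_apply]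
    split_ifs <;> simp

end TensorSlice

/-! ### Slices as partial integrals over the group -/

section TensorIntegral

variable {A G : Type*} [CStarAlgebra A] [TopologicalSpace G] [CompactSpace G]
  [MeasurableSpace G] [BorelSpace G] (μ : MeasureTheory.Measure G)
  [MeasureTheory.IsProbabilityMeasure μ] (j : A →⋆ₐ[ℂ] C(G, ℂ))

/-- The linear form `f ↦ ∫ f`. -/
noncomputable def integralForm : A →ₗ[ℂ] ℂ where
  toFun f := ∫ x, j f x ∂μ
  map_add' f g := by
    simp only [map_add, ContinuousMap.add_apply]
    exact MeasureTheory.integral_add (ContinuousMap.integrable_of_compactSpace μ _)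
      (ContinuousMap.integrable_of_compactSpace μ _)
  map_smul' c f := by
    simp only [map_smul, ContinuousMap.smul_apply]
    exact MeasureTheory.integral_smul _ _

theorem integralForm_apply (f : A) : integralForm μ j f = ∫ x, j f x ∂μ := rfl

theorem tensorSliceLeft_integralForm (t : A ⊗[ℂ] A) (y : G) :
    j (tensorSliceLeft (integralForm μ j) t) y =
      ∫ x, maxTensorToProd j j (toMaxTensor A A t) (x, y) ∂μ := by
  induction t using TensorProduct.induction_on with
  | zero => simp
  | add s t hs ht =>
    simp only [map_add, ContinuousMap.add_apply, hs, ht]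
    refine (MeasureTheory.integral_add ?_ ?_).symm <;>
    exact Continuous.integrable_of_hasCompactSupport (by fun_prop)
      (HasCompactSupport.of_compactSpace _)
  | tmul f g =>
    have h : ∀ x, maxTensorToProd j j (toMaxTensor A A (f ⊗ₜ g)) (x, y) = j f x * j g y :=
      fun x => maxTensorToProd_maxTmul j j f g (x, y)
    simp only [h, MeasureTheory.integral_mul_const, tensorSliceLeft_tmul, map_smul,
      ContinuousMap.smul_apply, integralForm_apply, smul_eq_mul]

theorem tensorSliceRight_integralForm (t : A ⊗[ℂ] A) (x : G) :
    j (tensorSliceRight (integralForm μ j) t) x =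
      ∫ y, maxTensorToProd j j (toMaxTensor A A t) (x, y) ∂μ := by
  induction t using TensorProduct.induction_on with
  | zero => simp
  | add s t hs ht =>
    simp only [map_add, ContinuousMap.add_apply, hs, ht]
    refine (MeasureTheory.integral_add ?_ ?_).symm <;>
    exact Continuous.integrable_of_hasCompactSupport (by fun_prop)
      (HasCompactSupport.of_compactSpace _)
  | tmul f g =>
    have h : ∀ y, maxTensorToProd j j (toMaxTensor A A (f ⊗ₜ g)) (x, y) = j f x * j g y :=
      fun y => maxTensorToProd_maxTmul j j f g (x, y)
    simp only [h, MeasureTheory.integral_const_mul, tensorSliceRight_tmul, map_smul,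
      ContinuousMap.smul_apply, integralForm_apply, smul_eq_mul, mul_comm]

end TensorIntegral

/-! ### Invariance of the random matrix trace -/

section WeylHaar

variable {H : Type*} [AddCommGroup H] [Fintype H] [DecidableEq H]
  {G : Type*} [Group G] [TopologicalSpace G] [IsTopologicalGroup G] [CompactSpace G]
  [MeasurableSpace G] [BorelSpace G] (μ : MeasureTheory.Measure G)
  [μ.IsHaarMeasure] [MeasureTheory.IsProbabilityMeasure μ] {ρ : WeylRep H G}

theorem integral_comp_weylTranslate (f : C(G, ℂ)) (I : H × H)
    (c : AddChar H ℂ × AddChar H ℂ) : ∫ x, f (weylTranslate ρ I c x) ∂μ = ∫ x, f x ∂μ := by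
  have := isMulRightInvariant_of_compactSpace μ
  exact (MeasureTheory.integral_mul_left_eq_self
    (fun x => f (x * ρ.weyl I.2 c.2)) (ρ.weyl I.1 c.1)⁻¹).trans
    (MeasureTheory.integral_mul_right_eq_self f _)

/-- A diagonal entry `b = b'` lies in a block only when `k = l`, and then the entry is the average
of `n²` translates of `f`, all with the same integral. -/
theorem matrixIntegral_twirl (f : C(G, ℂ)) (k l : AddChar H ℂ × AddChar H ℂ) :
    matrixIntegral μ (twirl ρ f k l) = if k = l then ∫ x, f x ∂μ else 0 := by
  have hn := card_ne_zero_complex (H := H)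
  rw [matrixIntegral_eq_sum]
  simp only [twirl_apply]
  split_ifs with h
  · subst h
    have h1 : ∀ b : AddChar H ℂ × AddChar H ℂ, ∫ x, (((Fintype.card H : ℂ) ^ 2)⁻¹ •
        ∑ I : H × H, weylPairing I (k - k) • f.comp (weylTranslate ρ I (b - k))) x ∂μ =
        ∫ x, f x ∂μ := by
      intro b
      simp only [ContinuousMap.smul_apply, ContinuousMap.sum_apply, sub_self, weylPairing_zero,
        one_smul, smul_eq_mul, ContinuousMap.comp_apply]
      rw [MeasureTheory.integral_const_mul, MeasureTheory.integral_finsetSum]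
      · simp only [integral_comp_weylTranslate, Finset.sum_const, Finset.card_univ,
          Fintype.card_prod, nsmul_eq_mul]
        push_cast
        field_simp
      · exact fun I _ => ContinuousMap.integrable_of_compactSpace μ (f.comp (weylTranslate ρ I _))
    simp only [if_true, h1]
    simp
    field_simp
  · have h1 : ∀ b : AddChar H ℂ × AddChar H ℂ, ¬ b - k = b - l := fun b hb =>
      h (sub_right_injective hb)
    simp [h1]

namespace TwirlRestriction

variable {B C : Type*} [CStarAlgebra B] [CStarAlgebra C] (R : TwirlRestriction ρ B C)
  (φ : B →ₗ[ℂ] ℂ) (hφ : ∀ b, φ b = matrixIntegral μ (R.incl b))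

include hφ

theorem haar_twirl (f : C) (k l : AddChar H ℂ × AddChar H ℂ) :
    φ (R.twirl f k l) = if k = l then integralForm μ R.toFunctions f else 0 := by
  rw [hφ, R.incl_twirl, matrixIntegral_twirl]
  rfl

/-- Slicing turns `tensorEntry` into a multiple of `δ_pq`, so in the eigenvector equation only the
term `j = i` survives. Any `i` in the support then gives the integral of a single diagonal entry of
`b`, and averaging over these entries produces `φ b`. -/
theorem slice_comul (Φ : MaxTensor B B →L[ℂ] B) (Δ : B →⋆ₐ[ℂ] MaxTensor B B)
    (hΦ : ∀ (f : C(G, ℂ)) (t : C ⊗[ℂ] C),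
      (∀ z, maxTensorToProd R.toFunctions R.toFunctions (toMaxTensor C C t) z = f (z.1 * z.2)) →
        ∀ p q, Φ (tensorEntry R.twirl p q t) = if p = q then (∫ x, f x ∂μ) • (1 : B) else 0)
    (b : B) (t : AddChar H ℂ × AddChar H ℂ → AddChar H ℂ × AddChar H ℂ → C ⊗[ℂ] C)
    (ht : ∀ k l, maxTensorToProd R.toFunctions R.toFunctions (toMaxTensor C C (t k l)) =
            randomMatrixComul _ G (R.incl b) k l)
    (hΔ : ∀ i, comulVector (AddChar H ℂ) i • Δ b = ∑ j, comulVector (AddChar H ℂ) j •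
          tensorEntry R.twirl i.2 j.2 (t i.1 j.1)) : Φ (Δ b) = φ b • (1 : B) := by
  have h1 : ∀ k : AddChar H ℂ × AddChar H ℂ,
      Φ (Δ b) = (∫ x, R.incl b k k x ∂μ) • (1 : B) := by
    intro k
    -- The chosen index lies in the support of `comulVector` and has first component `k`; its middle
    -- component `0` is arbitrary.
    have h2 := congrArg Φ (hΔ (k, (k.1, 0), (0, k.2)))
    rw [map_smul, map_sum] at h2
    simp only [map_smul] at h2
    rw [sum_comulVector_smul (fun j => Φ (tensorEntry R.twirl ((k.1, 0), (0, k.2)) j.2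
      (t k j.1)))] at h2
    have h3 : ∀ l p q, Φ (tensorEntry R.twirl p q (t k l)) =
        if p = q then (∫ x, R.incl b k l x ∂μ) • (1 : B) else 0 := fun l p q =>
      hΦ _ _ (fun z => by rw [ht, randomMatrixComul_apply]) p q
    simp only [h3, comulVector, Prod.mk.injEq, ite_and, and_self, if_true, one_smul] at h2
    rw [h2]
    simp [Finset.sum_ite_eq]
  have h2 : (Fintype.card (AddChar H ℂ × AddChar H ℂ) : ℂ) ≠ 0 :=
    Nat.cast_ne_zero.2 Fintype.card_ne_zero
  calc Φ (Δ b) = (Fintype.card (AddChar H ℂ × AddChar H ℂ) : ℂ)⁻¹ •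
        ∑ k : AddChar H ℂ × AddChar H ℂ, Φ (Δ b) := by
        rw [Finset.sum_const, Finset.card_univ, ← Nat.cast_smul_eq_nsmul ℂ, smul_smul,
          inv_mul_cancel₀ h2, one_smul]
    _ = (Fintype.card (AddChar H ℂ × AddChar H ℂ) : ℂ)⁻¹ •
        ∑ k : AddChar H ℂ × AddChar H ℂ, (∫ x, R.incl b k k x ∂μ) • (1 : B) := by
        rw [Finset.sum_congr rfl fun k _ => h1 k]
    _ = _ := by rw [← Finset.sum_smul, smul_smul, hφ, matrixIntegral_eq_sum]

/-- `φ` is the slice map for `B = ℂ` restricted to the first leg, and slice maps are bounded.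
Continuity is needed to extend the invariance from the generated `*`-algebra to its closure. -/
theorem continuous_haar : Continuous φ := by
  obtain ⟨Φ, hΦ⟩ := exists_slice_left (B := ℂ) μ R.incl φ hφ
  have : (φ : B → ℂ) = fun b => Φ (maxInl B ℂ b) := by
    funext b
    refine Eq.trans ?_ (hΦ b 1).symm
    simp
  rw [this]
  exact Φ.continuous.comp (StarAlgHom.continuous_of_cstar _)

/-- The comultiplication of the image of the Weyl matrix model, and its Haar integration. -/
theorem exists_comul_isHaarIntegration :
    ∃ Δ : B →⋆ₐ[ℂ] MaxTensor B B,
      (∀ x y, Δ (R.model x y) = ∑ z, maxTmul (R.model x z) (R.model z y)) ∧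
      IsHaarIntegration Δ φ := by
  obtain ⟨Δ, hΔ, hadj⟩ := R.exists_comul
  have hext : ∀ Φ : MaxTensor B B →L[ℂ] B, (∀ (f : C(G, ℂ)) (t : C ⊗[ℂ] C),
      (∀ z, maxTensorToProd R.toFunctions R.toFunctions (toMaxTensor C C t) z = f (z.1 * z.2)) →
        ∀ p q, Φ (tensorEntry R.twirl p q t) = if p = q then (∫ x, f x ∂μ) • (1 : B) else 0) →
      ∀ b, Φ (Δ b) = φ b • (1 : B) := by
    intro Φ hΦ b
    have hb : b ∈ closure ((StarAlgebra.adjoin ℂ (Set.range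
        fun k : (H × AddChar H ℂ) × (H × AddChar H ℂ) => R.model k.1 k.2) :
          StarSubalgebra ℂ B) : Set B) := by
      rw [← StarSubalgebra.topologicalClosure_coe, R.adjoin_model]
      trivial
    refine closure_minimal (t := {b | Φ (Δ b) = φ b • (1 : B)}) (fun b hb => ?_)
      (isClosed_eq (Φ.continuous.comp (StarAlgHom.continuous_of_cstar Δ))
        ((R.continuous_haar μ φ hφ).smul continuous_const)) hb
    obtain ⟨t, ht, h⟩ := hadj b hb
    exact R.slice_comul μ φ hφ Φ Δ hΦ b t ht h
  -- By translation invariance a partial integral of `f(xy)` is a constant function, and a unital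
  -- morphism sends constants to scalar matrices. This supplies the second Kronecker factor.
  have hconst : ∀ c : ℂ, ∀ f : C, (∀ x, R.toFunctions f x = c) → ∀ k l,
      R.twirl f k l = if k = l then c • (1 : B) else 0 := by
    intro c f hf k l
    have : f = algebraMap ℂ C c := R.toFunctions_injective (by
      ext x
      rw [hf, AlgHomClass.commutes]
      rfl)
    rw [this, AlgHomClass.commutes, CStarMatrix.algebraMap_apply]
    split_ifs
    · rw [Algebra.algebraMap_eq_smul_one]
    · rfl
  have := isMulRightInvariant_of_compactSpace μ
  obtain ⟨Φ, hΦ⟩ := exists_slice_left (B := B) μ R.incl φ hφ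
  obtain ⟨Ψ, hΨ⟩ := exists_slice_right (B := B) μ R.incl φ hφ
  refine ⟨Δ, hΔ, fun a => ?_, ?_, fun a b => ?_, ⟨Φ, hΦ, hext Φ fun f t ht p q => ?_⟩,
    ⟨Ψ, fun a b => hΨ a b, hext Ψ fun f t ht p q => ?_⟩⟩
  · rw [hφ, map_mul, StarHomClass.map_star R.incl]
    exact matrixIntegral_star_mul_self_nonneg μ _
  · rw [hφ, map_one, matrixIntegral_one]
  · rw [hφ, hφ, map_mul R.incl, map_mul R.incl, matrixIntegral_mul_comm]
  · rw [sliceLeft_tensorEntry R.twirl φ Φ _ (R.haar_twirl μ φ hφ) hΦ,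
      hconst (∫ x, f x ∂μ) _ fun y => ?_]
    · simp only [Prod.ext_iff, ite_and]
    · rw [tensorSliceLeft_integralForm]
      simp only [ht]
      exact MeasureTheory.integral_mul_right_eq_self f y
  · rw [sliceRight_tensorEntry R.twirl φ Ψ _ (R.haar_twirl μ φ hφ) hΨ,
      hconst (∫ x, f x ∂μ) _ fun x => ?_]
    · have hpq : p = q ↔ p.2 = q.2 ∧ p.1 = q.1 := Prod.ext_iff.trans and_comm
      simp only [hpq, ite_and]
    · rw [tensorSliceRight_integralForm]
      simp only [ht]
      exact MeasureTheory.integral_mul_left_eq_self f x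

end TwirlRestriction

end WeylHaar

/-! ## The counit and the antipode -/

section Antipode

variable {ν G : Type*} [Fintype ν] [DecidableEq ν] [Group G] [TopologicalSpace G]
  [IsTopologicalGroup G] [CompactSpace G]

/-- The transposition of random matrices, combined with the flip of the indices and with the
inversion of `G`. -/
noncomputable def flipTranspose (f : RandomMatrix (ν × ν) G) : RandomMatrix (ν × ν) G :=
  cstarMatrixOf fun k l => (f l.swap k.swap).comp ⟨Inv.inv, continuous_inv⟩

theorem flipTranspose_apply (f : RandomMatrix (ν × ν) G) (k l : ν × ν) (x : G) :
    flipTranspose f k l x = f l.swap k.swap x⁻¹ := rfl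

theorem continuous_flipTranspose :
    Continuous (flipTranspose : RandomMatrix (ν × ν) G → RandomMatrix (ν × ν) G) := by
  refine continuous_pi fun k => continuous_pi fun l => ?_
  exact (ContinuousMap.continuous_precomp _).comp (CStarMatrix.continuous_entry l.swap k.swap)

/-- Transposition reverses products because the entries commute; the index flip and the inversion of
the group only relabel. -/
theorem flipTranspose_mul (f g : RandomMatrix (ν × ν) G) :
    flipTranspose (f * g) = flipTranspose g * flipTranspose f := by
  refine CStarMatrix.ext fun k l => ?_
  ext x
  rw [flipTranspose_apply, CStarMatrix.mul_apply, CStarMatrix.mul_apply, ContinuousMap.sum_apply,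
    ContinuousMap.sum_apply]
  exact Fintype.sum_equiv (Equiv.prodComm ν ν) _ _ fun m => mul_comm _ _

theorem flipTranspose_star (f : RandomMatrix (ν × ν) G) :
    flipTranspose (star f) = star (flipTranspose f) := rfl

theorem flipTranspose_add (f g : RandomMatrix (ν × ν) G) :
    flipTranspose (f + g) = flipTranspose f + flipTranspose g := rfl

theorem flipTranspose_algebraMap (c : ℂ) :
    flipTranspose (algebraMap ℂ (RandomMatrix (ν × ν) G) c) = algebraMap ℂ _ c := by
  refine CStarMatrix.ext fun k l => ?_
  ext x
  rw [flipTranspose_apply, CStarMatrix.algebraMap_apply, CStarMatrix.algebraMap_apply]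
  by_cases h : k = l
  · simp [h]
  · simp [h, Ne.symm h]

/-- A morphism to the opposite algebra, from an antimultiplicative map on a larger algebra that
preserves the generators. -/
theorem exists_antipode {B Y : Type*} [CStarAlgebra B] (i : B →⋆ₐ[ℂ] RandomMatrix (ν × ν) G)
    (hi : Function.Injective i) (s s' : Y → B)
    (hs : (StarAlgebra.adjoin ℂ (Set.range s)).topologicalClosure = ⊤)
    (h : ∀ y, flipTranspose (i (s y)) = i (s' y)) :
    ∃ S : B →⋆ₐ[ℂ] Bᵐᵒᵖ, ∀ y, S (s y) = MulOpposite.op (s' y) := by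
  -- Injective morphisms of C*-algebras are isometric, so the range is closed. The invariance of the
  -- range under `flipTranspose` thus need only be checked on the generated `*`-algebra.
  have hcl : IsClosed (Set.range i) :=
    (NonUnitalStarAlgHom.isometry i hi).isClosedEmbedding.isClosed_range
  have hex : ∀ b, ∃ b', i b' = flipTranspose (i b) := by
    intro b
    have hb : b ∈ closure ((StarAlgebra.adjoin ℂ (Set.range s) : StarSubalgebra ℂ B) : Set B) := by
      rw [← StarSubalgebra.topologicalClosure_coe, hs]
      trivial
    refine closure_minimal (t := {b | flipTranspose (i b) ∈ Set.range i}) (fun b hb => ?_)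
      (hcl.preimage (continuous_flipTranspose.comp (StarAlgHom.continuous_of_cstar i))) hb
    refine StarAlgebra.adjoin_induction (p := fun b _ => flipTranspose (i b) ∈ Set.range i)
      ?_ ?_ ?_ ?_ ?_ hb
    · rintro _ ⟨y, rfl⟩
      exact ⟨_, (h y).symm⟩
    · intro c
      exact ⟨algebraMap ℂ B c, by
        rw [AlgHomClass.commutes i, flipTranspose_algebraMap]⟩
    · rintro x y _ _ ⟨x', hx⟩ ⟨y', hy⟩
      exact ⟨x' + y', by rw [map_add i, map_add i, flipTranspose_add, hx, hy]⟩
    · rintro x y _ _ ⟨x', hx⟩ ⟨y', hy⟩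
      exact ⟨y' * x', by rw [map_mul i, map_mul i, flipTranspose_mul, hx, hy]⟩
    · rintro x _ ⟨x', hx⟩
      exact ⟨star x', by
        rw [StarHomClass.map_star i, StarHomClass.map_star i, flipTranspose_star, hx]⟩
  choose S hS using hex
  have hc : ∀ c, S (algebraMap ℂ B c) = algebraMap ℂ B c := fun c =>
    hi (by rw [hS, AlgHomClass.commutes i, flipTranspose_algebraMap])
  refine ⟨{ toFun := fun b => MulOpposite.op (S b)
            map_one' := ?_
            map_mul' := fun x y => ?_
            map_zero' := ?_
            map_add' := fun x y => ?_
            commutes' := fun c => congrArg MulOpposite.op (hc c)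
            map_star' := fun x => ?_ }, fun y => ?_⟩
  · have := hc 1
    rw [map_one] at this
    rw [this]
    rfl
  · refine congrArg MulOpposite.op (hi ?_)
    change i (S (x * y)) = i (S y * S x)
    rw [map_mul i, hS, hS, hS, map_mul i, flipTranspose_mul]
  · have := hc 0
    rw [map_zero] at this
    rw [this]
    rfl
  · refine congrArg MulOpposite.op (hi ?_)
    change i (S (x + y)) = i (S x + S y)
    rw [map_add i, hS, hS, hS, map_add i, flipTranspose_add]
  · refine congrArg MulOpposite.op (hi ?_)
    change i (S (star x)) = i (star (S x))
    rw [StarHomClass.map_star i, hS, hS, StarHomClass.map_star i, flipTranspose_star]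
  · exact congrArg MulOpposite.op (hi (by rw [hS, h]))

end Antipode

/-! ### Counit, antipode and unitarity for the Weyl model -/

section WeylCounit

variable {H : Type*} [AddCommGroup H] [Fintype H] [DecidableEq H]
  {G : Type*} [Group G] [TopologicalSpace G] [IsTopologicalGroup G] [CompactSpace G]

/-- Inversion replaces `U` by `U^*`, whose entries are conjugated and index-flipped; the flip and
the transposition undo this and exchange the roles of `x` and `y`. -/
theorem flipTranspose_weylModel (ρ : WeylRep H G) (x y : H × AddChar H ℂ) :
    flipTranspose (weylModel ρ x y) = weylModel ρ y x := by
  refine CStarMatrix.ext fun k l => ?_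
  ext U
  have hinv : ∀ a b, ρ.toHom U⁻¹ a b = star (ρ.toHom U b a) := fun a b => by
    rw [ρ.toHom_inv, Matrix.star_apply]
  rw [flipTranspose_apply, weylModel_apply, weylModel_apply, ContinuousMap.smul_apply,
    ContinuousMap.smul_apply, entryCoeff_apply, entryCoeff_apply, hinv, hinv, star_star]
  have hp : weylPairing (x.1, y.1) (k.swap - l.swap) = weylPairing (y.1, x.1) (l - k) := by
    have h1 : ∀ (a b : AddChar H ℂ) (z : H), (a - b) (-z) = (b - a) z := fun a b z => by
      rw [← AddChar.neg_apply, neg_sub]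
    simp only [weylPairing, Prod.fst_sub, Prod.snd_sub, Prod.fst_swap, Prod.snd_swap, h1]
    exact mul_comm _ _
  rw [hp, mul_comm (star _)]
  rfl

/-- At `U = 1` the projection is onto the line of `W_x W_y^*`. The identity matrix spans this line
when `x = y` and is orthogonal to it otherwise, by orthogonality of the Weyl matrices, so it is an
eigenvector with eigenvalue `δ_xy`. -/
theorem sum_weylModel_one (ρ : WeylRep H G) (x y : H × AddChar H ℂ)
    (b : AddChar H ℂ × AddChar H ℂ) :
    ∑ b' : AddChar H ℂ × AddChar H ℂ, (if b'.1 = b'.2 then (1 : ℂ) else 0) •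
      weylModel ρ x y b b' 1 = (if b.1 = b.2 then (1 : ℂ) else 0) • (if x = y then (1 : ℂ) else 0) := by
  have hn := card_ne_zero_complex (H := H)
  obtain ⟨i, a⟩ := x
  obtain ⟨j, d⟩ := y
  obtain ⟨b₁, b₂⟩ := b
  have h1 : ∀ p : AddChar H ℂ, weylModel ρ (i, a) (j, d) (b₁, b₂) (p, p) 1 =
      if b₁ = b₂ ∧ a = d then (Fintype.card H : ℂ)⁻¹ * (p - b₁) (j - i) else 0 := by
    intro p
    rw [weylModel_apply, ContinuousMap.smul_apply, entryCoeff_apply, map_one]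
    simp only [Prod.mk_sub_mk, Matrix.one_apply, weylPairing, sub_right_inj]
    by_cases had : a = d
    · subst had
      by_cases hb : b₁ = b₂
      · subst hb
        rw [sub_eq_add_neg j i, AddChar.map_add_eq_mul]
        simp
        ring
      · simp [hb]
    · simp [had]
  have h2 : ∑ p : AddChar H ℂ, (p - b₁) (j - i) =
      if i = j then (Fintype.card H : ℂ) else 0 := by
    rw [Fintype.sum_equiv (Equiv.subRight b₁) (fun p => (p - b₁) (j - i)) (fun p => p (j - i))
      fun p => rfl, AddChar.sum_apply_eq_ite]
    simp only [sub_eq_zero, eq_comm (a := j)]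
  rw [Fintype.sum_prod_type]
  simp only [ite_smul, one_smul, zero_smul, Finset.sum_ite_eq, Finset.mem_univ, if_true, h1]
  by_cases had : a = d
  · by_cases hb : b₁ = b₂
    · simp only [had, hb, and_self, if_true]
      rw [← Finset.mul_sum, ← hb, h2]
      by_cases hij : i = j <;> simp [hij, hn]
    · simp [hb]
  · simp [had]

namespace TwirlRestriction

variable {ρ : WeylRep H G} {B C : Type*} [CStarAlgebra B] [CStarAlgebra C]
  (R : TwirlRestriction ρ B C)

theorem exists_counit : ∃ ε : B →⋆ₐ[ℂ] ℂ, ∀ x y, ε (R.model x y) = if x = y then 1 else 0 := by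
  obtain ⟨ε, -, hε⟩ := exists_starAlgHom_of_eigenvector ((evalRandomMatrix 1).comp R.incl)
    (fun b : AddChar H ℂ × AddChar H ℂ => if b.1 = b.2 then 1 else 0) 0 (by simp)
    (fun k : (H × AddChar H ℂ) × (H × AddChar H ℂ) => R.model k.1 k.2) R.adjoin_model
    (fun k => R.star_model k.1 k.2) (fun k => if k.1 = k.2 then 1 else 0)
    (fun k => by split_ifs <;> simp) (fun k i => by
      refine Eq.trans ?_ (sum_weylModel_one ρ k.1 k.2 i)
      rw [← R.incl_model]
      rfl)
  exact ⟨ε, fun x y => hε (x, y)⟩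

theorem exists_antipode :
    ∃ S : B →⋆ₐ[ℂ] Bᵐᵒᵖ, ∀ x y, S (R.model x y) = MulOpposite.op (R.model y x) := by
  obtain ⟨S, hS⟩ := _root_.exists_antipode R.incl R.incl_injective
    (fun k : (H × AddChar H ℂ) × (H × AddChar H ℂ) => R.model k.1 k.2)
    (fun k => R.model k.2 k.1) R.adjoin_model fun k => by
      rw [R.incl_model, R.incl_model, flipTranspose_weylModel]
  exact ⟨S, fun x y => hS (x, y)⟩

theorem model_mem_unitary : Matrix.of R.model ∈ unitary (Matrix (H × AddChar H ℂ) _ B) := by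
  refine magic_mem_unitary _ R.star_model (fun x y => R.incl_injective ?_)
    (fun x => R.incl_injective ?_) (fun y => R.incl_injective ?_)
  · change R.incl (R.model x y * R.model x y) = R.incl (R.model x y)
    rw [map_mul R.incl, R.incl_model, weylModel_mul_self]
  · change R.incl (∑ y, R.model x y) = R.incl 1
    rw [map_sum R.incl, map_one R.incl, ← sum_weylModel_right ρ x]
    exact Finset.sum_congr rfl fun y _ => R.incl_model x y
  · change R.incl (∑ x, R.model x y) = R.incl 1
    rw [map_sum R.incl, map_one R.incl, ← sum_weylModel_left ρ y]
    exact Finset.sum_congr rfl fun x _ => R.incl_model x y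

/-- The image of the Weyl matrix model is a Woronowicz algebra, with the random matrix trace as
Haar integration. -/
theorem exists_woronowiczAlgebra [MeasurableSpace G] [BorelSpace G]
    (μ : MeasureTheory.Measure G) [μ.IsHaarMeasure] [MeasureTheory.IsProbabilityMeasure μ]
    (φ : B →ₗ[ℂ] ℂ) (hφ : ∀ b, φ b = matrixIntegral μ (R.incl b)) :
    ∃ W : WoronowiczAlgebra (Matrix.of R.model), IsHaarIntegration W.comul φ := by
  obtain ⟨Δ, hΔ, hH⟩ := R.exists_comul_isHaarIntegration μ φ hφ
  obtain ⟨ε, hε⟩ := R.exists_counit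
  obtain ⟨S, hS⟩ := R.exists_antipode
  exact ⟨{ unitary := R.model_mem_unitary
           generates := R.adjoin_model
           comul := Δ
           comul_apply := hΔ
           counit := ε
           counit_apply := hε
           antipode := S
           antipode_apply := fun x y => (hS x y).trans
            (congrArg MulOpposite.op (R.star_model y x).symm) }, hH⟩

end TwirlRestriction

end WeylCounit

/-! ## Stationarity of the Weyl matrix models -/

theorem isometry_subtype_toProd {X : Type*} [TopologicalSpace X] [CompactSpace X]
    (S : StarSubalgebra ℂ C(X, ℂ)) [IsClosed (S : Set C(X, ℂ))] :
    Isometry (maxTensorToProd S.subtype S.subtype) :=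
  isometry_maxTensorToProd S.subtype S.subtype (fun _ _ => Subtype.ext (mul_comm _ _))
    (fun _ _ => Subtype.ext (mul_comm _ _)) (exists_eval_eq_character S) (exists_eval_eq_character S)

section WeylImage

variable {H : Type*} [AddCommGroup H] [Fintype H] [DecidableEq H]
  {G : Type*} [Group G] [TopologicalSpace G] [IsTopologicalGroup G] [CompactSpace G]
  (ρ : WeylRep H G) {M : Type*} [CStarAlgebra M]

/-- The twirling data given by a closed `*`-subalgebra generated by the model. -/
noncomputable def TwirlRestriction.ofSubalgebra
    (ι : M →⋆ₐ[ℂ] RandomMatrix (AddChar H ℂ × AddChar H ℂ) G) (hι : Function.Injective ι)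
    (tw : C(G, ℂ) →⋆ₐ[ℂ] CStarMatrix (AddChar H ℂ × AddChar H ℂ) (AddChar H ℂ × AddChar H ℂ) M)
    (htw : ∀ f k l, ι (tw f k l) = _root_.twirl ρ f k l)
    (B : StarSubalgebra ℂ M) [IsClosed (B : Set M)]
    (s : H × AddChar H ℂ → H × AddChar H ℂ → B)
    (hsB : ∀ x y, ι (s x y) = weylModel ρ x y)
    (hs : (StarAlgebra.adjoin ℂ (Set.range fun k : (H × AddChar H ℂ) × (H × AddChar H ℂ) =>
      s k.1 k.2)).topologicalClosure = ⊤) :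
    TwirlRestriction ρ B (cstarMatrixComap tw B) where
  incl := ι.comp B.subtype
  incl_injective := hι.comp Subtype.val_injective
  toFunctions := (cstarMatrixComap tw B).subtype
  toFunctions_injective := Subtype.val_injective
  isometry_toProd := isometry_subtype_toProd (cstarMatrixComap tw B)
  twirl := cstarMatrixRestrict tw B
  incl_twirl f k l := htw f k l
  coeff h h' := ⟨entryCoeff ρ h h', fun k k' => by
    -- The twirl of a coefficient has Fourier coefficients of the model as its nonzero entries.
    -- These are combinations of the generators, so the coefficient belongs to the algebra of
    -- functions twirled into `M_N(B)`.
    have hf : ∀ t r, ∃ b ∈ B, ι b = weylFourier ρ t r := fun t r =>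
      ⟨_, ((Fintype.card H : ℂ)⁻¹ • ∑ I : H × H, weylPairing I r • s (I.1, t.1) (I.2, t.2)).2, by
        rw [weylFourier_eq_sum_weylModel]
        simp [hsB]⟩
    have h1 := htw (entryCoeff ρ h h') k k'
    rw [twirl_entryCoeff] at h1
    split_ifs at h1
    · obtain ⟨b, hb, hb'⟩ := hf (k - h) (h - h')
      rwa [← hι (hb'.trans h1.symm)]
    · rw [hι (h1.trans (map_zero ι).symm)]
      exact zero_mem B⟩
  toFunctions_coeff h k := rfl
  model := s
  incl_model := hsB
  adjoin_model := hs

/-- The twirling data on the image of a matrix model which is given by the Weyl matrix model. -/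
noncomputable def TwirlRestriction.ofImage
    (ι : M →⋆ₐ[ℂ] RandomMatrix (AddChar H ℂ × AddChar H ℂ) G) (hι : Function.Injective ι)
    (tw : C(G, ℂ) →⋆ₐ[ℂ] CStarMatrix (AddChar H ℂ × AddChar H ℂ) (AddChar H ℂ × AddChar H ℂ) M)
    (htw : ∀ f k l, ι (tw f k l) = _root_.twirl ρ f k l)
    (π : QuantumPermAlgebra (H × AddChar H ℂ) →⋆ₐ[ℂ] M)
    (hπ : ∀ x y, ι (π (quantumPermCoord (H × AddChar H ℂ) x y)) = weylModel ρ x y) :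
    TwirlRestriction ρ (cstarImage π) (cstarMatrixComap tw (cstarImage π)) :=
  .ofSubalgebra ρ ι hι tw htw (cstarImage π)
    ((quantumPermCoord (H × AddChar H ℂ)).map (toCstarImage π)) hπ
    (adjoin_cstarImage_quantumPermCoord π)

theorem stationaryOnImage_of_weylModel [MeasurableSpace G] [BorelSpace G]
    (μ : MeasureTheory.Measure G) [μ.IsHaarMeasure] [MeasureTheory.IsProbabilityMeasure μ]
    (π : QuantumPermAlgebra (H × AddChar H ℂ) →⋆ₐ[ℂ]
      RandomMatrix (AddChar H ℂ × AddChar H ℂ) G)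
    (hπ : ∀ x y, π (quantumPermCoord (H × AddChar H ℂ) x y) = weylModel ρ x y) :
    StationaryOnImage (quantumPermCoord (H × AddChar H ℂ)) μ π :=
  (TwirlRestriction.ofImage ρ (StarAlgHom.id ℂ (RandomMatrix (AddChar H ℂ × AddChar H ℂ) G))
    Function.injective_id (twirl ρ) (fun _ _ _ => rfl) π hπ).exists_woronowiczAlgebra μ _
    fun _ => rfl

end WeylImage

/-! ### From projections to the explicit model -/

section WeylSubgroup

variable {H : Type*} [AddCommGroup H] [Fintype H]
  (E : Subgroup (Matrix.unitaryGroup (AddChar H ℂ) ℂ)) [CompactSpace E]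
  (hE : ∀ (i : H) (a : AddChar H ℂ), weylUnitary i a ∈ E)

/-- The standard representation of a subgroup of `U_n` which contains the Weyl matrices. -/
noncomputable def weylRepOfSubgroup : WeylRep H E where
  toHom := (Matrix.unitaryGroup (AddChar H ℂ) ℂ).subtype.comp E.subtype
  continuous_toHom := continuous_subtype_val.comp continuous_subtype_val
  mem_unitary g := g.1.2
  weyl i a := ⟨weylUnitary i a, hE i a⟩
  toHom_weyl _ _ := rfl

/-- The entries of the matrix model. -/
theorem weylProj_apply (x y : H × AddChar H ℂ) (b b' : AddChar H ℂ × AddChar H ℂ) :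
    weylProj E x y b b' = ((Fintype.card H : ℂ)⁻¹ * weylPairing (x.1, y.1) (b' - b)) •
      entryCoeff (weylRepOfSubgroup E hE) (b - (x.2, y.2)) (b' - (x.2, y.2)) := by
  ext U
  have hn := sum_norm_sq_unitary (weylUnitary x.1 x.2 * U.1 * star (weylUnitary y.1 y.2))
  rw [AddChar.card_eq] at hn
  change projMatrix (matVec (weylMatrix x.1 x.2 * (U.1 : Matrix (AddChar H ℂ) (AddChar H ℂ) ℂ) *
          star (weylMatrix y.1 y.2))) b b' = _ * entryCoeff (weylRepOfSubgroup E hE) _ _ U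
  have hn' : ∑ m, ‖matVec (weylMatrix x.1 x.2 * (U.1 : Matrix (AddChar H ℂ) (AddChar H ℂ) ℂ) *
          star (weylMatrix y.1 y.2)) m‖ ^ 2 = (Fintype.card H : ℝ) := hn
  have hU : (weylRepOfSubgroup E hE).toHom U =
    (U.1 : Matrix (AddChar H ℂ) (AddChar H ℂ) ℂ) := rfl
  rw [projMatrix_apply, hn', entryCoeff_apply, hU]
  simp only [matVec, mul_star_weylMatrix_apply, weylMatrix_mul_apply,
    weylPairing, Prod.fst_sub, Prod.snd_sub, star_mul', RCLike.star_def, ← AddChar.map_neg_eq_conj,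
    AddChar.sub_apply, neg_neg]
  simp only [Complex.ofReal_natCast]
  -- The phases depending on the dual indices of `x` and `y` occur once in the vector and once
  -- conjugated, so they cancel; only the phases in `b' - b` survive.
  have e1 := weylPairing_mul_neg (x.1, y.1) (x.2, y.2)
  simp only [weylPairing, Prod.fst_neg, Prod.snd_neg, AddChar.neg_apply, neg_neg] at e1
  field_simp
  linear_combination ((U.1 : Matrix (AddChar H ℂ) (AddChar H ℂ) ℂ) (b.1 - x.2) (b.2 - y.2) *
    (starRingEnd ℂ) ((U.1 : Matrix (AddChar H ℂ) (AddChar H ℂ) ℂ) (b'.1 - x.2) (b'.2 - y.2)) *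
    (b.1 x.1 * b'.1 (-x.1) * b.2 (-y.1) * b'.2 y.1)) * e1

theorem weylProj_eq_weylModel (x y : H × AddChar H ℂ) :
    weylProj E x y = weylModel (weylRepOfSubgroup E hE) x y :=
  CStarMatrix.ext fun b b' => weylProj_apply E hE x y b b'

end WeylSubgroup

theorem theorem16p17 {H : Type*} [AddCommGroup H] [Fintype H] [DecidableEq H]
    (E : Subgroup (Matrix.unitaryGroup (AddChar H ℂ) ℂ)) [CompactSpace E]
    (hE : ∀ (i : H) (a : AddChar H ℂ), weylUnitary i a ∈ E)
    [MeasurableSpace E] [BorelSpace E] (μ : MeasureTheory.Measure E)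
    [μ.IsHaarMeasure] [MeasureTheory.IsProbabilityMeasure μ] :
    (∃! π : QuantumPermAlgebra (H × AddChar H ℂ) →⋆ₐ[ℂ]
        RandomMatrix (AddChar H ℂ × AddChar H ℂ) E,
      ∀ x y, π (quantumPermCoord (H × AddChar H ℂ) x y) = weylProj E x y) ∧
    ∀ π : QuantumPermAlgebra (H × AddChar H ℂ) →⋆ₐ[ℂ]
        RandomMatrix (AddChar H ℂ × AddChar H ℂ) E,
      (∀ x y, π (quantumPermCoord (H × AddChar H ℂ) x y) = weylProj E x y) →
        StationaryOnImage (quantumPermCoord (H × AddChar H ℂ)) μ π := by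
  have hw : ∀ x y, weylProj E x y = weylModel (weylRepOfSubgroup E hE) x y :=
    weylProj_eq_weylModel E hE
  refine ⟨?_, fun π hπ => stationaryOnImage_of_weylModel (weylRepOfSubgroup E hE) μ π
    fun x y => (hπ x y).trans (hw x y)⟩
  refine existsUnique_quantumPermAlgebra_lift (Matrix.of fun x y => weylProj E x y)
    (fun x y => ?_) (fun x y => ?_) (fun x => ?_) (fun y => ?_) <;>
    simp only [Matrix.of_apply, hw]
  · exact star_weylModel _ x y
  · exact weylModel_mul_self _ x y
  · exact sum_weylModel_right _ x
  · exact sum_weylModel_left _ y
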